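/- Formulas are first-order formulas in the language of rings $\mathfrak L_{\rm ring}=\{+,-,\cdot,0,1\}$, and ${\rm Var}(\varphi)$ is the set of free variables of $\varphi$. A fragment is a set of formulas that contains $\top$ and $\bot$ and is closed under $\wedge$, $\vee$ and free variable substitution. For a set of formulas $\mathsf F$ and $Q\in\{\forall,\exists\}$ let $Q_1[\mathsf F]=\mathsf F\cup\{Qx\,\psi:\psi\in\mathsf F,\ x\text{ a variable}\}$ and $Q_{m+1}[\mathsf F]=Q_1[Q_m[\mathsf F]]$; let $Q^1\mathsf F$ be the smallest fragment containing $Q_1[\mathsf F]$, let $Q^{m+1}\mathsf F=Q^1(Q^m\mathsf F)$, and $Q\mathsf F=\bigcup_{m\ge1}Q^m\mathsf F$. With $\mathsf F_0$ the set of quantifier-free formulas, $\exists,\exists\forall,\exists\forall\exists,\dots$ denote $\exists\mathsf F_0,\ \exists(\forall\mathsf F_0),\ \exists(\forall(\exists\mathsf F_0)),\dots$. For a ring $R$, ${\rm Th}_{\mathsf F}(R)$ is the set of sentences in $\mathsf F$ that hold in $R$. **Proposition 4.6.** Let $\mathsf F\in\{\exists,\exists\forall,\exists\forall\exists,\dots\}$.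 For every prime $p$, all integers $n\ge 0$ and $d\ge 1$, and every formula $\gamma(x)\in\exists$ (with at most one free variable $x$), there exists a map $$\tau=\tau_{p,n,d,\gamma}\colon\ \forall\mathsf F\longrightarrow\forall_{d+1}[\mathsf F]$$ with ${\rm Var}(\tau\varphi)={\rm Var}(\varphi)$ for all $\varphi\in\forall\mathsf F$, such that the following holds for every geometrically integral $\mathbb F_p$-variety $X$ of dimension $d$ and every field $k$ of characteristic $p$ with $[k:k^p]=p^n$ for which $\gamma$ defines $k$ in the function field $k(X)$ of $X_k=X\times_{\mathbb F_p}k$, i.e. $\gamma(k(X))=k$: for every $\varphi(u_1,\dots,u_m)\in\forall\mathsf F$ with free variables $u_1,\dots,u_m$, $$k(X)\models\Big(\varphi\wedge\bigwedge_{i=1}^m\gamma(u_i)\Big)\leftrightarrow\tau\varphi ;$$ in particular ${\rm Th}_{\forall\mathsf F}(k(X))=\tau^{-1}\big({\rm Th}_{\forall_{d+1}[\mathsf F]}(k(X))\big)$. Moreover $\tau$ is computable uniformly in $p$, $n$, $d$ and $\gamma$: for each $\mathsf F$, the map $(p,n,d,\gamma,\varphi)\mapsto\tau_{p,n,d,\gamma}\varphi$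 can be chosen computable with respect to a standard Gödel numbering of formulas. -/

import Mathlib

universe u

/-! ## First-order formulas in the language of rings

Terms and formulas are built from named variables, which are indexed by `ℕ`. The symbols of
the language are `+`, `-` (unary), `·`, `0`, `1`; the logical symbols are
`⊤`, `⊥`, `=`, `¬`, `∧`, `∨`, `∀`, `∃`. -/

/-- Terms of the language of rings. -/
inductive RingTerm : Type
  | var (i : ℕ)
  | zero
  | one
  | neg (t : RingTerm)
  | add (s t : RingTerm)
  | mul (s t : RingTerm)

/-- Formulas of the language of rings. -/
inductive RingFormula : Type
  | verum
  | falsum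
  | eq (s t : RingTerm)
  | neg (φ : RingFormula)
  | and (φ ψ : RingFormula)
  | or (φ ψ : RingFormula)
  | all (x : ℕ) (φ : RingFormula)
  | ex (x : ℕ) (φ : RingFormula)

namespace RingTerm

/-- The variables that occur in a term. -/
def vars : RingTerm → Finset ℕ
  | var i => {i}
  | zero => ∅
  | one => ∅
  | neg t => t.vars
  | add s t => s.vars ∪ t.vars
  | mul s t => s.vars ∪ t.vars

/-- Renaming of variables. -/
def rename (σ : ℕ → ℕ) : RingTerm → RingTerm
  | var i => var (σ i)
  | zero => zero
  | one => one
  | neg t => neg (t.rename σ)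
  | add s t => add (s.rename σ) (t.rename σ)
  | mul s t => mul (s.rename σ) (t.rename σ)

/-- The value of a term in a ring under an assignment of the variables. -/
def eval {R : Type u} [CommRing R] (v : ℕ → R) : RingTerm → R
  | var i => v i
  | zero => 0
  | one => 1
  | neg t => -t.eval v
  | add s t => s.eval v + t.eval v
  | mul s t => s.eval v * t.eval v

/-- Gödel number of a term. -/
def code : RingTerm → ℕ
  | var i => Nat.pair 0 i
  | zero => Nat.pair 1 0
  | one => Nat.pair 2 0
  | neg t => Nat.pair 3 t.code
  | add s t => Nat.pair 4 (Nat.pair s.code t.code)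
  | mul s t => Nat.pair 5 (Nat.pair s.code t.code)

theorem code_injective : Function.Injective code := by
  intro s
  induction s <;> intro t h <;> cases t <;> simp only [code, Nat.pair_eq_pair] at h <;> grind

end RingTerm

namespace RingFormula

/-- The set `Var(φ)` of free variables of a formula. -/
def freeVars : RingFormula → Finset ℕ
  | verum => ∅
  | falsum => ∅
  | eq s t => s.vars ∪ t.vars
  | neg φ => φ.freeVars
  | and φ ψ => φ.freeVars ∪ ψ.freeVars
  | or φ ψ => φ.freeVars ∪ ψ.freeVars
  | all x φ => φ.freeVars.erase x
  | ex x φ => φ.freeVars.erase x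

/-- Satisfaction of a formula in a ring under an assignment of the variables. -/
def Realize {R : Type u} [CommRing R] : RingFormula → (ℕ → R) → Prop
  | verum, _ => True
  | falsum, _ => False
  | eq s t, v => s.eval v = t.eval v
  | neg φ, v => ¬ φ.Realize v
  | and φ ψ, v => φ.Realize v ∧ ψ.Realize v
  | or φ ψ, v => φ.Realize v ∨ ψ.Realize v
  | all x φ, v => ∀ a : R, φ.Realize (Function.update v x a)
  | ex x φ, v => ∃ a : R, φ.Realize (Function.update v x a)

/-- Gödel number of a formula. -/
def code : RingFormula → ℕ
  | verum => Nat.pair 0 0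
  | falsum => Nat.pair 1 0
  | eq s t => Nat.pair 2 (Nat.pair s.code t.code)
  | neg φ => Nat.pair 3 φ.code
  | and φ ψ => Nat.pair 4 (Nat.pair φ.code ψ.code)
  | or φ ψ => Nat.pair 5 (Nat.pair φ.code ψ.code)
  | all x φ => Nat.pair 6 (Nat.pair x φ.code)
  | ex x φ => Nat.pair 7 (Nat.pair x φ.code)

theorem code_injective : Function.Injective code := by
  intro φ
  induction φ <;> intro ψ h <;> cases ψ <;> simp only [code, Nat.pair_eq_pair] at h <;>
    grind [RingTerm.code_injective.eq_iff]

/-- The bound variable to use in place of `x` when the variables in `S` must not be captured: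
`x` itself if possible, and otherwise a variable that is larger than all those in `S`. -/
def boundName (x : ℕ) (S : Finset ℕ) : ℕ :=
  if x ∈ S then S.sup id + 1 else x

/-- Free variable substitution: every free occurrence of the variable `i` is replaced by the
variable `σ i`, and bound variables are renamed where this is needed to avoid a capture. -/
def rename : (ℕ → ℕ) → RingFormula → RingFormula
  | _, verum => verum
  | _, falsum => falsum
  | σ, eq s t => eq (s.rename σ) (t.rename σ)
  | σ, neg φ => neg (φ.rename σ)
  | σ, and φ ψ => and (φ.rename σ) (ψ.rename σ)
  | σ, or φ ψ => or (φ.rename σ) (ψ.rename σ)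
  | σ, all x φ =>
    all (boundName x ((φ.freeVars.erase x).image σ))
      (φ.rename (Function.update σ x (boundName x ((φ.freeVars.erase x).image σ))))
  | σ, ex x φ =>
    ex (boundName x ((φ.freeVars.erase x).image σ))
      (φ.rename (Function.update σ x (boundName x ((φ.freeVars.erase x).image σ))))

/-- A formula without quantifiers. -/
def IsQuantifierFree : RingFormula → Prop
  | verum => True
  | falsum => True
  | eq _ _ => True
  | neg φ => φ.IsQuantifierFree
  | and φ ψ => φ.IsQuantifierFree ∧ ψ.IsQuantifierFree
  | or φ ψ => φ.IsQuantifierFree ∧ ψ.IsQuantifierFree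
  | all _ _ => False
  | ex _ _ => False

/-- The set `{a ∈ R : R ⊨ γ(a)}` defined in `R` by a formula `γ = γ(x)` with at most one free
variable `x`. All variables are assigned the value `a`, so that `x` need not be named. -/
def definedSet (γ : RingFormula) (R : Type u) [CommRing R] : Set R :=
  {a | γ.Realize fun _ => a}

/-! ## Fragments -/

/-- A fragment: a set of formulas that contains `⊤` and `⊥` and is closed under conjunction,
disjunction and free variable substitution. -/
structure IsFragment (F : Set RingFormula) : Prop where
  verum_mem : verum ∈ F
  falsum_mem : falsum ∈ F
  and_mem : ∀ φ ∈ F, ∀ ψ ∈ F, and φ ψ ∈ F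
  or_mem : ∀ φ ∈ F, ∀ ψ ∈ F, or φ ψ ∈ F
  rename_mem : ∀ φ ∈ F, ∀ σ : ℕ → ℕ, rename σ φ ∈ F

/-- The smallest fragment containing `S`. -/
def fragmentClosure (S : Set RingFormula) : Set RingFormula :=
  ⋂₀ {F | IsFragment F ∧ S ⊆ F}

/-- The two quantifiers. -/
inductive Quantifier : Type
  | all
  | ex

/-- The formula `Q x φ`. -/
def quantify : Quantifier → ℕ → RingFormula → RingFormula
  | .all, x, φ => all x φ
  | .ex, x, φ => ex x φ

/-- `F₀`: the quantifier-free formulas. -/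
def quantifierFree : Set RingFormula := {φ | φ.IsQuantifierFree}

/-- `Q₁[F] = {Q x ψ : ψ ∈ F, x a variable} ∪ F`. -/
def bracketOne (Q : Quantifier) (F : Set RingFormula) : Set RingFormula :=
  {φ | ∃ x, ∃ ψ ∈ F, φ = quantify Q x ψ} ∪ F

/-- `Qₙ[F]`, that is `Q₁[Q₁[⋯[F]]]` (and `F` for `n = 0`). -/
def bracket (Q : Quantifier) : ℕ → Set RingFormula → Set RingFormula
  | 0, F => F
  | n + 1, F => bracketOne Q (bracket Q n F)

/-- `Q₁F`: the smallest fragment containing `Q₁[F]`. -/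
def one (Q : Quantifier) (F : Set RingFormula) : Set RingFormula :=
  fragmentClosure (bracketOne Q F)

/-- `Qⁿ F`, that is `Q₁ Q₁ ⋯ F` (and `F` for `n = 0`). -/
def power (Q : Quantifier) : ℕ → Set RingFormula → Set RingFormula
  | 0, F => F
  | n + 1, F => one Q (power Q n F)

/-- `Q F`: the union of all `Qⁿ F`, `n ≥ 1`. -/
def unbounded (Q : Quantifier) (F : Set RingFormula) : Set RingFormula :=
  ⋃ n : ℕ, power Q (n + 1) F

/-- The fragment `Q Q' Q ⋯ F₀` given by an alternating word of length `l` in the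
quantifiers, the leftmost of which is the given one. -/
def alternating : Quantifier → ℕ → Set RingFormula
  | _, 0 => quantifierFree
  | .ex, l + 1 => unbounded .ex (alternating .all l)
  | .all, l + 1 => unbounded .all (alternating .ex l)

/-- The existential formulas. -/
def existential : Set RingFormula := unbounded .ex quantifierFree

/-- `Th_F(R)`: the sentences in `F` that hold in `R`. -/
def theoryIn (F : Set RingFormula) (R : Type u) [CommRing R] : Set RingFormula :=
  {φ | φ ∈ F ∧ φ.freeVars = ∅ ∧ ∀ v : ℕ → R, φ.Realize v}

end RingFormula

/-! ## Function fields of varieties over the prime field -/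

noncomputable section

namespace PrimeVariety

open AlgebraicGeometry CategoryTheory Limits

/-- The prime field `𝔽_p`, in an arbitrary universe. -/
abbrev primeField (p : ℕ) : CommRingCat.{u} := .of (ULift.{u} (ZMod p))

/-- The embedding of `𝔽_p` into a field of characteristic `p`. -/
def primeFieldMap (p : ℕ) (k : Type u) [Field k] [CharP k p] :
    primeField.{u} p ⟶ CommRingCat.of k :=
  CommRingCat.ofHom ((ZMod.castHom (dvd_refl p) k).comp ULift.ringEquiv.toRingHom)

variable {p : ℕ} {X : Scheme.{u}} (s : X ⟶ Spec (primeField.{u} p))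
  (k : Type u) [Field k] [CharP k p]

/-- The base change `X_k` of an `𝔽_p`-scheme `X` to a field `k` of characteristic `p`. -/
abbrev baseChange : Scheme.{u} := pullback s (Spec.map (primeFieldMap p k))

instance isIntegral_baseChange [GeometricallyIntegral s] : IsIntegral (baseChange s k) :=
  pullback_of_geometrically GeometricallyIntegral.geometrically_isIntegral k _

/-- The field `k(X)`: the function field of `X_k`. -/
abbrev functionField [GeometricallyIntegral s] : Type u := (baseChange s k).functionField

/-- The canonical homomorphism from `k` to `k(X)`: the structure morphism `X_k ⟶ Spec k`
on global sections, followed by the map to the stalk at the generic point. -/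
def constantMap [GeometricallyIntegral s] : k →+* functionField s k :=
  ((Scheme.ΓSpecIso (CommRingCat.of k)).inv ≫
    (pullback.snd s (Spec.map (primeFieldMap p k))).appTop ≫
    (baseChange s k).presheaf.germ ⊤ (genericPoint (baseChange s k)) trivial).hom

end PrimeVariety

end

/-! Put `K = k(X)`, `q = p ^ 2` and `N = p ^ (2 * n)`, the degree of `k` over its subfield of `q`-th
powers. Let `t` be a separating transcendence basis of the function field of `X` over `𝔽_p`, and `b`
a basis of `k` over `k^q`. The products of the `b j` with the monomials in `t` with exponents below
`q` form a basis of `K` over `K^q` (`IsGenericCompositum.exists_isDigitBasis`). An element of `K`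
thus carries `q ^ d * N` arbitrary coordinates in `K`, the `q`-th roots of its coefficients, so that
one element can encode a pair. Consequently all outer universal quantifiers collapse into one: `∀ y
z, ψ` becomes `∀ x, ∃ y z, (x decodes to (y, z)) ∧ ψ`, and the new existential quantifiers are
absorbed by `F`. With `d` further universal quantifiers for `t` this makes `d + 1`.

The collapse does not need decoding to be a function. By `realize_absorb` it suffices that every
element decodes to some pair, and that every pair has a code that decodes to this pair only.

What is said about `t` and `b` must be existential. That `t` is unsuitable is expressed by a
nontrivial relation between its monomials over the compositum of `k` and `K^q`; this becomes a
disjunct. By a dimension count every other `t` gives a basis (`IsDigitBasis.of_not_digitDependent`).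
That constants form a basis of `k` over `k^q` is not expressed at all: decoding allows any constants
`c j` with `c 0 = 1`. Instead, a code contains, as its coordinates at the monomial `1`, elements
that are linearly independent over `k`. They force the matrix that relates `c` to `b` to be
invertible, which makes the decoding of this code unique (`IsDigitBasis.exists_code`). The entries
of the pair sit at two further monomials, so `q ^ d > 2` is required; `q = p` would fail for `p =
2`, `d = 1`.

Computability holds because each construction on formulas is mirrored by a primitive recursive
function on Gödel numbers. -/

/-! ## Syntax and semantics of formulas -/

namespace RingTerm

theorem eval_congr {R : Type u} [CommRing R] {v w : ℕ → R} (t : RingTerm)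
    (h : ∀ i ∈ t.vars, v i = w i) : t.eval v = t.eval w := by
  induction t <;> simp_all [vars, eval]

theorem le_code_of_mem_vars {t : RingTerm} {i : ℕ} (h : i ∈ t.vars) : i ≤ t.code := by
  induction t with
  | var j => simp_all [vars, code, Nat.right_le_pair]
  | zero => simp [vars] at h
  | one => simp [vars] at h
  | neg t ih => exact (ih h).trans (Nat.right_le_pair _ _)
  | add s t ihs iht | mul s t ihs iht =>
    refine le_trans ?_ (Nat.right_le_pair _ _)
    rcases Finset.mem_union.1 h with h | h
    · exact (ihs h).trans (Nat.left_le_pair _ _)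
    · exact (iht h).trans (Nat.right_le_pair _ _)

end RingTerm

namespace RingFormula

theorem realize_congr {R : Type u} [CommRing R] (φ : RingFormula) {v w : ℕ → R}
    (h : ∀ i ∈ φ.freeVars, v i = w i) : φ.Realize v ↔ φ.Realize w := by
  induction φ generalizing v w with
  | verum => rfl
  | falsum => rfl
  | eq s t =>
    simp only [freeVars, Finset.mem_union] at h
    simp only [Realize]
    rw [s.eval_congr fun i hi => h i (.inl hi), t.eval_congr fun i hi => h i (.inr hi)]
  | neg φ ih => exact not_congr (ih h)
  | and φ ψ ihφ ihψ =>
    simp only [freeVars, Finset.mem_union] at h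
    exact and_congr (ihφ fun i hi => h i (.inl hi)) (ihψ fun i hi => h i (.inr hi))
  | or φ ψ ihφ ihψ =>
    simp only [freeVars, Finset.mem_union] at h
    exact or_congr (ihφ fun i hi => h i (.inl hi)) (ihψ fun i hi => h i (.inr hi))
  | all x φ ih =>
    refine forall_congr' fun a => ih fun i hi => ?_
    by_cases hx : i = x
    · simp [hx]
    · simpa [hx] using h i (Finset.mem_erase.2 ⟨hx, hi⟩)
  | ex x φ ih =>
    refine exists_congr fun a => ih fun i hi => ?_
    by_cases hx : i = x
    · simp [hx]
    · simpa [hx] using h i (Finset.mem_erase.2 ⟨hx, hi⟩)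

/-- Makes Gödel numbers a computable source of fresh variables: any number above the code of a
formula is not free in it. -/
theorem le_code_of_mem_freeVars {φ : RingFormula} {i : ℕ} (h : i ∈ φ.freeVars) : i ≤ φ.code := by
  induction φ with
  | verum => simp [freeVars] at h
  | falsum => simp [freeVars] at h
  | eq s t =>
    refine le_trans ?_ (Nat.right_le_pair _ _)
    rcases Finset.mem_union.1 h with h | h
    · exact (RingTerm.le_code_of_mem_vars h).trans (Nat.left_le_pair _ _)
    · exact (RingTerm.le_code_of_mem_vars h).trans (Nat.right_le_pair _ _)
  | neg φ ih => exact (ih h).trans (Nat.right_le_pair _ _)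
  | and s t ihs iht | or s t ihs iht =>
    refine le_trans ?_ (Nat.right_le_pair _ _)
    rcases Finset.mem_union.1 h with h | h
    · exact (ihs h).trans (Nat.left_le_pair _ _)
    · exact (iht h).trans (Nat.right_le_pair _ _)
  | all x φ ih | ex x φ ih =>
    exact (ih (Finset.mem_of_mem_erase h)).trans
      ((Nat.right_le_pair _ _).trans (Nat.right_le_pair _ _))

/-! ## Fragments generated by quantifiers -/

/-- The formulas obtained from those in `F` by `∧`, `∨` and the quantifier `Q`. -/
inductive Generated (Q : Quantifier) (F : Set RingFormula) : RingFormula → Prop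
  | base {φ : RingFormula} (h : φ ∈ F) : Generated Q F φ
  | and {φ ψ : RingFormula} (hφ : Generated Q F φ) (hψ : Generated Q F ψ) :
      Generated Q F (and φ ψ)
  | or {φ ψ : RingFormula} (hφ : Generated Q F φ) (hψ : Generated Q F ψ) :
      Generated Q F (or φ ψ)
  | quantify (x : ℕ) {φ : RingFormula} (hφ : Generated Q F φ) : Generated Q F (quantify Q x φ)

theorem Generated.rename {Q : Quantifier} {F : Set RingFormula} (hF : IsFragment F)
    {φ : RingFormula} (h : Generated Q F φ) (σ : ℕ → ℕ) :
    Generated Q F (RingFormula.rename σ φ) := by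
  induction h generalizing σ with
  | base h => exact .base (hF.rename_mem _ h σ)
  | and _ _ ih₁ ih₂ => exact .and (ih₁ σ) (ih₂ σ)
  | or _ _ ih₁ ih₂ => exact .or (ih₁ σ) (ih₂ σ)
  | quantify x _ ih => cases Q <;> exact .quantify _ (ih _)

theorem isFragment_generated (Q : Quantifier) {F : Set RingFormula} (hF : IsFragment F) :
    IsFragment {φ | Generated Q F φ} where
  verum_mem := .base hF.verum_mem
  falsum_mem := .base hF.falsum_mem
  and_mem _ h _ h' := .and h h'
  or_mem _ h _ h' := .or h h'
  rename_mem _ h σ := h.rename hF σ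

theorem subset_fragmentClosure (S : Set RingFormula) : S ⊆ fragmentClosure S :=
  Set.subset_sInter fun _ h => h.2

theorem isFragment_fragmentClosure (S : Set RingFormula) : IsFragment (fragmentClosure S) where
  verum_mem _ h := h.1.verum_mem
  falsum_mem _ h := h.1.falsum_mem
  and_mem φ hφ ψ hψ F h := h.1.and_mem φ (hφ F h) ψ (hψ F h)
  or_mem φ hφ ψ hψ F h := h.1.or_mem φ (hφ F h) ψ (hψ F h)
  rename_mem φ hφ σ F h := h.1.rename_mem φ (hφ F h) σ

theorem power_subset_succ (Q : Quantifier) (F : Set RingFormula) (n : ℕ) :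
    power Q n F ⊆ power Q (n + 1) F :=
  Set.subset_union_right.trans (subset_fragmentClosure _)

theorem power_mono (Q : Quantifier) (F : Set RingFormula) : Monotone fun n => power Q n F :=
  monotone_nat_of_le_succ (power_subset_succ Q F)

/-- Replaces iterated fragment closures by one inductive predicate, which allows case analysis on
the last step. Closure under renaming need not be imposed: it is inherited from `F`, because
renaming respects the shape of a formula. -/
theorem unbounded_eq_generated (Q : Quantifier) {F : Set RingFormula} (hF : IsFragment F) :
    unbounded Q F = {φ | Generated Q F φ} := by
  refine Set.Subset.antisymm (Set.iUnion_subset fun n => ?_) fun φ h => ?_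
  · have : ∀ m, power Q m F ⊆ {φ | Generated Q F φ} := by
      intro m
      induction m with
      | zero => exact fun _ => .base
      | succ m ih =>
        refine Set.sInter_subset_of_mem ⟨isFragment_generated Q hF, ?_⟩
        rintro φ (⟨x, ψ, hψ, rfl⟩ | hφ)
        exacts [.quantify x (ih hψ), ih hφ]
    exact this _
  -- The powers form a chain, so two formulas lie at a common level.
  · have key : ∀ {φ ψ}, φ ∈ unbounded Q F → ψ ∈ unbounded Q F →
        ∃ n, φ ∈ power Q (n + 1) F ∧ ψ ∈ power Q (n + 1) F := by
      intro φ ψ hφ hψ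
      obtain ⟨m, hm⟩ := Set.mem_iUnion.1 hφ
      obtain ⟨n, hn⟩ := Set.mem_iUnion.1 hψ
      exact ⟨max m n, power_mono Q F (by omega) hm, power_mono Q F (by omega) hn⟩
    induction h with
    | base h => exact Set.mem_iUnion.2 ⟨0, power_subset_succ Q F 0 h⟩
    | and _ _ ih₁ ih₂ =>
      obtain ⟨n, h₁, h₂⟩ := key ih₁ ih₂
      exact Set.mem_iUnion.2 ⟨n, (isFragment_fragmentClosure _).and_mem _ h₁ _ h₂⟩
    | or _ _ ih₁ ih₂ =>
      obtain ⟨n, h₁, h₂⟩ := key ih₁ ih₂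
      exact Set.mem_iUnion.2 ⟨n, (isFragment_fragmentClosure _).or_mem _ h₁ _ h₂⟩
    | quantify x _ ih =>
      obtain ⟨n, h, -⟩ := key ih ih
      exact Set.mem_iUnion.2 ⟨n + 1, subset_fragmentClosure _ (.inl ⟨x, _, h, rfl⟩)⟩

theorem IsQuantifierFree.rename {φ : RingFormula} (h : φ.IsQuantifierFree) (σ : ℕ → ℕ) :
    (φ.rename σ).IsQuantifierFree := by
  induction φ <;> simp_all [RingFormula.rename, IsQuantifierFree]

theorem isFragment_quantifierFree : IsFragment quantifierFree where
  verum_mem := trivial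
  falsum_mem := trivial
  and_mem _ h _ h' := ⟨h, h'⟩
  or_mem _ h _ h' := ⟨h, h'⟩
  rename_mem _ h σ := IsQuantifierFree.rename h σ

theorem isFragment_unbounded (Q : Quantifier) {F : Set RingFormula} (hF : IsFragment F) :
    IsFragment (unbounded Q F) := by
  rw [unbounded_eq_generated Q hF]
  exact isFragment_generated Q hF

theorem isFragment_alternating (Q : Quantifier) (l : ℕ) : IsFragment (alternating Q l) := by
  induction l generalizing Q with
  | zero => cases Q <;> exact isFragment_quantifierFree
  | succ l ih => cases Q <;> exact isFragment_unbounded _ (ih _)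

theorem subset_unbounded (Q : Quantifier) (F : Set RingFormula) : F ⊆ unbounded Q F := fun _ h =>
  Set.mem_iUnion.2 ⟨0, power_subset_succ Q F 0 h⟩

theorem quantify_mem_unbounded (Q : Quantifier) {F : Set RingFormula} (x : ℕ) {φ : RingFormula}
    (h : φ ∈ unbounded Q F) : quantify Q x φ ∈ unbounded Q F := by
  obtain ⟨n, hn⟩ := Set.mem_iUnion.1 h
  exact Set.mem_iUnion.2 ⟨n + 1, subset_fragmentClosure _ (.inl ⟨x, _, hn, rfl⟩)⟩

theorem unbounded_mono (Q : Quantifier) {F G : Set RingFormula} (hF : IsFragment F)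
    (hG : IsFragment G) (h : F ⊆ G) : unbounded Q F ⊆ unbounded Q G := by
  rw [unbounded_eq_generated Q hF, unbounded_eq_generated Q hG]
  intro φ hφ
  induction hφ with
  | base h' => exact .base (h h')
  | and _ _ ih₁ ih₂ => exact .and ih₁ ih₂
  | or _ _ ih₁ ih₂ => exact .or ih₁ ih₂
  | quantify x _ ih => exact .quantify x ih

theorem quantifierFree_subset_alternating (Q : Quantifier) (l : ℕ) :
    quantifierFree ⊆ alternating Q l := by
  induction l generalizing Q with
  | zero => cases Q <;> exact subset_rfl
  | succ l ih => cases Q <;> exact (ih _).trans (subset_unbounded _ _)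

theorem existential_subset_alternating (l : ℕ) : existential ⊆ alternating .ex (l + 1) :=
  unbounded_mono _ isFragment_quantifierFree (isFragment_alternating _ _)
    (quantifierFree_subset_alternating _ _)

/-- Closure of a set of formulas under immediate subformulas, except below negations. -/
structure SubformulaClosed (F : Set RingFormula) : Prop where
  of_and {φ ψ : RingFormula} : and φ ψ ∈ F → φ ∈ F ∧ ψ ∈ F
  of_or {φ ψ : RingFormula} : or φ ψ ∈ F → φ ∈ F ∧ ψ ∈ F
  of_quantify {Q : Quantifier} {x : ℕ} {φ : RingFormula} : quantify Q x φ ∈ F → φ ∈ F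

/-- Needed because `absorb` descends through `∧`, `∨` and `∀` without knowing where the part in `F`
begins, so it also enters formulas of `F`. -/
theorem subformulaClosed_unbounded (Q : Quantifier) {F : Set RingFormula} (hF : IsFragment F)
    (h : SubformulaClosed F) : SubformulaClosed (unbounded Q F) := by
  rw [unbounded_eq_generated Q hF]
  refine ⟨fun {φ ψ} hg => ?_, fun {φ ψ} hg => ?_, fun {Q' x φ} hg => ?_⟩
  · generalize hχ : and φ ψ = χ at hg
    cases hg with
    | base h' => subst hχ; exact ⟨.base (h.of_and h').1, .base (h.of_and h').2⟩
    | and h₁ h₂ => cases hχ; exact ⟨h₁, h₂⟩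
    | or => cases hχ
    | quantify => cases Q <;> cases hχ
  · generalize hχ : or φ ψ = χ at hg
    cases hg with
    | base h' => subst hχ; exact ⟨.base (h.of_or h').1, .base (h.of_or h').2⟩
    | or h₁ h₂ => cases hχ; exact ⟨h₁, h₂⟩
    | and => cases hχ
    | quantify => cases Q <;> cases hχ
  · generalize hχ : quantify Q' x φ = χ at hg
    cases hg with
    | base h' => subst hχ; exact .base (h.of_quantify h')
    | or h₁ h₂ => cases Q' <;> cases hχ
    | and => cases Q' <;> cases hχ
    | quantify y h' => cases Q <;> cases Q' <;> cases hχ <;> exact h'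

theorem subformulaClosed_quantifierFree : SubformulaClosed quantifierFree where
  of_and h := h
  of_or h := h
  of_quantify {Q x φ} h := by cases Q <;> exact h.elim

theorem subformulaClosed_alternating (Q : Quantifier) (l : ℕ) :
    SubformulaClosed (alternating Q l) := by
  induction l generalizing Q with
  | zero => cases Q <;> exact subformulaClosed_quantifierFree
  | succ l ih =>
    cases Q <;> exact subformulaClosed_unbounded _ (isFragment_alternating _ _) (ih _)

end RingFormula

namespace RingFormula

open Function (update)

/-! ## Absorbing universal quantifiers -/

/-- The formula `φ(v)` with `v` substituted for `u`, written as `∃ u (u = v ∧ φ)`. -/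
def rebind (u v : ℕ) (φ : RingFormula) : RingFormula :=
  ex u (and (eq (.var u) (.var v)) φ)

/-- Substitution in this form needs no renaming of bound variables, stays inside fragments closed
under `∃`, and acts simply on Gödel numbers. If `v` were `u`, the inner `v` would be captured. -/
theorem realize_rebind {R : Type u} [CommRing R] {u v : ℕ} (h : v ≠ u) (φ : RingFormula)
    (a : ℕ → R) : (rebind u v φ).Realize a ↔ φ.Realize (update a u (a v)) := by
  simp [rebind, Realize, RingTerm.eval, h]

theorem freeVars_rebind {u v : ℕ} (h : v ≠ u) (φ : RingFormula) :
    (rebind u v φ).freeVars = insert v (φ.freeVars.erase u) := by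
  ext i
  simp only [rebind, freeVars, RingTerm.vars, Finset.mem_erase, Finset.mem_union,
    Finset.mem_singleton, Finset.mem_insert]
  grind

/-- The formula `φ` with the variable `h` substituted for all variables below `m`. -/
def bindBelow (h : ℕ) (φ : RingFormula) (m : ℕ) : RingFormula :=
  m.rec φ fun i ψ => rebind i h ψ

theorem realize_bindBelow {R : Type u} [CommRing R] {h : ℕ} (φ : RingFormula) {m : ℕ}
    (hm : m ≤ h) (a : ℕ → R) :
    (bindBelow h φ m).Realize a ↔ φ.Realize fun i => if i < m then a h else a i := by
  induction m generalizing a with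
  | zero => simp [bindBelow]
  | succ m ih =>
    refine (realize_rebind (by omega) _ _).trans ((ih (by omega) _).trans (iff_of_eq ?_))
    congr 1
    ext i
    by_cases h1 : i < m
    · simp [h1, show i < m + 1 by omega, show h ≠ m by omega]
    · by_cases h2 : i = m
      · simp [h2]
      · simp [h1, h2, show ¬ i < m + 1 by omega]

theorem freeVars_bindBelow {h : ℕ} (φ : RingFormula) {m i : ℕ} (hm : m ≤ h)
    (hi : i ∈ (bindBelow h φ m).freeVars) : i = h ∨ i ∈ φ.freeVars ∧ m ≤ i := by
  induction m with
  | zero => exact .inr ⟨hi, Nat.zero_le _⟩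
  | succ m ih =>
    have : i ∈ (rebind m h (bindBelow h φ m)).freeVars := hi
    rw [freeVars_rebind (by omega)] at this
    grind

/-- The formula `γ(u)`, where `γ` has no free variables other than one below `m`, and `h` is an
auxiliary variable. -/
def member (γ : RingFormula) (m h u : ℕ) : RingFormula :=
  rebind h u (bindBelow h γ m)

/-- The name of the variable of `γ` need not be known: all variables below `m`, hence all free ones
of `γ`, receive the value of `u`, in agreement with the constant assignment in `definedSet`. -/
theorem realize_member {R : Type u} [CommRing R] {γ : RingFormula} {m h u : ℕ}
    (hγ : γ.code < m) (hm : m ≤ h) (hu : u ≠ h) (a : ℕ → R) :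
    (member γ m h u).Realize a ↔ a u ∈ γ.definedSet R := by
  rw [member, realize_rebind hu, realize_bindBelow _ hm]
  refine realize_congr _ fun i hi => ?_
  simp [(le_code_of_mem_freeVars hi).trans_lt hγ]

theorem freeVars_member {γ : RingFormula} {m h u : ℕ} (hγ : γ.code < m) (hm : m ≤ h)
    (hu : u ≠ h) : (member γ m h u).freeVars = {u} := by
  ext i
  rw [member, freeVars_rebind hu]
  simp only [Finset.mem_insert, Finset.mem_erase, Finset.mem_singleton, or_iff_left_iff_imp]
  rintro ⟨h1, h2⟩
  rcases freeVars_bindBelow γ hm h2 with h3 | ⟨h3, h4⟩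
  · exact absurd h3 h1
  · exact absurd (le_code_of_mem_freeVars h3) (by omega)

/-- The conjunction of the formulas `χ i` over the variables `i` of a term. -/
def termGuard (χ : ℕ → RingFormula) : RingTerm → RingFormula
  | .var i => χ i
  | .zero => verum
  | .one => verum
  | .neg t => termGuard χ t
  | .add s t => and (termGuard χ s) (termGuard χ t)
  | .mul s t => and (termGuard χ s) (termGuard χ t)

/-- The conjunction of the formulas `χ i` over the free variables `i` of a formula. -/
def guard (χ : ℕ → RingFormula) : RingFormula → RingFormula
  | verum => verum
  | falsum => verum
  | eq s t => and (termGuard χ s) (termGuard χ t)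
  | neg φ => guard χ φ
  | and φ ψ => and (guard χ φ) (guard χ ψ)
  | or φ ψ => and (guard χ φ) (guard χ ψ)
  | all x φ => ex x (guard χ φ)
  | ex x φ => ex x (guard χ φ)

theorem freeVars_termGuard {χ : ℕ → RingFormula} (t : RingTerm)
    (h : ∀ i ∈ t.vars, (χ i).freeVars = {i}) : (termGuard χ t).freeVars = t.vars := by
  induction t <;> simp_all [termGuard, RingTerm.vars, freeVars]

theorem realize_termGuard {R : Type u} [CommRing R] {χ : ℕ → RingFormula} {A : Set R}
    (t : RingTerm) (h : ∀ i ∈ t.vars, ∀ a : ℕ → R, (χ i).Realize a ↔ a i ∈ A) (a : ℕ → R) :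
    (termGuard χ t).Realize a ↔ ∀ i ∈ t.vars, a i ∈ A := by
  induction t <;> simp_all [termGuard, RingTerm.vars, Realize, or_imp, forall_and]

/-- Beyond imposing the conditions, the guard mentions every free variable of `φ`; this is what
makes the translation have exactly the same free variables. -/
theorem freeVars_guard {χ : ℕ → RingFormula} (φ : RingFormula)
    (h : ∀ i ≤ φ.code, (χ i).freeVars = {i}) : (guard χ φ).freeVars = φ.freeVars := by
  induction φ with
  | verum => rfl
  | falsum => rfl
  | eq s t =>
    have h1 := freeVars_termGuard s fun i hi =>
      h i (le_code_of_mem_freeVars (Finset.mem_union_left _ hi))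
    have h2 := freeVars_termGuard t fun i hi =>
      h i (le_code_of_mem_freeVars (Finset.mem_union_right _ hi))
    simp [guard, freeVars, h1, h2]
  | neg φ ih => exact ih fun i hi => h i (hi.trans (Nat.right_le_pair _ _))
  | and φ ψ ih₁ ih₂ | or φ ψ ih₁ ih₂ =>
    have h1 := ih₁ fun i hi => h i (hi.trans ((Nat.left_le_pair _ _).trans (Nat.right_le_pair _ _)))
    have h2 := ih₂ fun i hi =>
      h i (hi.trans ((Nat.right_le_pair _ _).trans (Nat.right_le_pair _ _)))
    simp [guard, freeVars, h1, h2]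
  | all x φ ih | ex x φ ih =>
    have h1 := ih fun i hi => h i (hi.trans ((Nat.right_le_pair _ _).trans (Nat.right_le_pair _ _)))
    simp [guard, freeVars, h1]

/-- Quantifiers of either kind become `∃`, whose only effect is to discard the condition on the
bound variable; nonemptiness of `A` provides the value. -/
theorem realize_guard {R : Type u} [CommRing R] {χ : ℕ → RingFormula} {A : Set R}
    (hA : A.Nonempty) (φ : RingFormula)
    (h : ∀ i ≤ φ.code, ∀ a : ℕ → R, (χ i).Realize a ↔ a i ∈ A) (a : ℕ → R) :
    (guard χ φ).Realize a ↔ ∀ i ∈ φ.freeVars, a i ∈ A := by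
  have quant : ∀ (x : ℕ) (ψ : RingFormula) (a : ℕ → R),
      (∃ b, ∀ i ∈ ψ.freeVars, update a x b i ∈ A) ↔ ∀ i ∈ ψ.freeVars.erase x, a i ∈ A := by
    intro x ψ a
    constructor
    · rintro ⟨b, hb⟩ i hi
      obtain ⟨h1, h2⟩ := Finset.mem_erase.1 hi
      simpa [h1] using hb i h2
    · intro hi
      obtain ⟨b, hb⟩ := hA
      refine ⟨b, fun i h2 => ?_⟩
      by_cases h1 : i = x
      · simpa [h1] using hb
      · simpa [h1] using hi i (Finset.mem_erase.2 ⟨h1, h2⟩)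
  induction φ generalizing a with
  | verum => simp [guard, freeVars, Realize]
  | falsum => simp [guard, freeVars, Realize]
  | eq s t =>
    have h1 := realize_termGuard s (fun i hi =>
      h i (le_code_of_mem_freeVars (Finset.mem_union_left _ hi))) a
    have h2 := realize_termGuard t (fun i hi =>
      h i (le_code_of_mem_freeVars (Finset.mem_union_right _ hi))) a
    simp [guard, freeVars, Realize, h1, h2, or_imp, forall_and]
  | neg φ ih => exact ih (fun i hi => h i (hi.trans (Nat.right_le_pair _ _))) a
  | and φ ψ ih₁ ih₂ | or φ ψ ih₁ ih₂ =>
    have h1 := ih₁ (fun i hi => h i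
      (hi.trans ((Nat.left_le_pair _ _).trans (Nat.right_le_pair _ _)))) a
    have h2 := ih₂ (fun i hi => h i
      (hi.trans ((Nat.right_le_pair _ _).trans (Nat.right_le_pair _ _)))) a
    simp [guard, freeVars, Realize, h1, h2, or_imp, forall_and]
  | all x φ ih | ex x φ ih =>
    have h1 := ih fun i hi => h i (hi.trans ((Nat.right_le_pair _ _).trans (Nat.right_le_pair _ _)))
    rw [freeVars, ← quant]
    exact exists_congr fun b => h1 _

/-- Replaces the outer universal quantifiers of a formula by a single universal quantifier over
the variable `w`, which is left free, by means of a formula `δ(w, w + 1, w + 2)` that decodes `w`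
as a pair. -/
def absorb (δ : RingFormula) (w : ℕ) : RingFormula → RingFormula
  | verum => verum
  | falsum => falsum
  | eq s t => eq s t
  | neg φ => neg φ
  | and φ ψ => and (absorb δ w φ) (absorb δ w ψ)
  | or φ ψ => ex (w + 1) (ex (w + 2) (and δ
      (or (rebind w (w + 1) (absorb δ w φ)) (rebind w (w + 2) (absorb δ w ψ)))))
  | all x φ => ex (w + 1) (ex (w + 2) (and δ
      (rebind x (w + 1) (rebind w (w + 2) (absorb δ w φ)))))
  | ex x φ => ex x φ

theorem freeVars_absorb {δ : RingFormula} {w : ℕ} (hδ : ∀ i ∈ δ.freeVars, w ≤ i) (φ : RingFormula)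
    (hw : φ.code < w) {i : ℕ} (hi : i ∈ (absorb δ w φ).freeVars) :
    i ∈ φ.freeVars ∨ i = w ∨ w + 3 ≤ i ∧ i ∈ δ.freeVars := by
  induction φ generalizing i with
  | verum => exact .inl hi
  | falsum => exact .inl hi
  | eq s t => exact .inl hi
  | neg φ _ => exact .inl hi
  | ex x φ _ => exact .inl hi
  | and φ ψ ih₁ ih₂ =>
    have l := (Nat.left_le_pair φ.code ψ.code).trans (Nat.right_le_pair 4 _)
    have r := (Nat.right_le_pair φ.code ψ.code).trans (Nat.right_le_pair 4 _)
    simp only [absorb, freeVars, Finset.mem_union] at hi ⊢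
    rcases hi with hi | hi
    · have := ih₁ (l.trans_lt hw) hi; tauto
    · have := ih₂ (r.trans_lt hw) hi; tauto
  | or φ ψ ih₁ ih₂ =>
    have l := ((Nat.left_le_pair φ.code ψ.code).trans (Nat.right_le_pair 5 _)).trans_lt hw
    have r := ((Nat.right_le_pair φ.code ψ.code).trans (Nat.right_le_pair 5 _)).trans_lt hw
    simp only [absorb, freeVars, freeVars_rebind (show w + 1 ≠ w by omega),
      freeVars_rebind (show w + 2 ≠ w by omega), Finset.mem_union, Finset.mem_erase,
      Finset.mem_insert] at hi ⊢
    obtain ⟨h1, h2, hi | (hi | ⟨-, hi⟩) | (hi | ⟨-, hi⟩)⟩ := hi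
    · have := hδ i hi
      by_cases hiw : i = w
      · exact .inr (.inl hiw)
      · exact .inr (.inr ⟨by omega, hi⟩)
    · exact absurd hi h1
    · have := ih₁ l hi; tauto
    · exact absurd hi h2
    · have := ih₂ r hi; tauto
  | all x φ ih =>
    have l := ((Nat.left_le_pair x φ.code).trans (Nat.right_le_pair 6 _)).trans_lt hw
    have r := ((Nat.right_le_pair x φ.code).trans (Nat.right_le_pair 6 _)).trans_lt hw
    simp only [absorb, freeVars, freeVars_rebind (show w + 1 ≠ x by omega),
      freeVars_rebind (show w + 2 ≠ w by omega), Finset.mem_union, Finset.mem_erase,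
      Finset.mem_insert] at hi ⊢
    obtain ⟨h1, h2, hi | hi | ⟨h3, hi | ⟨-, hi⟩⟩⟩ := hi
    · have := hδ i hi
      by_cases hiw : i = w
      · exact .inr (.inl hiw)
      · exact .inr (.inr ⟨by omega, hi⟩)
    · exact absurd hi h1
    · exact absurd hi h2
    · have := ih r hi; tauto

/-- Totality of `rel` passes from a true universal statement about pairs to one about codes.
Conversely, a counterexample pair has a code that decodes to nothing else, hence is a counterexample
itself. A universal quantifier commutes with `∧`, but for `∨` two independent variables must be
paired: `(∀ y, φ) ∨ (∀ z, ψ)` is `∀ y z, (φ ∨ ψ)`. The assignment `a₀` freezes the parameters of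
`δ`, since decoding behaves well only for suitable ones. -/
theorem realize_absorb {R : Type u} [CommRing R] {δ : RingFormula} {w : ℕ}
    (hδ : ∀ i ∈ δ.freeVars, w ≤ i) {a₀ : ℕ → R} {rel : R → R → R → Prop}
    (hrel : ∀ a : ℕ → R, (∀ i, w + 3 ≤ i → a i = a₀ i) →
      (δ.Realize a ↔ rel (a w) (a (w + 1)) (a (w + 2))))
    (total : ∀ x, ∃ y z, rel x y z)
    (exact : ∀ y z, ∃ x, ∀ y' z', rel x y' z' → y' = y ∧ z' = z)
    (φ : RingFormula) (hw : φ.code < w) (a : ℕ → R) (ha : ∀ i, w + 3 ≤ i → a i = a₀ i) :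
    φ.Realize a ↔ ∀ x, (absorb δ w φ).Realize (update a w x) := by
  -- Where the formula is left alone, `w` is not free in it and the quantifier over `w` is vacuous.
  have base : ∀ φ : RingFormula, φ.code < w → ∀ a : ℕ → R,
      (φ.Realize a ↔ ∀ x, φ.Realize (update a w x)) := by
    intro φ hw a
    have : ∀ x, φ.Realize (update a w x) ↔ φ.Realize a := fun x => realize_congr _ fun i hi => by
      have := le_code_of_mem_freeVars hi
      simp [show i ≠ w by omega]
    simp [this]
  -- The absorbed formula does not see `w + 1` and `w + 2`, so these names can be reused at every
  -- nested level.
  have congr : ∀ φ : RingFormula, φ.code < w → ∀ a b : ℕ → R,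
      (∀ i, i ≠ w + 1 → i ≠ w + 2 → a i = b i) →
      ((absorb δ w φ).Realize a ↔ (absorb δ w φ).Realize b) := by
    intro φ hw a b hab
    refine realize_congr _ fun i hi => ?_
    rcases freeVars_absorb hδ φ hw hi with h | h | h
    · have := le_code_of_mem_freeVars h
      exact hab i (by omega) (by omega)
    · exact hab i (by omega) (by omega)
    · exact hab i (by omega) (by omega)
  have decode : ∀ (a : ℕ → R) (x y z : R), (∀ i, w + 3 ≤ i → a i = a₀ i) →
      (δ.Realize (update (update (update a w x) (w + 1) y) (w + 2) z) ↔ rel x y z) := by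
    intro a x y z ha
    rw [hrel _ fun i hi => ?_]
    · simp
    · simp [show i ≠ w by omega, show i ≠ w + 1 by omega, show i ≠ w + 2 by omega, ha i hi]
  induction φ generalizing a with
  | verum => exact base _ hw a
  | falsum => exact base _ hw a
  | eq s t => exact base _ hw a
  | neg φ _ => exact base _ hw a
  | ex x φ _ => exact base _ hw a
  | and φ ψ ih₁ ih₂ =>
    have l := ((Nat.left_le_pair φ.code ψ.code).trans (Nat.right_le_pair 4 _)).trans_lt hw
    have r := ((Nat.right_le_pair φ.code ψ.code).trans (Nat.right_le_pair 4 _)).trans_lt hw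
    simp only [absorb, Realize, forall_and]
    exact and_congr (ih₁ l a ha) (ih₂ r a ha)
  | or φ ψ ih₁ ih₂ =>
    have l := ((Nat.left_le_pair φ.code ψ.code).trans (Nat.right_le_pair 5 _)).trans_lt hw
    have r := ((Nat.right_le_pair φ.code ψ.code).trans (Nat.right_le_pair 5 _)).trans_lt hw
    simp only [absorb, Realize, realize_rebind (show w + 1 ≠ w by omega),
      realize_rebind (show w + 2 ≠ w by omega), decode a _ _ _ ha]
    refine (or_congr (ih₁ l a ha) (ih₂ r a ha)).trans ?_
    have e1 : ∀ x y z, (absorb δ w φ).Realize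
        (update (update (update (update a w x) (w + 1) y) (w + 2) z) w
          (update (update (update a w x) (w + 1) y) (w + 2) z (w + 1))) ↔
        (absorb δ w φ).Realize (update a w y) := fun x y z => congr φ l _ _ fun i h1 h2 => by
      by_cases hi : i = w <;> simp [hi, h1, h2]
    have e2 : ∀ x y z, (absorb δ w ψ).Realize
        (update (update (update (update a w x) (w + 1) y) (w + 2) z) w
          (update (update (update a w x) (w + 1) y) (w + 2) z (w + 2))) ↔
        (absorb δ w ψ).Realize (update a w z) := fun x y z => congr ψ r _ _ fun i h1 h2 => by
      by_cases hi : i = w <;> simp [hi, h1, h2]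
    simp only [e1, e2]
    constructor
    · intro h x
      obtain ⟨y, z, hyz⟩ := total x
      exact ⟨y, z, hyz, h.imp (fun h => h y) (fun h => h z)⟩
    · intro h
      -- A counterexample to each disjunct: their pair is encoded by a single `x`.
      by_contra! hc
      obtain ⟨⟨y, hy⟩, z, hz⟩ := hc
      obtain ⟨x, hx⟩ := exact y z
      obtain ⟨y', z', h1, h2⟩ := h x
      obtain ⟨rfl, rfl⟩ := hx _ _ h1
      exact h2.elim hy hz
  | all u φ ih =>
    have l := ((Nat.left_le_pair u φ.code).trans (Nat.right_le_pair 6 _)).trans_lt hw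
    have r := ((Nat.right_le_pair u φ.code).trans (Nat.right_le_pair 6 _)).trans_lt hw
    have ih' : ∀ y, φ.Realize (update a u y) ↔
        ∀ x, (absorb δ w φ).Realize (update (update a u y) w x) := fun y =>
      ih r _ fun i hi => by simp [show i ≠ u by omega, ha i hi]
    simp only [absorb, Realize, realize_rebind (show w + 1 ≠ u by omega),
      realize_rebind (show w + 2 ≠ w by omega), decode a _ _ _ ha, ih']
    have e1 : ∀ x y z, (absorb δ w φ).Realize
        (update (update (update (update (update a w x) (w + 1) y) (w + 2) z) u
          (update (update (update a w x) (w + 1) y) (w + 2) z (w + 1))) w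
          (update (update (update (update a w x) (w + 1) y) (w + 2) z) u
          (update (update (update a w x) (w + 1) y) (w + 2) z (w + 1)) (w + 2))) ↔
        (absorb δ w φ).Realize (update (update a u y) w z) := fun x y z =>
      congr φ r _ _ fun i h1 h2 => by
        by_cases hi : i = w
        · simp [hi, show w + 2 ≠ u by omega]
        · by_cases hu : i = u
          · simp [hu, show u ≠ w by omega]
          · simp [hi, hu, h1, h2]
    simp only [e1]
    constructor
    · intro h x
      obtain ⟨y, z, hyz⟩ := total x
      exact ⟨y, z, hyz, h y z⟩
    · intro h y z
      obtain ⟨x, hx⟩ := exact y z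
      obtain ⟨y', z', h1, h2⟩ := h x
      obtain ⟨rfl, rfl⟩ := hx _ _ h1
      exact h2

/-! ## Membership in fragments -/

/-- A fragment that contains the quantifier-free formulas and is closed under `∃`. -/
structure IsExistentialFragment (F : Set RingFormula) : Prop extends IsFragment F where
  quantifierFree_subset : quantifierFree ⊆ F
  ex_mem : ∀ x, ∀ φ ∈ F, ex x φ ∈ F

theorem isExistentialFragment_alternating (l : ℕ) :
    IsExistentialFragment (alternating .ex (l + 1)) where
  toIsFragment := isFragment_alternating _ _
  quantifierFree_subset := quantifierFree_subset_alternating _ _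
  ex_mem x _ h := quantify_mem_unbounded .ex x h

variable {F : Set RingFormula}

theorem IsExistentialFragment.eq_mem (hF : IsExistentialFragment F) (s t : RingTerm) :
    eq s t ∈ F :=
  hF.quantifierFree_subset (show IsQuantifierFree (eq s t) from trivial)

theorem IsExistentialFragment.neg_eq_mem (hF : IsExistentialFragment F) (s t : RingTerm) :
    neg (eq s t) ∈ F :=
  hF.quantifierFree_subset (show IsQuantifierFree (neg (eq s t)) from trivial)

theorem IsExistentialFragment.rebind_mem (hF : IsExistentialFragment F) (u v : ℕ)
    {φ : RingFormula} (h : φ ∈ F) : rebind u v φ ∈ F :=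
  hF.ex_mem _ _ (hF.and_mem _ (hF.eq_mem _ _) _ h)

theorem IsExistentialFragment.member_mem (hF : IsExistentialFragment F) {γ : RingFormula}
    (hγ : γ ∈ F) (m h u : ℕ) : member γ m h u ∈ F := by
  refine hF.rebind_mem _ _ ?_
  induction m with
  | zero => exact hγ
  | succ m ih => exact hF.rebind_mem _ _ ih

theorem IsExistentialFragment.termGuard_mem (hF : IsExistentialFragment F) {χ : ℕ → RingFormula}
    (hχ : ∀ i, χ i ∈ F) (t : RingTerm) : termGuard χ t ∈ F := by
  induction t with
  | var i => exact hχ i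
  | zero => exact hF.verum_mem
  | one => exact hF.verum_mem
  | neg t ih => exact ih
  | add s t ihs iht | mul s t ihs iht => exact hF.and_mem _ ihs _ iht

theorem IsExistentialFragment.guard_mem (hF : IsExistentialFragment F) {χ : ℕ → RingFormula}
    (hχ : ∀ i, χ i ∈ F) (φ : RingFormula) : guard χ φ ∈ F := by
  induction φ with
  | verum => exact hF.verum_mem
  | falsum => exact hF.verum_mem
  | eq s t => exact hF.and_mem _ (hF.termGuard_mem hχ s) _ (hF.termGuard_mem hχ t)
  | neg φ ih => exact ih
  | and φ ψ ih₁ ih₂ | or φ ψ ih₁ ih₂ => exact hF.and_mem _ ih₁ _ ih₂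
  | all x φ ih | ex x φ ih => exact hF.ex_mem _ _ ih

/-- Everything that `absorb` adds is positive existential over `F`. Where it stops at a negation or
an `∃`-formula, that formula cannot come from a generating step of `∀F`, hence lies in `F`. -/
theorem IsExistentialFragment.absorb_mem (hF : IsExistentialFragment F)
    (hsub : SubformulaClosed F) {δ : RingFormula} (hδ : δ ∈ F) (w : ℕ) {φ : RingFormula}
    (hφ : φ ∈ unbounded .all F) : absorb δ w φ ∈ F := by
  have hsub' := subformulaClosed_unbounded .all hF.toIsFragment hsub
  have base : ∀ φ ∈ unbounded .all F, (∀ χ ψ, φ ≠ and χ ψ) → (∀ χ ψ, φ ≠ or χ ψ) →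
      (∀ x ψ, φ ≠ all x ψ) → φ ∈ F := by
    intro φ h h1 h2 h3
    rw [unbounded_eq_generated _ hF.toIsFragment] at h
    cases h with
    | base h => exact h
    | and => exact absurd rfl (h1 _ _)
    | or => exact absurd rfl (h2 _ _)
    | quantify => exact absurd rfl (h3 _ _)
  induction φ with
  | verum => exact hF.verum_mem
  | falsum => exact hF.falsum_mem
  | eq s t => exact hF.eq_mem s t
  | neg φ _ => exact base _ hφ nofun nofun nofun
  | ex x φ _ => exact base _ hφ nofun nofun nofun
  | and φ ψ ih₁ ih₂ =>
    exact hF.and_mem _ (ih₁ (hsub'.of_and hφ).1) _ (ih₂ (hsub'.of_and hφ).2)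
  | or φ ψ ih₁ ih₂ =>
    exact hF.ex_mem _ _ (hF.ex_mem _ _ (hF.and_mem _ hδ _ (hF.or_mem _
      (hF.rebind_mem _ _ (ih₁ (hsub'.of_or hφ).1)) _
      (hF.rebind_mem _ _ (ih₂ (hsub'.of_or hφ).2)))))
  | all x φ ih =>
    exact hF.ex_mem _ _ (hF.ex_mem _ _ (hF.and_mem _ hδ _ (hF.rebind_mem _ _
      (hF.rebind_mem _ _ (ih (hsub'.of_quantify (Q := .all) hφ))))))

end RingFormula

open Function (update)

/-! ## Terms for sums, powers and monomials -/

namespace RingTerm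

/-- The term `t ^ m`. -/
def pow (t : RingTerm) (m : ℕ) : RingTerm :=
  m.rec one fun _ s => mul s t

/-- The term `∑ i < m, f i`. -/
def sum (f : ℕ → RingTerm) (m : ℕ) : RingTerm :=
  m.rec zero fun i s => add s (f i)

/-- The monomial in the variables `T, ..., T + d - 1` whose exponents are the digits of `a` in
base `q`. -/
def monomial (q T d a : ℕ) : RingTerm :=
  d.rec one fun i s => mul s ((var (T + i)).pow (a / q ^ i % q))

/-- The term `c (i % N) * z i ^ q`, where the `c j` are the variables from `A` on and the `z i` are
the variables from `A + N` on. -/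
def coefficient (q N A i : ℕ) : RingTerm :=
  mul (var (A + i % N)) ((var (A + N + i)).pow q)

/-- The sum of all monomials in the variables `T, ..., T + d - 1` with exponents below `q`, with
coefficients of the form `∑ j < N, c j * z j ^ q`. -/
def expansion (q N T d A : ℕ) : RingTerm :=
  sum (fun i => mul (monomial q T d (i / N)) (coefficient q N A i)) (q ^ d * N)

section

variable {R : Type u} [CommRing R] (v : ℕ → R)

theorem eval_pow (t : RingTerm) (m : ℕ) : (t.pow m).eval v = t.eval v ^ m := by
  induction m with
  | zero => simp [pow, eval]
  | succ m ih =>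
    rw [pow_succ, ← ih]
    rfl

theorem eval_sum (f : ℕ → RingTerm) (m : ℕ) :
    (sum f m).eval v = ∑ i ∈ Finset.range m, (f i).eval v := by
  induction m with
  | zero => simp [sum, eval]
  | succ m ih =>
    rw [Finset.sum_range_succ, ← ih]
    rfl

end

theorem vars_pow {t : RingTerm} {m i : ℕ} (h : i ∈ (t.pow m).vars) : i ∈ t.vars := by
  induction m with
  | zero => simp [pow, vars] at h
  | succ m ih => exact (Finset.mem_union.1 h).elim ih id

theorem vars_sum {f : ℕ → RingTerm} {m i : ℕ} (h : i ∈ (sum f m).vars) :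
    ∃ j < m, i ∈ (f j).vars := by
  induction m with
  | zero => simp [sum, vars] at h
  | succ m ih =>
    rcases Finset.mem_union.1 h with h | h
    · obtain ⟨j, hj, h⟩ := ih h
      exact ⟨j, by omega, h⟩
    · exact ⟨m, by omega, h⟩

theorem vars_monomial {q T d a i : ℕ} (h : i ∈ (monomial q T d a).vars) : T ≤ i ∧ i < T + d := by
  induction d with
  | zero => simp [monomial, vars] at h
  | succ d ih =>
    rcases Finset.mem_union.1 h with h | h
    · have := ih h
      omega
    · have := Finset.mem_singleton.1 (vars_pow h)
      omega

theorem vars_coefficient {q N A m i : ℕ} (hN : 0 < N) (h : i ∈ (coefficient q N A m).vars) :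
    A ≤ i ∧ i < A + N + (m + 1) := by
  have := Nat.mod_lt m hN
  rcases Finset.mem_union.1 h with h | h
  · have := Finset.mem_singleton.1 h
    omega
  · have := Finset.mem_singleton.1 (vars_pow h)
    omega

theorem vars_expansion {q N T d A i : ℕ} (hN : 0 < N) (h : i ∈ (expansion q N T d A).vars) :
    T ≤ i ∧ i < T + d ∨ A ≤ i ∧ i < A + (N + q ^ d * N) := by
  obtain ⟨j, hj, h⟩ := vars_sum h
  rcases Finset.mem_union.1 h with h | h
  · exact .inl (vars_monomial h)
  · have := vars_coefficient hN h
    omega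

end RingTerm

/-! ## Expansions with respect to a `p`-basis -/

section Expansion

variable {R : Type u} [CommRing R]

/-- The monomial in `t 0, ..., t (d - 1)` whose exponents are the digits of `a` in base `q`. -/
def digitMonomial (q d : ℕ) (t : ℕ → R) (a : ℕ) : R :=
  ∏ i ∈ Finset.range d, t i ^ (a / q ^ i % q)

/-- The sum of all monomials in `t 0, ..., t (d - 1)` with exponents below `q`, with
coefficients of the form `∑ j < N, c j * z j ^ q`. -/
def digitExpansion (q N d : ℕ) (t c z : ℕ → R) : R :=
  ∑ i ∈ Finset.range (q ^ d * N), digitMonomial q d t (i / N) * (c (i % N) * z i ^ q)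

/-- A nontrivial linear relation between the monomials in `t 0, ..., t (d - 1)` with exponents
below `q`, with coefficients of the form `∑ j < N, c j * z j ^ q`, where the `c j` are in `S`. -/
def DigitDependent (S : Set R) (q N d : ℕ) (t : ℕ → R) : Prop :=
  ∃ c z : ℕ → R, (∀ j < N, c j ∈ S) ∧ digitExpansion q N d t c z = 0 ∧
    ∃ a < q ^ d, ∑ j ∈ Finset.range N, c j * z (a * N + j) ^ q ≠ 0

/-- The element `x` has an expansion in which `y` and `y'` occur. -/
def DigitDecode (S : Set R) (q N d : ℕ) (t : ℕ → R) (x y y' : R) : Prop :=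
  ∃ c z : ℕ → R, (∀ j < N, c j ∈ S) ∧ c 0 = 1 ∧ x = digitExpansion q N d t c z ∧
    y = z N ∧ y' = z (2 * N)

theorem digitMonomial_congr {q d : ℕ} {t t' : ℕ → R} (h : ∀ i < d, t i = t' i) (a : ℕ) :
    digitMonomial q d t a = digitMonomial q d t' a :=
  Finset.prod_congr rfl fun i hi => by rw [h i (Finset.mem_range.1 hi)]

theorem digitExpansion_congr {q N d : ℕ} (hN : 0 < N) {t t' c c' z z' : ℕ → R}
    (h : ∀ i < d, t i = t' i) (hc : ∀ i < N, c i = c' i) (hz : ∀ i < q ^ d * N, z i = z' i) :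
    digitExpansion q N d t c z = digitExpansion q N d t' c' z' :=
  Finset.sum_congr rfl fun i hi => by
    rw [digitMonomial_congr h, hc _ (Nat.mod_lt _ hN), hz i (Finset.mem_range.1 hi)]

/-- Division with remainder by `N`: the index `a * N + j` belongs to the monomial `a` and the
constant `j`. The coordinates of one monomial thus form a block of length `N`. -/
theorem digitExpansion_eq (q N d : ℕ) (hN : 0 < N) (t c z : ℕ → R) :
    digitExpansion q N d t c z = ∑ a ∈ Finset.range (q ^ d),
      digitMonomial q d t a * ∑ j ∈ Finset.range N, c j * z (a * N + j) ^ q := by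
  simp only [digitExpansion, Finset.mul_sum]
  generalize q ^ d = Q
  induction Q with
  | zero => simp
  | succ Q ih =>
    rw [Finset.sum_range_succ, ← ih, Nat.succ_mul, Finset.sum_range_add]
    refine congrArg _ (Finset.sum_congr rfl fun j hj => ?_)
    have hj := Finset.mem_range.1 hj
    rw [Nat.mul_add_mod_of_lt hj, Nat.mul_comm Q N, Nat.mul_add_div hN, Nat.div_eq_of_lt hj,
      Nat.add_zero]

theorem digitDependent_congr {S : Set R} {q N d : ℕ} {t t' : ℕ → R} (hN : 0 < N)
    (h : ∀ i < d, t i = t' i) : DigitDependent S q N d t ↔ DigitDependent S q N d t' := by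
  simp only [DigitDependent,
    digitExpansion_congr hN h (fun i _ => rfl) fun i _ => rfl]

theorem digitDecode_congr {S : Set R} {q N d : ℕ} {t t' : ℕ → R} (hN : 0 < N)
    (h : ∀ i < d, t i = t' i) (x y y' : R) :
    DigitDecode S q N d t x y y' ↔ DigitDecode S q N d t' x y y' := by
  simp only [DigitDecode,
    digitExpansion_congr hN h (fun i _ => rfl) fun i _ => rfl]

namespace RingTerm

theorem eval_monomial (v : ℕ → R) (q T d a : ℕ) :
    (monomial q T d a).eval v = digitMonomial q d (fun i => v (T + i)) a := by
  induction d with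
  | zero => simp [monomial, eval, digitMonomial]
  | succ d ih =>
    rw [digitMonomial, Finset.prod_range_succ, ← digitMonomial, ← ih]
    exact congrArg _ (eval_pow v _ _)

theorem eval_coefficient (v : ℕ → R) (q N A i : ℕ) :
    (coefficient q N A i).eval v = v (A + i % N) * v (A + N + i) ^ q := by
  simp [coefficient, eval, eval_pow]

theorem eval_expansion (v : ℕ → R) (q N T d A : ℕ) : (expansion q N T d A).eval v =
    digitExpansion q N d (fun i => v (T + i)) (fun i => v (A + i)) (fun i => v (A + N + i)) := by
  simp [expansion, eval_sum, eval, eval_monomial, eval_coefficient, digitExpansion]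

end RingTerm

end Expansion

namespace RingFormula

open RingTerm

/-- The formula `⋀ i < m, f i`. -/
def conj (f : ℕ → RingFormula) (m : ℕ) : RingFormula :=
  m.rec verum fun i ψ => and ψ (f i)

/-- The formula `⋁ i < m, f i`. -/
def disj (f : ℕ → RingFormula) (m : ℕ) : RingFormula :=
  m.rec falsum fun i ψ => or ψ (f i)

/-- Existential quantification over the variables `A, ..., A + m - 1`. -/
def exBlock (A : ℕ) (φ : RingFormula) (m : ℕ) : RingFormula :=
  m.rec φ fun i ψ => ex (A + i) ψ

/-- Universal quantification over the variables `A, ..., A + m - 1`. -/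
def allBlock (A : ℕ) (φ : RingFormula) (m : ℕ) : RingFormula :=
  m.rec φ fun i ψ => all (A + i) ψ

section

variable {R : Type u} [CommRing R]

theorem realize_conj (f : ℕ → RingFormula) (m : ℕ) (v : ℕ → R) :
    (conj f m).Realize v ↔ ∀ i < m, (f i).Realize v := by
  induction m with
  | zero => simp [conj, Realize]
  | succ m ih =>
    rw [Nat.forall_lt_succ_right, ← ih]
    rfl

theorem realize_disj (f : ℕ → RingFormula) (m : ℕ) (v : ℕ → R) :
    (disj f m).Realize v ↔ ∃ i < m, (f i).Realize v := by
  induction m with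
  | zero => simp [disj, Realize]
  | succ m ih =>
    rw [Nat.exists_lt_succ_right, ← ih]
    rfl

theorem realize_exBlock (A : ℕ) (φ : RingFormula) (m : ℕ) (v : ℕ → R) :
    (exBlock A φ m).Realize v ↔
      ∃ f : ℕ → R, φ.Realize fun i => if A ≤ i ∧ i < A + m then f i else v i := by
  induction m generalizing v with
  | zero => simp [exBlock, show ∀ i, ¬ (A ≤ i ∧ i < A) by omega]
  | succ m ih =>
    refine (exists_congr fun a => ih (update v (A + m) a)).trans ⟨?_, ?_⟩
    · rintro ⟨a, f, h⟩
      refine ⟨update f (A + m) a, ?_⟩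
      convert h using 2 with i
      by_cases h1 : i = A + m
      · subst h1; simp
      · simp [h1, show i < A + (m + 1) ↔ i < A + m by omega]
    · rintro ⟨f, h⟩
      refine ⟨f (A + m), f, ?_⟩
      convert h using 2 with i
      by_cases h1 : i = A + m
      · subst h1; simp
      · simp [h1, show i < A + (m + 1) ↔ i < A + m by omega]

theorem realize_allBlock (A : ℕ) (φ : RingFormula) (m : ℕ) (v : ℕ → R) :
    (allBlock A φ m).Realize v ↔
      ∀ f : ℕ → R, φ.Realize fun i => if A ≤ i ∧ i < A + m then f i else v i := by
  induction m generalizing v with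
  | zero => simp [allBlock, show ∀ i, ¬ (A ≤ i ∧ i < A) by omega]
  | succ m ih =>
    refine (forall_congr' fun a => ih (update v (A + m) a)).trans ⟨?_, ?_⟩
    · intro h f
      convert h (f (A + m)) f using 2 with i
      by_cases h1 : i = A + m
      · subst h1; simp
      · simp [h1, show i < A + (m + 1) ↔ i < A + m by omega]
    · intro h a f
      convert h (update f (A + m) a) using 2 with i
      by_cases h1 : i = A + m
      · subst h1; simp
      · simp [h1, show i < A + (m + 1) ↔ i < A + m by omega]

end

theorem freeVars_conj {f : ℕ → RingFormula} {m i : ℕ} (h : i ∈ (conj f m).freeVars) :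
    ∃ j < m, i ∈ (f j).freeVars := by
  induction m with
  | zero => simp [conj, freeVars] at h
  | succ m ih =>
    rcases Finset.mem_union.1 h with h | h
    · obtain ⟨j, hj, h⟩ := ih h
      exact ⟨j, by omega, h⟩
    · exact ⟨m, by omega, h⟩

theorem freeVars_disj {f : ℕ → RingFormula} {m i : ℕ} (h : i ∈ (disj f m).freeVars) :
    ∃ j < m, i ∈ (f j).freeVars := by
  induction m with
  | zero => simp [disj, freeVars] at h
  | succ m ih =>
    rcases Finset.mem_union.1 h with h | h
    · obtain ⟨j, hj, h⟩ := ih h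
      exact ⟨j, by omega, h⟩
    · exact ⟨m, by omega, h⟩

theorem freeVars_exBlock (A : ℕ) (φ : RingFormula) (m i : ℕ) :
    i ∈ (exBlock A φ m).freeVars ↔ i ∈ φ.freeVars ∧ ¬ (A ≤ i ∧ i < A + m) := by
  induction m with
  | zero => simp [exBlock, show ¬ (A ≤ i ∧ i < A) by omega]
  | succ m ih =>
    refine Finset.mem_erase.trans ((and_congr_right fun _ => ih).trans ?_)
    grind

theorem freeVars_allBlock (A : ℕ) (φ : RingFormula) (m i : ℕ) :
    i ∈ (allBlock A φ m).freeVars ↔ i ∈ φ.freeVars ∧ ¬ (A ≤ i ∧ i < A + m) := by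
  induction m with
  | zero => simp [allBlock, show ¬ (A ≤ i ∧ i < A) by omega]
  | succ m ih =>
    refine Finset.mem_erase.trans ((and_congr_right fun _ => ih).trans ?_)
    grind

variable {F : Set RingFormula}

theorem IsExistentialFragment.conj_mem (hF : IsExistentialFragment F) {f : ℕ → RingFormula}
    (h : ∀ i, f i ∈ F) (m : ℕ) : conj f m ∈ F := by
  induction m with
  | zero => exact hF.verum_mem
  | succ m ih => exact hF.and_mem _ ih _ (h m)

theorem IsExistentialFragment.disj_mem (hF : IsExistentialFragment F) {f : ℕ → RingFormula}
    (h : ∀ i, f i ∈ F) (m : ℕ) : disj f m ∈ F := by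
  induction m with
  | zero => exact hF.falsum_mem
  | succ m ih => exact hF.or_mem _ ih _ (h m)

theorem IsExistentialFragment.exBlock_mem (hF : IsExistentialFragment F) (A : ℕ) {φ : RingFormula}
    (h : φ ∈ F) (m : ℕ) : exBlock A φ m ∈ F := by
  induction m with
  | zero => exact h
  | succ m ih => exact hF.ex_mem _ _ ih

theorem allBlock_mem_bracket {A : ℕ} {φ : RingFormula} {r : ℕ} (h : φ ∈ bracket .all r F)
    (m : ℕ) : allBlock A φ m ∈ bracket .all (m + r) F := by
  induction m with
  | zero => simpa [allBlock] using h
  | succ m ih =>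
    rw [Nat.succ_add]
    exact .inl ⟨A + m, _, ih, rfl⟩

/-! ## The formulas of the reduction -/

/-- The formula expressing `DigitDependent` for the variables from `T` on. -/
def dependent (χ : ℕ → RingFormula) (q N T d A : ℕ) : RingFormula :=
  exBlock A (and (conj (fun j => χ (A + j)) N) (and (eq (expansion q N T d A) zero)
    (disj (fun a => neg (eq (RingTerm.sum (fun j => coefficient q N A (a * N + j)) N) zero))
      (q ^ d)))) (N + q ^ d * N)

/-- The formula expressing `DigitDecode` for the variables `w`, `w + 1`, `w + 2` and those
from `T` on. -/
def decode (χ : ℕ → RingFormula) (q N w T d A : ℕ) : RingFormula :=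
  exBlock A (and (conj (fun j => χ (A + j)) N) (and (eq (.var A) .one)
    (and (eq (.var w) (expansion q N T d A)) (and (eq (.var (w + 1)) (.var (A + N + N)))
      (eq (.var (w + 2)) (.var (A + N + 2 * N))))))) (N + q ^ d * N)

/-- The translation of `∀F`-formulas, where the variables below `w` are those that may occur
in `γ` and `φ`. -/
def translate (γ φ : RingFormula) (q N d w : ℕ) : RingFormula :=
  allBlock (w + 4) (all w (and (guard (member γ w (w + 3)) φ)
    (or (dependent (member γ w (w + 3)) q N (w + 4) d (w + 4 + d))
      (absorb (decode (member γ w (w + 3)) q N w (w + 4) d (w + 4 + d)) w φ)))) d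

section

variable {R : Type u} [CommRing R] {χ : ℕ → RingFormula} {S : Set R} {q N T d A w : ℕ}

theorem realize_dependent (hN : 0 < N) (hA : T + d ≤ A)
    (hχ : ∀ i, A ≤ i → ∀ v : ℕ → R, (χ i).Realize v ↔ v i ∈ S) (v : ℕ → R) :
    (dependent χ q N T d A).Realize v ↔ DigitDependent S q N d fun i => v (T + i) := by
  have h0 : ∀ a, RingTerm.eval (R := R) a zero = 0 := fun _ => rfl
  simp only [dependent, realize_exBlock, Realize, realize_conj, realize_disj, eval_expansion,
    eval_sum, eval_coefficient, h0, hχ _ (Nat.le_add_right A _)]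
  constructor
  · rintro ⟨f, h1, h2, a, ha, h3⟩
    refine ⟨_, fun i => if A ≤ A + N + i ∧ A + N + i < A + (N + q ^ d * N) then f (A + N + i)
      else v (A + N + i), h1, ?_, a, ha, ?_⟩
    · rw [← h2]
      refine digitExpansion_congr hN (fun i hi => ?_) (fun _ _ => rfl) (fun _ _ => rfl)
      rw [if_neg (by omega)]
    · intro h4
      refine h3 ((Finset.sum_congr rfl fun j hj => ?_).trans h4)
      rw [Nat.mul_add_mod_of_lt (Finset.mem_range.1 hj)]
  · rintro ⟨c, z, h1, h2, a, ha, h3⟩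
    -- The quantified variables from `A` on hold first the `N` constants, then the coordinates.
    refine ⟨fun i => if i < A + N then c (i - A) else z (i - (A + N)), ?_, ?_, a, ha, ?_⟩
    · intro j hj
      simp [hj, show j < N + q ^ d * N by omega, h1 j hj]
    · rw [← h2]
      refine digitExpansion_congr hN (fun i hi => ?_) (fun i hi => ?_) (fun i hi => ?_)
      · rw [if_neg (by omega)]
      · simp only []
        rw [if_pos (by omega), if_pos (by omega), Nat.add_sub_cancel_left]
      · simp only []
        rw [if_pos (by omega), if_neg (by omega), Nat.add_sub_cancel_left]
    · intro h4
      refine h3 ((Finset.sum_congr rfl fun j hj => ?_).trans h4)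
      have hj := Finset.mem_range.1 hj
      have : a * N + j < q ^ d * N := by nlinarith
      rw [Nat.mul_add_mod_of_lt hj]
      simp only []
      rw [if_pos (by omega), if_pos (by omega), if_pos (by omega), if_neg (by omega),
        Nat.add_sub_cancel_left, Nat.add_sub_cancel_left]

theorem realize_decode (hN : 0 < N) (hw : w + 3 ≤ T) (hA : T + d ≤ A) (hq : 2 < q ^ d)
    (hχ : ∀ i, A ≤ i → ∀ v : ℕ → R, (χ i).Realize v ↔ v i ∈ S) (v : ℕ → R) :
    (decode χ q N w T d A).Realize v ↔
      DigitDecode S q N d (fun i => v (T + i)) (v w) (v (w + 1)) (v (w + 2)) := by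
  have h1 : ∀ a, RingTerm.eval (R := R) a .one = 1 := fun _ => rfl
  have hv : ∀ a i, RingTerm.eval (R := R) a (.var i) = a i := fun _ _ => rfl
  -- Keeps the coordinates `N` and `2 * N`, the decoded pair, inside the quantified block.
  have hQ : 2 * N < q ^ d * N := by nlinarith
  simp only [decode, realize_exBlock, Realize, realize_conj, eval_expansion,
    h1, hv, hχ _ (Nat.le_add_right A _)]
  simp only [show ¬ A ≤ w by omega, show ¬ A ≤ w + 1 by omega, show ¬ A ≤ w + 2 by omega,
    false_and, if_false]
  constructor
  · rintro ⟨f, h1, h2, h3, h4, h5⟩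
    refine ⟨_, fun i => if A ≤ A + N + i ∧ A + N + i < A + (N + q ^ d * N) then f (A + N + i)
      else v (A + N + i), h1, h2, ?_, h4, h5⟩
    rw [h3]
    refine digitExpansion_congr hN (fun i hi => ?_) (fun _ _ => rfl) (fun _ _ => rfl)
    rw [if_neg (by omega)]
  · rintro ⟨c, z, h1, h2, h3, h4, h5⟩
    refine ⟨fun i => if i < A + N then c (i - A) else z (i - (A + N)), ?_, ?_, ?_, ?_, ?_⟩
    · intro j hj
      simp [hj, show j < N + q ^ d * N by omega, h1 j hj]
    · simp [hN, h2]
    · rw [h3]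
      refine digitExpansion_congr hN (fun i hi => ?_) (fun i hi => ?_) (fun i hi => ?_)
      · rw [if_neg (by omega)]
      · simp only []
        rw [if_pos (by omega), if_pos (by omega), Nat.add_sub_cancel_left]
      · simp only []
        rw [if_pos (by omega), if_neg (by omega), Nat.add_sub_cancel_left]
    · simp only []
      rw [if_pos (by omega), if_neg (by omega), Nat.add_sub_cancel_left, h4]
    · simp only []
      rw [if_pos (by omega), if_neg (by omega), Nat.add_sub_cancel_left, h5]

end

section

variable {χ : ℕ → RingFormula} {q N T d A w i : ℕ}

theorem freeVars_dependent (hN : 0 < N) (hχ : ∀ i, A ≤ i → (χ i).freeVars = {i})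
    (h : i ∈ (dependent χ q N T d A).freeVars) : T ≤ i ∧ i < T + d := by
  simp only [dependent, freeVars_exBlock, freeVars, RingTerm.vars, Finset.mem_union] at h
  obtain ⟨h1 | (h1 | h1) | h1, h2⟩ := h
  · obtain ⟨j, hj, h3⟩ := freeVars_conj h1
    rw [hχ _ (by omega), Finset.mem_singleton] at h3
    omega
  · have := vars_expansion hN h1
    omega
  · simp at h1
  · obtain ⟨a, ha, h3⟩ := freeVars_disj h1
    simp only [freeVars, RingTerm.vars, Finset.union_empty] at h3
    obtain ⟨j, hj, h4⟩ := vars_sum h3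
    have := vars_coefficient hN h4
    have : a * N + j < q ^ d * N := by nlinarith
    omega

theorem freeVars_decode (hN : 0 < N) (hq : 2 < q ^ d) (hχ : ∀ i, A ≤ i → (χ i).freeVars = {i})
    (h : i ∈ (decode χ q N w T d A).freeVars) :
    w ≤ i ∧ i < w + 3 ∨ T ≤ i ∧ i < T + d := by
  have hQ : 2 * N < q ^ d * N := by nlinarith
  simp only [decode, freeVars_exBlock, freeVars, RingTerm.vars, Finset.mem_union,
    Finset.mem_singleton] at h
  obtain ⟨h1 | (h1 | h1) | (h1 | h1) | (h1 | h1) | (h1 | h1), h2⟩ := h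
  · obtain ⟨j, hj, h3⟩ := freeVars_conj h1
    rw [hχ _ (by omega), Finset.mem_singleton] at h3
    omega
  all_goals try omega
  · simp at h1
  · have := vars_expansion hN h1
    omega

variable {γ φ : RingFormula}

theorem freeVars_translate (hN : 0 < N) (hq : 2 < q ^ d) (hγ : γ.code < w) (hφ : φ.code < w) :
    (translate γ φ q N d w).freeVars = φ.freeVars := by
  have hχ : ∀ i, i ≠ w + 3 → (member γ w (w + 3) i).freeVars = {i} := fun i hi =>
    freeVars_member hγ (by omega) hi
  ext i
  rw [translate, freeVars_allBlock]
  simp only [freeVars, Finset.mem_erase, Finset.mem_union,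
    freeVars_guard φ fun i hi => hχ i (by omega)]
  constructor
  · rintro ⟨⟨h1, h2 | h2 | h2⟩, h3⟩
    · exact h2
    · exact absurd (freeVars_dependent hN (fun i hi => hχ i (by omega)) h2) h3
    · have h4 : ∀ j ∈ (decode (member γ w (w + 3)) q N w (w + 4) d (w + 4 + d)).freeVars,
          w ≤ j ∧ j < w + 3 ∨ w + 4 ≤ j ∧ j < w + 4 + d :=
        fun j hj => freeVars_decode hN hq (fun i hi => hχ i (by omega)) hj
      rcases freeVars_absorb (fun j hj => by have := h4 j hj; omega) φ hφ h2 with h5 | h5 | h5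
      · exact h5
      · exact absurd h5 h1
      · have := h4 i h5.2
        omega
  · intro h
    have := le_code_of_mem_freeVars h
    exact ⟨⟨by omega, .inl h⟩, by omega⟩

/-- One universal quantifier binds `w` and `d` bind the block from `w + 4` on. The matrix lies in
`F` because dependence occurs positively and its only negations are of equations. -/
theorem translate_mem_bracket {F : Set RingFormula} (hF : IsExistentialFragment F)
    (hsub : SubformulaClosed F) (hγ : γ ∈ F) (hφ : φ ∈ unbounded .all F) (q N d w : ℕ) :
    translate γ φ q N d w ∈ bracket .all (d + 1) F := by
  have hχ : ∀ i, member γ w (w + 3) i ∈ F := fun i => hF.member_mem hγ _ _ _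
  refine allBlock_mem_bracket (r := 1) (Or.inl ⟨w, _,
    hF.and_mem _ (hF.guard_mem hχ φ) _ (hF.or_mem _ ?_ _
    (hF.absorb_mem hsub ?_ w hφ)), rfl⟩) d
  · exact hF.exBlock_mem _ (hF.and_mem _ (hF.conj_mem (fun j => hχ _) _) _ (hF.and_mem _
      (hF.eq_mem _ _) _ (hF.disj_mem (fun a => hF.neg_eq_mem _ _) _))) _
  · exact hF.exBlock_mem _ (hF.and_mem _ (hF.conj_mem (fun j => hχ _) _) _ (hF.and_mem _
      (hF.eq_mem _ _) _ (hF.and_mem _ (hF.eq_mem _ _) _ (hF.and_mem _ (hF.eq_mem _ _) _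
      (hF.eq_mem _ _))))) _

/-- Dependent tuples `t` satisfy the disjunction outright; for every other `t` the quantifier over
`w` turns the absorbed formula into `φ`. The existence of one such `t` is what allows `φ` to be
recovered from the translation. -/
theorem realize_translate {R : Type u} [CommRing R] (hN : 0 < N) (hq : 2 < q ^ d)
    (hγ : γ.code < w) (hφ : φ.code < w) (hne : (γ.definedSet R).Nonempty)
    (total : ∀ t : ℕ → R, ¬ DigitDependent (γ.definedSet R) q N d t →
      ∀ x, ∃ y z, DigitDecode (γ.definedSet R) q N d t x y z)
    (exact : ∀ t : ℕ → R, ¬ DigitDependent (γ.definedSet R) q N d t → ∀ y z, ∃ x, ∀ y' z',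
      DigitDecode (γ.definedSet R) q N d t x y' z' → y' = y ∧ z' = z)
    (exists_basis : ∃ t : ℕ → R, ¬ DigitDependent (γ.definedSet R) q N d t) (v : ℕ → R) :
    (translate γ φ q N d w).Realize v ↔
      φ.Realize v ∧ ∀ i ∈ φ.freeVars, v i ∈ γ.definedSet R := by
  have hχ : ∀ i, i ≠ w + 3 → ∀ v : ℕ → R,
      (member γ w (w + 3) i).Realize v ↔ v i ∈ γ.definedSet R := fun i hi =>
    realize_member hγ (by omega) hi
  have hχ' : ∀ i, i ≠ w + 3 → (member γ w (w + 3) i).freeVars = {i} := fun i hi =>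
    freeVars_member hγ (by omega) hi
  have hδ : ∀ j ∈ (decode (member γ w (w + 3)) q N w (w + 4) d (w + 4 + d)).freeVars,
      w ≤ j ∧ j < w + 3 ∨ w + 4 ≤ j ∧ j < w + 4 + d :=
    fun j hj => freeVars_decode hN hq (fun i hi => hχ' i (by omega)) hj
  have key : ∀ a : ℕ → R,
      (∀ x, ∃ y z, DigitDecode (γ.definedSet R) q N d (fun i => a (w + 4 + i)) x y z) →
      (∀ y z, ∃ x, ∀ y' z', DigitDecode (γ.definedSet R) q N d (fun i => a (w + 4 + i)) x y' z' →
        y' = y ∧ z' = z) →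
      (φ.Realize a ↔ ∀ x, (absorb (decode (member γ w (w + 3)) q N w (w + 4) d (w + 4 + d)) w
        φ).Realize (update a w x)) := by
    intro a h1 h2
    refine realize_absorb (fun j hj => by have := hδ j hj; omega) (a₀ := a) (fun b hb => ?_)
      h1 h2 φ hφ a fun _ _ => rfl
    rw [realize_decode hN (by omega) (by omega) hq fun i hi => hχ i (by omega)]
    rw [show (fun i => b (w + 4 + i)) = fun i => a (w + 4 + i) from
      funext fun i => hb _ (by omega)]
  have step : ∀ a : ℕ → R, (∀ i ∈ φ.freeVars, a i = v i) → ∀ x,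
      ((and (guard (member γ w (w + 3)) φ) (or (dependent (member γ w (w + 3)) q N (w + 4) d
        (w + 4 + d)) (absorb (decode (member γ w (w + 3)) q N w (w + 4) d (w + 4 + d)) w
        φ))).Realize (update a w x) ↔ (∀ i ∈ φ.freeVars, v i ∈ γ.definedSet R) ∧
        (DigitDependent (γ.definedSet R) q N d (fun i => a (w + 4 + i)) ∨
          (absorb (decode (member γ w (w + 3)) q N w (w + 4) d (w + 4 + d)) w φ).Realize
            (update a w x))) := by
    intro a ha x
    refine and_congr ?_ (or_congr_left ?_)
    · rw [realize_guard hne φ fun i hi => hχ i (by omega)]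
      refine forall₂_congr fun i hi => ?_
      have := le_code_of_mem_freeVars hi
      rw [Function.update_of_ne (by omega), ha i hi]
    · rw [realize_dependent hN le_rfl fun i hi => hχ i (by omega)]
      rw [show (fun i => update a w x (w + 4 + i)) = fun i => a (w + 4 + i) from
        funext fun i => Function.update_of_ne (by omega) _ _]
  have low : ∀ f : ℕ → R, ∀ i ∈ φ.freeVars,
      (if w + 4 ≤ i ∧ i < w + 4 + d then f i else v i) = v i := fun f i hi => by
    have := le_code_of_mem_freeVars hi
    rw [if_neg (by omega)]
  rw [translate, realize_allBlock]
  refine (forall_congr' fun f => forall_congr' fun x => step _ (low f) x).trans ?_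
  constructor
  · intro h
    obtain ⟨t, ht⟩ := exists_basis
    -- The tuple is stored with a shift by `w + 4`; only its first `d` entries are stored and only
    -- these matter.
    have agree : ∀ i < d, (if w + 4 ≤ w + 4 + i ∧ w + 4 + i < w + 4 + d then
        t (w + 4 + i - (w + 4)) else v (w + 4 + i)) = t i := fun i hi => by
      rw [if_pos (by omega), Nat.add_sub_cancel_left]
    have h := h fun i => t (i - (w + 4))
    refine ⟨?_, (h 0).1⟩
    rw [← realize_congr φ (low fun i => t (i - (w + 4))), key]
    · exact fun x => (h x).2.resolve_left fun h' => ht ((digitDependent_congr hN agree).1 h')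
    · intro x
      obtain ⟨y, z, hyz⟩ := total t ht x
      exact ⟨y, z, (digitDecode_congr hN agree x y z).2 hyz⟩
    · intro y z
      obtain ⟨x, hx⟩ := exact t ht y z
      exact ⟨x, fun y' z' h' => hx y' z' ((digitDecode_congr hN agree x y' z').1 h')⟩
  · rintro ⟨h1, h2⟩ f x
    refine ⟨h2, or_iff_not_imp_left.2 fun h3 => ?_⟩
    rw [← realize_congr φ (low f)] at h1
    refine (key _ ?_ ?_).1 h1 x
    · exact total _ h3
    · exact exact _ h3

end

end RingFormula

/-! ## Computability of the translation on Gödel numbers -/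

section Recursion

/-- Recursion on Gödel numbers: the value at `c = ⟨b, x⟩` is determined by `c` and the values at
`x`, `l` and `r`, where `x = ⟨l, r⟩`; values at arguments that are not smaller than `c` are
replaced by `0`. -/
def codeRec (G : ℕ → ℕ → ℕ → ℕ → ℕ) (c : ℕ) : ℕ :=
  G c (if _h : c.unpair.2 < c then codeRec G c.unpair.2 else 0)
    (if _h : c.unpair.2.unpair.1 < c then codeRec G c.unpair.2.unpair.1 else 0)
    (if _h : c.unpair.2.unpair.2 < c then codeRec G c.unpair.2.unpair.2 else 0)
termination_by c

/-- A nonzero tag makes the pair larger than `x`, so the recursive call is genuine. Here `x` need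
not encode a pair of formulas, and the values `l` and `r` carry no meaning. -/
theorem codeRec_unary (G : ℕ → ℕ → ℕ → ℕ → ℕ) {b : ℕ} (hb : b ≠ 0) (x : ℕ) :
    ∃ l r, codeRec G (Nat.pair b x) = G (Nat.pair b x) (codeRec G x) l r := by
  have h := Nat.add_le_pair b x
  rw [codeRec]
  simp only [Nat.unpair_pair]
  rw [dif_pos (show x < _ by omega)]
  exact ⟨_, _, rfl⟩

theorem codeRec_binary (G : ℕ → ℕ → ℕ → ℕ → ℕ) {b : ℕ} (hb : b ≠ 0) (l r : ℕ) :
    ∃ x, codeRec G (Nat.pair b (Nat.pair l r)) =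
      G (Nat.pair b (Nat.pair l r)) x (codeRec G l) (codeRec G r) := by
  have h := Nat.add_le_pair b (Nat.pair l r)
  have h' := Nat.add_le_pair l r
  rw [codeRec]
  simp only [Nat.unpair_pair]
  rw [dif_pos (show l < _ by omega), dif_pos (show r < _ by omega)]
  exact ⟨_, rfl⟩

variable {α : Type*} [Primcodable α]

theorem Primrec.fst_unpair {f : α → ℕ} (hf : Primrec f) : Primrec fun a => (f a).unpair.1 :=
  Primrec.fst.comp (Primrec.unpair.comp hf)

theorem Primrec.snd_unpair {f : α → ℕ} (hf : Primrec f) : Primrec fun a => (f a).unpair.2 :=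
  Primrec.snd.comp (Primrec.unpair.comp hf)

theorem Primrec.natPair {f g : α → ℕ} (hf : Primrec f) (hg : Primrec g) :
    Primrec fun a => Nat.pair (f a) (g a) :=
  Primrec₂.natPair.comp hf hg

theorem Primrec.add {f g : α → ℕ} (hf : Primrec f) (hg : Primrec g) :
    Primrec fun a => f a + g a :=
  Primrec.nat_add.comp hf hg

theorem Primrec.mul {f g : α → ℕ} (hf : Primrec f) (hg : Primrec g) :
    Primrec fun a => f a * g a :=
  Primrec.nat_mul.comp hf hg

theorem Primrec.pow {f g : α → ℕ} (hf : Primrec f) (hg : Primrec g) :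
    Primrec fun a => f a ^ g a := by
  refine (Primrec.nat_rec' hg (Primrec.const 1)
    (h := fun a x => x.2 * f a) ?_).of_eq fun a => ?_
  · exact Primrec.mul (snd.comp snd) (hf.comp fst)
  · induction g a with
    | zero => rfl
    | succ n ih => simp only [pow_succ, ← ih]

/-- Course-of-values recursion: earlier values are looked up in a list, and a lookup beyond its end
gives the same `0` as the guarded calls in `codeRec`. -/
theorem Primrec.codeRec {G : α → ℕ → ℕ → ℕ → ℕ → ℕ}
    (hG : Primrec fun x : α × ℕ × ℕ × ℕ × ℕ => G x.1 x.2.1 x.2.2.1 x.2.2.2.1 x.2.2.2.2)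
    {f : α → ℕ} (hf : Primrec f) : Primrec fun a => _root_.codeRec (G a) (f a) := by
  have key : Primrec₂ fun a c => _root_.codeRec (G a) c := by
    refine Primrec.nat_strong_rec _ (g := fun a L => some (G a L.length
      (L[L.length.unpair.2]?.getD 0) (L[L.length.unpair.2.unpair.1]?.getD 0)
      (L[L.length.unpair.2.unpair.2]?.getD 0))) ?_ fun a n => ?_
    · have hn : Primrec fun x : α × List ℕ => x.2.length := list_length.comp snd
      have hget : ∀ {i : α × List ℕ → ℕ}, Primrec i → Primrec fun x => (x.2[i x]?).getD 0 :=
        fun hi => option_getD.comp (list_getElem?.comp snd hi) (const 0)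
      exact option_some.comp (hG.comp (fst.pair (hn.pair ((hget hn.snd_unpair).pair
        ((hget hn.snd_unpair.fst_unpair).pair (hget hn.snd_unpair.snd_unpair))))))
    · have hget : ∀ i, (((List.range n).map (_root_.codeRec (G a)))[i]?).getD 0 =
          if _h : i < n then _root_.codeRec (G a) i else 0 := by
        intro i
        by_cases h : i < n
        · simp [h]
        · simp [h]
      simp only [List.length_map, List.length_range, hget]
      conv_rhs => rw [_root_.codeRec]
  exact key.comp .id hf

end Recursion

namespace RingTerm

variable {α : Type*} [Primcodable α]

theorem primrec_code_sum {f : α → ℕ → RingTerm} {m : α → ℕ}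
    (hf : Primrec fun x : α × ℕ => (f x.1 x.2).code) (hm : Primrec m) :
    Primrec fun a => (RingTerm.sum (f a) (m a)).code := by
  refine (Primrec.nat_rec' hm (Primrec.const zero.code)
    (h := fun a x => Nat.pair 4 (Nat.pair x.2 (f a x.1).code)) ?_).of_eq fun a => ?_
  · exact (Primrec.const 4).natPair ((Primrec.snd.comp Primrec.snd).natPair
      (hf.comp (Primrec.fst.pair (Primrec.fst.comp Primrec.snd))))
  · induction m a with
    | zero => rfl
    | succ n ih => simp only [ih]; rfl

theorem primrec_code_pow_var {i m : α → ℕ} (hi : Primrec i) (hm : Primrec m) :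
    Primrec fun a => ((var (i a)).pow (m a)).code := by
  refine (Primrec.nat_rec' hm (Primrec.const one.code)
    (h := fun a x => Nat.pair 5 (Nat.pair x.2 (var (i a)).code)) ?_).of_eq fun a => ?_
  · exact (Primrec.const 5).natPair ((Primrec.snd.comp Primrec.snd).natPair
      ((Primrec.const 0).natPair (hi.comp Primrec.fst)))
  · induction m a with
    | zero => rfl
    | succ n ih => simp only [ih]; rfl

theorem primrec_code_monomial {q T d b : α → ℕ} (hq : Primrec q) (hT : Primrec T)
    (hd : Primrec d) (hb : Primrec b) :
    Primrec fun a => (monomial (q a) (T a) (d a) (b a)).code := by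
  refine (Primrec.nat_rec' hd (Primrec.const one.code) (h := fun a x => Nat.pair 5 (Nat.pair x.2
    ((var (T a + x.1)).pow (b a / q a ^ x.1 % q a)).code)) ?_).of_eq fun a => ?_
  · have hi : Primrec fun x : α × ℕ × ℕ => x.2.1 := Primrec.fst.comp Primrec.snd
    have h := primrec_code_pow_var ((hT.comp Primrec.fst).add hi)
      (Primrec.nat_mod.comp (Primrec.nat_div.comp (hb.comp Primrec.fst)
        ((hq.comp Primrec.fst).pow hi)) (hq.comp Primrec.fst))
    exact (Primrec.const 5).natPair ((Primrec.snd.comp Primrec.snd).natPair h)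
  · induction d a with
    | zero => rfl
    | succ n ih => simp only [ih]; rfl

theorem primrec_code_coefficient {q N A i : α → ℕ} (hq : Primrec q) (hN : Primrec N)
    (hA : Primrec A) (hi : Primrec i) :
    Primrec fun a => (coefficient (q a) (N a) (A a) (i a)).code :=
  (Primrec.const 5).natPair (((Primrec.const 0).natPair
    (hA.add (Primrec.nat_mod.comp hi hN))).natPair (primrec_code_pow_var ((hA.add hN).add hi) hq))

theorem primrec_code_expansion {q N T d A : α → ℕ} (hq : Primrec q) (hN : Primrec N)
    (hT : Primrec T) (hd : Primrec d) (hA : Primrec A) :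
    Primrec fun a => (expansion (q a) (N a) (T a) (d a) (A a)).code := by
  refine primrec_code_sum ?_ ((hq.pow hd).mul hN)
  have hf : Primrec (Prod.fst : α × ℕ → α) := Primrec.fst
  exact (Primrec.const 5).natPair ((primrec_code_monomial (hq.comp hf) (hT.comp hf) (hd.comp hf)
    (Primrec.nat_div.comp Primrec.snd (hN.comp hf))).natPair
    (primrec_code_coefficient (hq.comp hf) (hN.comp hf) (hA.comp hf) Primrec.snd))

end RingTerm

namespace RingFormula

/-- `rebind` on Gödel numbers. -/
def rebindCode (u v c : ℕ) : ℕ :=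
  Nat.pair 7 (Nat.pair u (Nat.pair 4 (Nat.pair
    (Nat.pair 2 (Nat.pair (Nat.pair 0 u) (Nat.pair 0 v))) c)))

/-- `bindBelow` on Gödel numbers. -/
def bindBelowCode (h c m : ℕ) : ℕ :=
  m.rec c fun i e => rebindCode i h e

/-- `member` on Gödel numbers. -/
def memberCode (c m h u : ℕ) : ℕ :=
  rebindCode h u (bindBelowCode h c m)

/-- `conj` on Gödel numbers. -/
def conjCode (f : ℕ → ℕ) (m : ℕ) : ℕ :=
  m.rec verum.code fun i e => Nat.pair 4 (Nat.pair e (f i))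

/-- `disj` on Gödel numbers. -/
def disjCode (f : ℕ → ℕ) (m : ℕ) : ℕ :=
  m.rec falsum.code fun i e => Nat.pair 5 (Nat.pair e (f i))

/-- `exBlock` on Gödel numbers. -/
def exBlockCode (A c m : ℕ) : ℕ :=
  m.rec c fun i e => Nat.pair 7 (Nat.pair (A + i) e)

/-- `allBlock` on Gödel numbers. -/
def allBlockCode (A c m : ℕ) : ℕ :=
  m.rec c fun i e => Nat.pair 6 (Nat.pair (A + i) e)

/-- `termGuard` on Gödel numbers. -/
def termGuardCode (χ : ℕ → ℕ) : ℕ → ℕ :=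
  codeRec fun c x l r =>
    if c.unpair.1 = 0 then χ c.unpair.2
    else if c.unpair.1 = 1 then verum.code
    else if c.unpair.1 = 2 then verum.code
    else if c.unpair.1 = 3 then x
    else Nat.pair 4 (Nat.pair l r)

/-- `guard` on Gödel numbers. -/
def guardCode (χ : ℕ → ℕ) : ℕ → ℕ :=
  codeRec fun c x l r =>
    if c.unpair.1 = 0 then verum.code
    else if c.unpair.1 = 1 then verum.code
    else if c.unpair.1 = 2 then Nat.pair 4 (Nat.pair (termGuardCode χ c.unpair.2.unpair.1)
      (termGuardCode χ c.unpair.2.unpair.2))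
    else if c.unpair.1 = 3 then x
    else if c.unpair.1 = 4 then Nat.pair 4 (Nat.pair l r)
    else if c.unpair.1 = 5 then Nat.pair 4 (Nat.pair l r)
    else Nat.pair 7 (Nat.pair c.unpair.2.unpair.1 r)

/-- `absorb` on Gödel numbers. -/
def absorbCode (δ w : ℕ) : ℕ → ℕ :=
  codeRec fun c _ l r =>
    if c.unpair.1 = 4 then Nat.pair 4 (Nat.pair l r)
    else if c.unpair.1 = 5 then Nat.pair 7 (Nat.pair (w + 1) (Nat.pair 7 (Nat.pair (w + 2)
      (Nat.pair 4 (Nat.pair δ (Nat.pair 5 (Nat.pair (rebindCode w (w + 1) l)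
        (rebindCode w (w + 2) r))))))))
    else if c.unpair.1 = 6 then Nat.pair 7 (Nat.pair (w + 1) (Nat.pair 7 (Nat.pair (w + 2)
      (Nat.pair 4 (Nat.pair δ (rebindCode c.unpair.2.unpair.1 (w + 1)
        (rebindCode w (w + 2) r)))))))
    else c

theorem code_bindBelow (h : ℕ) (φ : RingFormula) (m : ℕ) :
    (bindBelow h φ m).code = bindBelowCode h φ.code m := by
  induction m with
  | zero => rfl
  | succ m ih => exact congrArg (rebindCode m h) ih

theorem code_member (γ : RingFormula) (m h u : ℕ) :
    (member γ m h u).code = memberCode γ.code m h u :=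
  congrArg (rebindCode h u) (code_bindBelow h γ m)

theorem code_conj (f : ℕ → RingFormula) (m : ℕ) :
    (conj f m).code = conjCode (fun i => (f i).code) m := by
  induction m with
  | zero => rfl
  | succ m ih => exact congrArg (fun e => Nat.pair 4 (Nat.pair e (f m).code)) ih

theorem code_disj (f : ℕ → RingFormula) (m : ℕ) :
    (disj f m).code = disjCode (fun i => (f i).code) m := by
  induction m with
  | zero => rfl
  | succ m ih => exact congrArg (fun e => Nat.pair 5 (Nat.pair e (f m).code)) ih

theorem code_exBlock (A : ℕ) (φ : RingFormula) (m : ℕ) :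
    (exBlock A φ m).code = exBlockCode A φ.code m := by
  induction m with
  | zero => rfl
  | succ m ih => exact congrArg (fun e => Nat.pair 7 (Nat.pair (A + m) e)) ih

theorem code_allBlock (A : ℕ) (φ : RingFormula) (m : ℕ) :
    (allBlock A φ m).code = allBlockCode A φ.code m := by
  induction m with
  | zero => rfl
  | succ m ih => exact congrArg (fun e => Nat.pair 6 (Nat.pair (A + m) e)) ih

theorem code_termGuard (χ : ℕ → RingFormula) (t : RingTerm) :
    (termGuard χ t).code = termGuardCode (fun i => (χ i).code) t.code := by
  induction t with
  | var i | zero | one =>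
    rw [termGuardCode, codeRec]
    simp [RingTerm.code, termGuard]
  | neg t ih =>
    obtain ⟨l, r, h⟩ := codeRec_unary _ (by decide : 3 ≠ 0) t.code
    exact ih.trans (h.trans (by simp [termGuardCode])).symm
  | add s t ihs iht =>
    obtain ⟨x, h⟩ := codeRec_binary _ (by decide : 4 ≠ 0) s.code t.code
    refine Eq.trans ?_ h.symm
    simp [termGuard, code, ihs, iht, termGuardCode]
  | mul s t ihs iht =>
    obtain ⟨x, h⟩ := codeRec_binary _ (by decide : 5 ≠ 0) s.code t.code
    refine Eq.trans ?_ h.symm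
    simp [termGuard, code, ihs, iht, termGuardCode]

theorem code_guard (χ : ℕ → RingFormula) (φ : RingFormula) :
    (guard χ φ).code = guardCode (fun i => (χ i).code) φ.code := by
  induction φ with
  | verum | falsum | eq s t =>
    rw [guardCode, codeRec]
    simp [code, guard, code_termGuard]
  | neg φ ih =>
    obtain ⟨l, r, h⟩ := codeRec_unary _ (by decide : 3 ≠ 0) φ.code
    exact ih.trans (h.trans (by simp [guardCode])).symm
  | and φ ψ ih₁ ih₂ =>
    obtain ⟨x, h⟩ := codeRec_binary _ (by decide : 4 ≠ 0) φ.code ψ.code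
    refine Eq.trans ?_ h.symm
    simp [guard, code, ih₁, ih₂, guardCode]
  | or φ ψ ih₁ ih₂ =>
    obtain ⟨x, h⟩ := codeRec_binary _ (by decide : 5 ≠ 0) φ.code ψ.code
    refine Eq.trans ?_ h.symm
    simp [guard, code, ih₁, ih₂, guardCode]
  | all x φ ih =>
    obtain ⟨y, h⟩ := codeRec_binary _ (by decide : 6 ≠ 0) x φ.code
    refine Eq.trans ?_ h.symm
    simp [guard, code, ih, guardCode]
  | ex x φ ih =>
    obtain ⟨y, h⟩ := codeRec_binary _ (by decide : 7 ≠ 0) x φ.code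
    refine Eq.trans ?_ h.symm
    simp [guard, code, ih, guardCode]

theorem code_absorb (δ : RingFormula) (w : ℕ) (φ : RingFormula) :
    (absorb δ w φ).code = absorbCode δ.code w φ.code := by
  induction φ with
  | verum | falsum | eq s t | neg φ _ | ex x φ _ =>
    rw [absorbCode, codeRec]
    simp [code, absorb]
  | and φ ψ ih₁ ih₂ =>
    obtain ⟨x, h⟩ := codeRec_binary _ (by decide : 4 ≠ 0) φ.code ψ.code
    refine Eq.trans ?_ h.symm
    simp [absorb, code, ih₁, ih₂, absorbCode]
  | or φ ψ ih₁ ih₂ =>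
    obtain ⟨x, h⟩ := codeRec_binary _ (by decide : 5 ≠ 0) φ.code ψ.code
    refine Eq.trans ?_ h.symm
    simp [absorb, code, rebind, rebindCode, RingTerm.code, ih₁, ih₂, absorbCode]
  | all x φ ih =>
    obtain ⟨y, h⟩ := codeRec_binary _ (by decide : 6 ≠ 0) x φ.code
    refine Eq.trans ?_ h.symm
    simp [absorb, code, rebind, rebindCode, RingTerm.code, ih, absorbCode]

/-- `dependent` on Gödel numbers. -/
def dependentCode (χ : ℕ → ℕ) (q N T d A : ℕ) : ℕ :=
  exBlockCode A (Nat.pair 4 (Nat.pair (conjCode (fun j => χ (A + j)) N) (Nat.pair 4 (Nat.pair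
    (eq (.expansion q N T d A) .zero).code
    (disjCode (fun a => (neg (eq (.sum (fun j => .coefficient q N A (a * N + j)) N) .zero)).code)
      (q ^ d)))))) (N + q ^ d * N)

/-- `decode` on Gödel numbers. -/
def decodeCode (χ : ℕ → ℕ) (q N w T d A : ℕ) : ℕ :=
  exBlockCode A (Nat.pair 4 (Nat.pair (conjCode (fun j => χ (A + j)) N)
    (and (eq (.var A) .one) (and (eq (.var w) (.expansion q N T d A))
      (and (eq (.var (w + 1)) (.var (A + N + N)))
        (eq (.var (w + 2)) (.var (A + N + 2 * N)))))).code)) (N + q ^ d * N)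

/-- `translate` on Gödel numbers. -/
def translateCode (g c q N d w : ℕ) : ℕ :=
  allBlockCode (w + 4) (Nat.pair 6 (Nat.pair w (Nat.pair 4 (Nat.pair
    (guardCode (memberCode g w (w + 3)) c) (Nat.pair 5 (Nat.pair
      (dependentCode (memberCode g w (w + 3)) q N (w + 4) d (w + 4 + d))
      (absorbCode (decodeCode (memberCode g w (w + 3)) q N w (w + 4) d (w + 4 + d)) w c)))))))
      d

theorem code_translate (γ φ : RingFormula) (q N d w : ℕ) :
    (translate γ φ q N d w).code = translateCode γ.code φ.code q N d w := by
  simp only [translate, translateCode, code_allBlock, code, code_guard, code_absorb, dependent,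
    dependentCode, decode, decodeCode, code_exBlock, code_conj, code_disj, code_member]

section

variable {α : Type*} [Primcodable α]

theorem primrec_rebindCode {u v c : α → ℕ} (hu : Primrec u) (hv : Primrec v) (hc : Primrec c) :
    Primrec fun a => rebindCode (u a) (v a) (c a) :=
  (Primrec.const 7).natPair (hu.natPair ((Primrec.const 4).natPair (Primrec.natPair
    ((Primrec.const 2).natPair (((Primrec.const 0).natPair hu).natPair
      ((Primrec.const 0).natPair hv))) hc)))

theorem primrec_memberCode {c m h u : α → ℕ} (hc : Primrec c) (hm : Primrec m) (hh : Primrec h)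
    (hu : Primrec u) : Primrec fun a => memberCode (c a) (m a) (h a) (u a) :=
  primrec_rebindCode hh hu (Primrec.nat_rec' hm hc
    (h := fun a x => rebindCode x.1 (h a) x.2) (primrec_rebindCode (Primrec.fst.comp Primrec.snd)
      (hh.comp Primrec.fst) (Primrec.snd.comp Primrec.snd)))

theorem primrec_conjCode {f : α → ℕ → ℕ} {m : α → ℕ} (hf : Primrec fun x : α × ℕ => f x.1 x.2)
    (hm : Primrec m) : Primrec fun a => conjCode (f a) (m a) :=
  Primrec.nat_rec' hm (Primrec.const _) (h := fun a x => Nat.pair 4 (Nat.pair x.2 (f a x.1)))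
    ((Primrec.const 4).natPair ((Primrec.snd.comp Primrec.snd).natPair
      (hf.comp (Primrec.fst.pair (Primrec.fst.comp Primrec.snd)))))

theorem primrec_disjCode {f : α → ℕ → ℕ} {m : α → ℕ} (hf : Primrec fun x : α × ℕ => f x.1 x.2)
    (hm : Primrec m) : Primrec fun a => disjCode (f a) (m a) :=
  Primrec.nat_rec' hm (Primrec.const _) (h := fun a x => Nat.pair 5 (Nat.pair x.2 (f a x.1)))
    ((Primrec.const 5).natPair ((Primrec.snd.comp Primrec.snd).natPair
      (hf.comp (Primrec.fst.pair (Primrec.fst.comp Primrec.snd)))))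

theorem primrec_exBlockCode {A c m : α → ℕ} (hA : Primrec A) (hc : Primrec c) (hm : Primrec m) :
    Primrec fun a => exBlockCode (A a) (c a) (m a) :=
  Primrec.nat_rec' hm hc (h := fun a x => Nat.pair 7 (Nat.pair (A a + x.1) x.2))
    ((Primrec.const 7).natPair (((hA.comp Primrec.fst).add (Primrec.fst.comp Primrec.snd)).natPair
      (Primrec.snd.comp Primrec.snd)))

theorem primrec_allBlockCode {A c m : α → ℕ} (hA : Primrec A) (hc : Primrec c) (hm : Primrec m) :
    Primrec fun a => allBlockCode (A a) (c a) (m a) :=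
  Primrec.nat_rec' hm hc (h := fun a x => Nat.pair 6 (Nat.pair (A a + x.1) x.2))
    ((Primrec.const 6).natPair (((hA.comp Primrec.fst).add (Primrec.fst.comp Primrec.snd)).natPair
      (Primrec.snd.comp Primrec.snd)))

theorem primrec_ite_eq {b : α → ℕ} (hb : Primrec b) (n : ℕ) {f g : α → ℕ} (hf : Primrec f)
    (hg : Primrec g) : Primrec fun a => if b a = n then f a else g a :=
  Primrec.ite (Primrec.eq.comp hb (Primrec.const n)) hf hg

theorem primrec_termGuardCode {χ : α → ℕ → ℕ} {c : α → ℕ}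
    (hχ : Primrec fun x : α × ℕ => χ x.1 x.2) (hc : Primrec c) :
    Primrec fun a => termGuardCode (χ a) (c a) := by
  have ha : Primrec fun x : α × ℕ × ℕ × ℕ × ℕ => x.1 := Primrec.fst
  have hn : Primrec fun x : α × ℕ × ℕ × ℕ × ℕ => x.2.1 := Primrec.fst.comp Primrec.snd
  have h2 : Primrec fun x : α × ℕ × ℕ × ℕ × ℕ => x.2.2 := Primrec.snd.comp Primrec.snd
  have hx : Primrec fun x : α × ℕ × ℕ × ℕ × ℕ => x.2.2.1 := Primrec.fst.comp h2
  have hl : Primrec fun x : α × ℕ × ℕ × ℕ × ℕ => x.2.2.2.1 :=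
    Primrec.fst.comp (Primrec.snd.comp h2)
  have hr : Primrec fun x : α × ℕ × ℕ × ℕ × ℕ => x.2.2.2.2 :=
    Primrec.snd.comp (Primrec.snd.comp h2)
  refine Primrec.codeRec ?_ hc
  exact primrec_ite_eq hn.fst_unpair 0 (hχ.comp (ha.pair hn.snd_unpair))
    (primrec_ite_eq hn.fst_unpair 1 (Primrec.const _) (primrec_ite_eq hn.fst_unpair 2
      (Primrec.const _) (primrec_ite_eq hn.fst_unpair 3 hx
        ((Primrec.const 4).natPair (hl.natPair hr)))))

theorem primrec_guardCode {χ : α → ℕ → ℕ} {c : α → ℕ}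
    (hχ : Primrec fun x : α × ℕ => χ x.1 x.2) (hc : Primrec c) :
    Primrec fun a => guardCode (χ a) (c a) := by
  have ha : Primrec fun x : α × ℕ × ℕ × ℕ × ℕ => x.1 := Primrec.fst
  have hn : Primrec fun x : α × ℕ × ℕ × ℕ × ℕ => x.2.1 := Primrec.fst.comp Primrec.snd
  have h2 : Primrec fun x : α × ℕ × ℕ × ℕ × ℕ => x.2.2 := Primrec.snd.comp Primrec.snd
  have hx : Primrec fun x : α × ℕ × ℕ × ℕ × ℕ => x.2.2.1 := Primrec.fst.comp h2
  have hl : Primrec fun x : α × ℕ × ℕ × ℕ × ℕ => x.2.2.2.1 :=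
    Primrec.fst.comp (Primrec.snd.comp h2)
  have hr : Primrec fun x : α × ℕ × ℕ × ℕ × ℕ => x.2.2.2.2 :=
    Primrec.snd.comp (Primrec.snd.comp h2)
  have hχ' : Primrec fun x : (α × ℕ × ℕ × ℕ × ℕ) × ℕ => χ x.1.1 x.2 :=
    hχ.comp ((ha.comp Primrec.fst).pair Primrec.snd)
  have hlr := (Primrec.const 4).natPair (hl.natPair hr)
  refine Primrec.codeRec ?_ hc
  exact primrec_ite_eq hn.fst_unpair 0 (Primrec.const _)
    (primrec_ite_eq hn.fst_unpair 1 (Primrec.const _) (primrec_ite_eq hn.fst_unpair 2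
      ((Primrec.const 4).natPair ((primrec_termGuardCode hχ' hn.snd_unpair.fst_unpair).natPair
        (primrec_termGuardCode hχ' hn.snd_unpair.snd_unpair)))
      (primrec_ite_eq hn.fst_unpair 3 hx (primrec_ite_eq hn.fst_unpair 4 hlr
        (primrec_ite_eq hn.fst_unpair 5 hlr
          ((Primrec.const 7).natPair (hn.snd_unpair.fst_unpair.natPair hr)))))))

theorem primrec_absorbCode {δ w c : α → ℕ} (hδ : Primrec δ) (hw : Primrec w) (hc : Primrec c) :
    Primrec fun a => absorbCode (δ a) (w a) (c a) := by
  have ha : Primrec fun x : α × ℕ × ℕ × ℕ × ℕ => x.1 := Primrec.fst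
  have hn : Primrec fun x : α × ℕ × ℕ × ℕ × ℕ => x.2.1 := Primrec.fst.comp Primrec.snd
  have h2 : Primrec fun x : α × ℕ × ℕ × ℕ × ℕ => x.2.2 := Primrec.snd.comp Primrec.snd
  have hl : Primrec fun x : α × ℕ × ℕ × ℕ × ℕ => x.2.2.2.1 :=
    Primrec.fst.comp (Primrec.snd.comp h2)
  have hr : Primrec fun x : α × ℕ × ℕ × ℕ × ℕ => x.2.2.2.2 :=
    Primrec.snd.comp (Primrec.snd.comp h2)
  have hδ' := hδ.comp ha
  have hw' := hw.comp ha
  have hw1 := hw'.add (Primrec.const 1)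
  have hw2 := hw'.add (Primrec.const 2)
  have wrap : ∀ {f : α × ℕ × ℕ × ℕ × ℕ → ℕ}, Primrec f → Primrec fun x =>
      Nat.pair 7 (Nat.pair (w x.1 + 1) (Nat.pair 7 (Nat.pair (w x.1 + 2)
        (Nat.pair 4 (Nat.pair (δ x.1) (f x)))))) := fun hf =>
    (Primrec.const 7).natPair (hw1.natPair ((Primrec.const 7).natPair (hw2.natPair
      ((Primrec.const 4).natPair (hδ'.natPair hf)))))
  refine Primrec.codeRec ?_ hc
  exact primrec_ite_eq hn.fst_unpair 4 ((Primrec.const 4).natPair (hl.natPair hr))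
    (primrec_ite_eq hn.fst_unpair 5 (wrap ((Primrec.const 5).natPair
      ((primrec_rebindCode hw' hw1 hl).natPair (primrec_rebindCode hw' hw2 hr))))
      (primrec_ite_eq hn.fst_unpair 6 (wrap (primrec_rebindCode hn.snd_unpair.fst_unpair hw1
        (primrec_rebindCode hw' hw2 hr))) hn))

theorem primrec_dependentCode {χ : α → ℕ → ℕ} {q N T d A : α → ℕ}
    (hχ : Primrec fun x : α × ℕ => χ x.1 x.2) (hq : Primrec q) (hN : Primrec N)
    (hT : Primrec T) (hd : Primrec d) (hA : Primrec A) :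
    Primrec fun a => dependentCode (χ a) (q a) (N a) (T a) (d a) (A a) := by
  have hf : Primrec (Prod.fst : α × ℕ → α) := Primrec.fst
  have hf2 : Primrec fun x : (α × ℕ) × ℕ => x.1.1 := Primrec.fst.comp Primrec.fst
  refine primrec_exBlockCode hA ((Primrec.const 4).natPair ((primrec_conjCode
    (f := fun a j => χ a (A a + j)) (hχ.comp (hf.pair ((hA.comp hf).add Primrec.snd))) hN).natPair
      ((Primrec.const 4).natPair
    (Primrec.natPair ((Primrec.const 2).natPair
      ((RingTerm.primrec_code_expansion hq hN hT hd hA).natPair (Primrec.const _)))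
      (primrec_disjCode (f := fun a b => (neg (eq (.sum (fun j => .coefficient (q a) (N a) (A a)
        (b * N a + j)) (N a)) .zero)).code) ?_ (hq.pow hd)))))) (hN.add ((hq.pow hd).mul hN))
  refine (Primrec.const 3).natPair ((Primrec.const 2).natPair (Primrec.natPair
    (RingTerm.primrec_code_sum ?_ (hN.comp hf)) (Primrec.const _)))
  exact RingTerm.primrec_code_coefficient (hq.comp hf2) (hN.comp hf2) (hA.comp hf2)
    (((Primrec.snd.comp Primrec.fst).mul (hN.comp hf2)).add Primrec.snd)

theorem primrec_decodeCode {χ : α → ℕ → ℕ} {q N w T d A : α → ℕ}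
    (hχ : Primrec fun x : α × ℕ => χ x.1 x.2) (hq : Primrec q) (hN : Primrec N)
    (hw : Primrec w) (hT : Primrec T) (hd : Primrec d) (hA : Primrec A) :
    Primrec fun a => decodeCode (χ a) (q a) (N a) (w a) (T a) (d a) (A a) := by
  have hf : Primrec (Prod.fst : α × ℕ → α) := Primrec.fst
  have hvar : ∀ {i : α → ℕ}, Primrec i → Primrec fun a => (RingTerm.var (i a)).code :=
    fun hi => (Primrec.const 0).natPair hi
  have heq : ∀ {s t : α → RingTerm}, Primrec (fun a => (s a).code) →
      Primrec (fun a => (t a).code) → Primrec fun a => (eq (s a) (t a)).code :=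
    fun hs ht => (Primrec.const 2).natPair (hs.natPair ht)
  have hand : ∀ {s t : α → RingFormula}, Primrec (fun a => (s a).code) →
      Primrec (fun a => (t a).code) → Primrec fun a => (and (s a) (t a)).code :=
    fun hs ht => (Primrec.const 4).natPair (hs.natPair ht)
  exact primrec_exBlockCode hA ((Primrec.const 4).natPair ((primrec_conjCode
    (f := fun a j => χ a (A a + j)) (hχ.comp (hf.pair ((hA.comp hf).add Primrec.snd))) hN).natPair
    (hand (heq (hvar hA) (Primrec.const _)) (hand
      (heq (hvar hw) (RingTerm.primrec_code_expansion hq hN hT hd hA))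
      (hand (heq (hvar (hw.add (Primrec.const 1))) (hvar ((hA.add hN).add hN)))
        (heq (hvar (hw.add (Primrec.const 2)))
          (hvar ((hA.add hN).add ((Primrec.const 2).mul hN))))))))) (hN.add ((hq.pow hd).mul hN))

theorem primrec_translateCode {g c q N d w : α → ℕ} (hg : Primrec g) (hc : Primrec c)
    (hq : Primrec q) (hN : Primrec N) (hd : Primrec d) (hw : Primrec w) :
    Primrec fun a => translateCode (g a) (c a) (q a) (N a) (d a) (w a) := by
  have hf : Primrec (Prod.fst : α × ℕ → α) := Primrec.fst
  have hw3 := hw.add (Primrec.const 3)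
  have hw4 := hw.add (Primrec.const 4)
  have hχ : Primrec fun x : α × ℕ => memberCode (g x.1) (w x.1) (w x.1 + 3) x.2 :=
    primrec_memberCode (hg.comp hf) (hw.comp hf) (hw3.comp hf) Primrec.snd
  exact primrec_allBlockCode hw4 ((Primrec.const 6).natPair (hw.natPair
    ((Primrec.const 4).natPair ((primrec_guardCode hχ hc).natPair ((Primrec.const 5).natPair
      ((primrec_dependentCode hχ hq hN hw4 hd (hw4.add hd)).natPair
        (primrec_absorbCode (primrec_decodeCode hχ hq hN hw hw4 hd (hw4.add hd)) hw hc)))))))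
    hd

end

end RingFormula

/-! ## Bases over the subfield of `q`-th powers -/

section PowerBasis

variable {K : Type u} [Field K] (p r : ℕ) [ExpChar K p]

/-- Each scalar in the subfield is a `p ^ r`-th power, so linear algebra over it can be written with
roots as unknowns, which is the form that ring formulas express. -/
theorem linearIndependent_pow_iff {m : ℕ} (e : ℕ → K) :
    LinearIndependent (iterateFrobenius K p r).fieldRange (fun i : Fin m => e i) ↔
      ∀ z : ℕ → K, ∑ i ∈ Finset.range m, e i * z i ^ p ^ r = 0 → ∀ i < m, z i = 0 := by
  rw [Fintype.linearIndependent_iff]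
  constructor
  · intro h z hz i hi
    have := h (fun i => ⟨z i ^ p ^ r, z i, rfl⟩) (by
      rw [← hz, ← Fin.sum_univ_eq_sum_range fun i => e i * z i ^ p ^ r]
      exact Finset.sum_congr rfl fun i _ => (mul_comm _ _)) ⟨i, hi⟩
    exact eq_zero_of_pow_eq_zero (congrArg Subtype.val this)
  · intro h g hg i
    choose z hz using fun i => (g i).2
    have := h (fun i => if hi : i < m then z ⟨i, hi⟩ else 0) (by
      rw [← Fin.sum_univ_eq_sum_range fun i =>
        e i * (if hi : i < m then z ⟨i, hi⟩ else 0) ^ p ^ r, ← hg]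
      refine Finset.sum_congr rfl fun i _ => ?_
      rw [dif_pos i.2, mul_comm]
      exact congrArg (· * e i) (hz i)) i i.2
    rw [dif_pos i.2] at this
    refine Subtype.ext ((hz i).symm.trans ?_)
    rw [this, map_zero]
    rfl

theorem span_pow_eq_top_iff {m : ℕ} (e : ℕ → K) :
    ⊤ ≤ Submodule.span (iterateFrobenius K p r).fieldRange (Set.range fun i : Fin m => e i) ↔
      ∀ x : K, ∃ z : ℕ → K, x = ∑ i ∈ Finset.range m, e i * z i ^ p ^ r := by
  constructor
  · intro h x
    obtain ⟨g, hg⟩ := (Submodule.mem_span_range_iff_exists_fun _).1 (h (show x ∈ ⊤ from trivial))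
    choose z hz using fun i => (g i).2
    refine ⟨fun i => if hi : i < m then z ⟨i, hi⟩ else 0, ?_⟩
    rw [← Fin.sum_univ_eq_sum_range fun i =>
        e i * (if hi : i < m then z ⟨i, hi⟩ else 0) ^ p ^ r, ← hg]
    refine Finset.sum_congr rfl fun i _ => ?_
    rw [dif_pos i.2, mul_comm]
    exact congrArg (· * e i) (hz i).symm
  · intro h x _
    obtain ⟨z, hz⟩ := h x
    refine (Submodule.mem_span_range_iff_exists_fun _).2
      ⟨fun i => ⟨z i ^ p ^ r, z i, rfl⟩, ?_⟩
    rw [hz, ← Fin.sum_univ_eq_sum_range fun i => e i * z i ^ p ^ r]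
    exact Finset.sum_congr rfl fun i _ => (mul_comm _ _)

/-- If `m` elements form a basis over the subfield of `p ^ r`-th powers, then any `m` linearly
independent elements span. -/
theorem exists_eq_sum_of_independent {m : ℕ} {e₀ e : ℕ → K}
    (h₀ : ∀ z : ℕ → K, ∑ i ∈ Finset.range m, e₀ i * z i ^ p ^ r = 0 → ∀ i < m, z i = 0)
    (h₁ : ∀ x : K, ∃ z : ℕ → K, x = ∑ i ∈ Finset.range m, e₀ i * z i ^ p ^ r)
    (h : ∀ z : ℕ → K, ∑ i ∈ Finset.range m, e i * z i ^ p ^ r = 0 → ∀ i < m, z i = 0) (x : K) :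
    ∃ z : ℕ → K, x = ∑ i ∈ Finset.range m, e i * z i ^ p ^ r := by
  rw [← linearIndependent_pow_iff p r] at h h₀
  rw [← span_pow_eq_top_iff p r] at h₁
  have hrank := Module.finrank_eq_card_basis (Module.Basis.mk h₀ h₁)
  refine (span_pow_eq_top_iff p r e).1 ?_ x
  by_cases hm : m = 0
  · subst hm
    simpa [Set.range_eq_empty] using h₁
  · have : Nonempty (Fin m) := ⟨⟨0, Nat.pos_of_ne_zero hm⟩⟩
    exact (h.span_eq_top_of_card_eq_finrank hrank.symm).ge

end PowerBasis

section Coding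

variable {k K : Type u} [Field k] [Field K] {p r : ℕ}

/-- A basis of `K` over the subfield of `q`-th powers, where `q = p ^ r`, that consists of the
products of the digit monomials in `t` and the images of elements `b` spanning `k` over the
subfield of its `q`-th powers. -/
structure IsDigitBasis (ι : k →+* K) (q N d : ℕ) (t : ℕ → K) (b : ℕ → k) : Prop where
  one : b 0 = 1
  exists_eq_const (c : k) : ∃ a : ℕ → k, c = ∑ j ∈ Finset.range N, b j * a j ^ q
  exists_eq (x : K) : ∃ z : ℕ → K, x = digitExpansion q N d t (fun j => ι (b j)) z
  independent (z : ℕ → K) (h : digitExpansion q N d t (fun j => ι (b j)) z = 0) :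
    ∀ i < q ^ d * N, z i = 0

variable {ι : k →+* K} {N d : ℕ} {t : ℕ → K} {b : ℕ → k}

theorem digitExpansion_eq_sum (q N d : ℕ) (t c z : ℕ → K) :
    digitExpansion q N d t c z =
      ∑ i ∈ Finset.range (q ^ d * N), digitMonomial q d t (i / N) * c (i % N) * z i ^ q :=
  Finset.sum_congr rfl fun i _ => by ring

theorem digitMonomial_zero (q d : ℕ) (t : ℕ → K) : digitMonomial q d t 0 = 1 := by
  simp [digitMonomial]

/-- The basis elements of the field of constants are independent over `q`-th powers. -/
theorem IsDigitBasis.independent_const (hp : 0 < p) (hN : 0 < N)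
    (h : IsDigitBasis ι (p ^ r) N d t b) (z : ℕ → K)
    (hz : ∑ j ∈ Finset.range N, ι (b j) * z j ^ p ^ r = 0) : ∀ j < N, z j = 0 := by
  have hq : 0 < (p ^ r) ^ d := by positivity
  have h0 : (0 : K) ^ p ^ r = 0 := zero_pow (by positivity)
  intro j hj
  -- The relation is placed in the block of the monomial `1`; all other blocks are zero.
  have := h.independent (fun i => if i < N then z i else 0) ?_ j (by nlinarith)
  · simpa [hj] using this
  · rw [digitExpansion_eq _ _ _ hN, Finset.sum_eq_single_of_mem 0 (Finset.mem_range.2 hq)]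
    · rw [digitMonomial_zero, one_mul, ← hz]
      refine Finset.sum_congr rfl fun j hj => ?_
      simp [Finset.mem_range.1 hj]
    · intro a _ ha
      refine mul_eq_zero_of_right _ (Finset.sum_eq_zero fun j hj => ?_)
      have : N ≤ a * N := Nat.le_mul_of_pos_left N (Nat.pos_of_ne_zero ha)
      rw [if_neg (by omega), h0, mul_zero]

/-- Rewriting an expansion with arbitrary constants in terms of the basis constants. -/
theorem sum_const_eq [ExpChar K p] (a : ℕ → ℕ → k) (c : ℕ → K) (z : ℕ → K)
    (hc : ∀ j < N, c j = ι (∑ l ∈ Finset.range N, b l * a j l ^ p ^ r)) :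
    ∑ j ∈ Finset.range N, c j * z j ^ p ^ r = ∑ l ∈ Finset.range N,
      ι (b l) * (∑ j ∈ Finset.range N, ι (a j l) * z j) ^ p ^ r := by
  simp only [sum_pow_char_pow, Finset.mul_sum, mul_pow]
  rw [Finset.sum_comm]
  refine Finset.sum_congr rfl fun j hj => ?_
  rw [hc j (Finset.mem_range.1 hj), map_sum, Finset.sum_mul]
  exact Finset.sum_congr rfl fun l _ => by rw [map_mul, map_pow]; ring

/-- By additivity of Frobenius, passing from the constants `c` to `b` acts on coordinates by one
matrix over `k`, the same in each block. -/
theorem digitExpansion_const_eq [ExpChar K p] (hN : 0 < N) (a : ℕ → ℕ → k) (c z : ℕ → K)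
    (hc : ∀ j < N, c j = ι (∑ l ∈ Finset.range N, b l * a j l ^ p ^ r)) :
    digitExpansion (p ^ r) N d t c z = digitExpansion (p ^ r) N d t (fun j => ι (b j))
      fun i => ∑ j ∈ Finset.range N, ι (a j (i % N)) * z (i / N * N + j) := by
  simp only [digitExpansion_eq _ _ _ hN]
  refine Finset.sum_congr rfl fun e _ => congrArg _ ?_
  rw [sum_const_eq a c (fun j => z (e * N + j)) hc]
  refine Finset.sum_congr rfl fun l hl => ?_
  have hl := Finset.mem_range.1 hl
  rw [Nat.mul_add_mod_of_lt hl, Nat.mul_comm e N, Nat.mul_add_div hN, Nat.div_eq_of_lt hl,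
    Nat.add_zero, Nat.mul_comm e N]

theorem IsDigitBasis.exists_coefficients (h : IsDigitBasis ι (p ^ r) N d t b) {c : ℕ → K}
    (hc : ∀ j < N, c j ∈ Set.range ι) :
    ∃ a : ℕ → ℕ → k, ∀ j < N, c j = ι (∑ l ∈ Finset.range N, b l * a j l ^ p ^ r) := by
  have : ∀ j, ∃ a : ℕ → k, j < N → c j = ι (∑ l ∈ Finset.range N, b l * a l ^ p ^ r) := by
    intro j
    by_cases hj : j < N
    · obtain ⟨x, hx⟩ := hc j hj
      obtain ⟨a, ha⟩ := h.exists_eq_const x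
      exact ⟨a, fun _ => by rw [← ha, hx]⟩
    · exact ⟨0, fun h => absurd h hj⟩
  choose a ha using this
  exact ⟨a, ha⟩

/-- Rewritten in terms of `b`, a relation has all coordinates zero, and therefore all its
coefficients in the compositum vanish as well. -/
theorem IsDigitBasis.not_digitDependent [ExpChar K p] (hp : 0 < p) (hN : 0 < N)
    (h : IsDigitBasis ι (p ^ r) N d t b) : ¬ DigitDependent (Set.range ι) (p ^ r) N d t := by
  rintro ⟨c, z, hc, hz, e, he, hne⟩
  obtain ⟨a, ha⟩ := h.exists_coefficients hc
  rw [digitExpansion_const_eq hN a c z ha] at hz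
  refine hne ?_
  rw [sum_const_eq a c (fun j => z (e * N + j)) ha]
  refine Finset.sum_eq_zero fun l hl => ?_
  have hl := Finset.mem_range.1 hl
  have := h.independent _ hz (e * N + l) (by nlinarith)
  rw [Nat.mul_add_mod_of_lt hl, Nat.mul_comm e N, Nat.mul_add_div hN, Nat.div_eq_of_lt hl,
    Nat.add_zero] at this
  rw [this, zero_pow (by positivity), mul_zero]

/-- If the digit monomials in `t'` satisfy no linear relation over the compositum of the constants
and the `q`-th powers, then they also yield a basis. -/
theorem IsDigitBasis.of_not_digitDependent [ExpChar K p] (hp : 0 < p) (hN : 0 < N)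
    (h : IsDigitBasis ι (p ^ r) N d t b) {t' : ℕ → K}
    (ht' : ¬ DigitDependent (Set.range ι) (p ^ r) N d t') : IsDigitBasis ι (p ^ r) N d t' b where
  one := h.one
  exists_eq_const := h.exists_eq_const
  independent := by
    intro z hz i hi
    by_contra hne
    -- The `b j` themselves serve as constants; the block containing `i` has a nonzero coefficient
    -- because they are independent over `q`-th powers.
    refine ht' ⟨_, z, fun j _ => ⟨b j, rfl⟩, hz, i / N,
      Nat.div_lt_of_lt_mul (by rwa [Nat.mul_comm]), fun h0 => hne ?_⟩
    have := h.independent_const hp hN (fun j => z (i / N * N + j)) h0 (i % N) (Nat.mod_lt _ hN)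
    rwa [Nat.div_add_mod'] at this
  exists_eq := by
    have h₀ := h.independent
    have h₁ := h.exists_eq
    simp only [digitExpansion_eq_sum] at h₀ h₁ ⊢
    -- Independence suffices: the number of products equals the dimension, which the given basis
    -- determines.
    refine exists_eq_sum_of_independent p r h₀ h₁ fun z hz i hi => ?_
    by_contra hne
    rw [← digitExpansion_eq_sum (p ^ r) N d t' (fun j => ι (b j))] at hz
    refine ht' ⟨_, z, fun j _ => ⟨b j, rfl⟩, hz, i / N,
      Nat.div_lt_of_lt_mul (by rwa [Nat.mul_comm]), fun h0 => hne ?_⟩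
    have := h.independent_const hp hN (fun j => z (i / N * N + j)) h0 (i % N) (Nat.mod_lt _ hN)
    rwa [Nat.div_add_mod'] at this

theorem IsDigitBasis.exists_digitDecode (h : IsDigitBasis ι (p ^ r) N d t b) (x : K) :
    ∃ y z, DigitDecode (Set.range ι) (p ^ r) N d t x y z := by
  obtain ⟨z, hz⟩ := h.exists_eq x
  exact ⟨_, _, _, z, fun j _ => ⟨b j, rfl⟩, by rw [h.one, map_one], hz, rfl, rfl⟩

/-- Any pair is encoded by an element that decodes to this pair only. -/
theorem IsDigitBasis.exists_code [ExpChar K p] (hp : 0 < p) (hN : 0 < N) (hq : 2 < (p ^ r) ^ d)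
    (h : IsDigitBasis ι (p ^ r) N d t b) {s : ℕ → K}
    (hs : ∀ a : ℕ → k, ∑ j ∈ Finset.range N, ι (a j) * s j = 0 → ∀ j < N, a j = 0) (y y' : K) :
    ∃ x, ∀ w w', DigitDecode (Set.range ι) (p ^ r) N d t x w w' → w = y ∧ w' = y' := by
  -- Block `0` holds the elements independent over `k`; blocks `1` and `2` hold `(y, 0, …, 0)` and
  -- `(y', 0, …, 0)`.
  let Z : ℕ → K := fun i => if i < N then s i else if i = N then y else if i = 2 * N then y' else 0
  refine ⟨digitExpansion (p ^ r) N d t (fun j => ι (b j)) Z, ?_⟩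
  rintro w w' ⟨c, z, hc, hc0, hx, rfl, rfl⟩
  obtain ⟨a, ha⟩ := h.exists_coefficients hc
  rw [digitExpansion_const_eq hN a c z ha] at hx
  -- Two expansions of the same element in the basis given by `b`: their coordinates agree.
  have hZ : ∀ i < (p ^ r) ^ d * N,
      Z i = ∑ j ∈ Finset.range N, ι (a j (i % N)) * z (i / N * N + j) := by
    intro i hi
    refine sub_eq_zero.1 (h.independent
      (fun i => Z i - ∑ j ∈ Finset.range N, ι (a j (i % N)) * z (i / N * N + j)) ?_ i hi)
    rw [← sub_eq_zero] at hx
    rw [← hx]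
    simp only [digitExpansion, ← Finset.sum_sub_distrib, sub_pow_expChar_pow]
    exact Finset.sum_congr rfl fun i _ => by ring
  have hrow : ∀ e < (p ^ r) ^ d, ∀ l < N,
      Z (e * N + l) = ∑ j ∈ Finset.range N, ι (a j l) * z (e * N + j) := by
    intro e he l hl
    have := hZ (e * N + l) (by nlinarith)
    rwa [Nat.mul_add_mod_of_lt hl, Nat.mul_comm e N, Nat.mul_add_div hN, Nat.div_eq_of_lt hl,
      Nat.add_zero, Nat.mul_comm N e] at this
  -- the coefficient matrix is invertible
  let M : Matrix (Fin N) (Fin N) k := fun l j => a j l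
  have hdet : M.det ≠ 0 := by
    intro hdet
    -- Block `0` says that the vector `s` is `M` applied to coordinates of `z`, so a vector killing
    -- `M` from the left is a linear relation over `k` between the `s l`.
    obtain ⟨v, hv, hvM⟩ := Matrix.exists_vecMul_eq_zero_iff.2 hdet
    refine hv (funext fun l => ?_)
    have := hs (fun l => if hl : l < N then v ⟨l, hl⟩ else 0) ?_ l l.2
    · simpa using this
    · have h1 : ∀ l ∈ Finset.range N, s l = ∑ j ∈ Finset.range N, ι (a j l) * z j := by
        intro l hl
        have := hrow 0 (by omega) l (Finset.mem_range.1 hl)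
        simpa [Z, Finset.mem_range.1 hl] using this
      rw [Finset.sum_congr rfl fun l hl => by rw [h1 l hl]]
      simp only [Finset.mul_sum]
      rw [Finset.sum_comm]
      refine Finset.sum_eq_zero fun j hj => ?_
      have h2 := congrArg ι (congrFun hvM ⟨j, Finset.mem_range.1 hj⟩)
      simp only [Matrix.vecMul, dotProduct, M, map_sum, map_mul, Pi.zero_apply, map_zero] at h2
      rw [← Fin.sum_univ_eq_sum_range fun l =>
        ι (if hl : l < N then v ⟨l, hl⟩ else 0) * (ι (a j l) * z j)]
      simp only [Fin.is_lt, dif_pos, Fin.eta, ← mul_assoc, ← Finset.sum_mul]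
      rw [h2, zero_mul]
  -- Since `c 0 = 1 = b 0`, the first column of the matrix is the first unit vector.
  have ha0 : ∀ l < N, a 0 l = if l = 0 then 1 else 0 := by
    intro l hl
    have h1 := ha 0 hN
    rw [hc0, ← map_one ι, ← h.one] at h1
    have h2 := h.independent_const hp hN (fun l => ι (a 0 l - if l = 0 then 1 else 0)) ?_ l hl
    · exact sub_eq_zero.1 ((map_eq_zero ι).1 h2)
    · simp only [map_sub, sub_pow_expChar_pow, mul_sub, Finset.sum_sub_distrib]
      rw [map_sum] at h1
      simp only [map_mul, map_pow] at h1
      rw [← h1, Finset.sum_eq_single_of_mem 0 (Finset.mem_range.2 hN)]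
      · simp
      · intro l _ hl
        have : p ^ r ≠ 0 := by positivity
        rw [if_neg hl, map_zero, zero_pow this, mul_zero]
  -- Hence `(x, 0, …, 0)` is mapped to itself, and by injectivity it is the only solution for a
  -- block of this shape.
  have solve : ∀ e < (p ^ r) ^ d, ∀ x, (∀ l < N, Z (e * N + l) = if l = 0 then x else 0) →
      z (e * N) = x := by
    intro e he x hx
    have hinj : Function.Injective (M.map ι).mulVec := by
      rw [Matrix.mulVec_injective_iff_isUnit, Matrix.isUnit_iff_isUnit_det, isUnit_iff_ne_zero]
      rw [← RingHom.mapMatrix_apply, ← RingHom.map_det]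
      exact (map_ne_zero ι).2 hdet
    have := @hinj (fun j => z (e * N + j)) (fun j => if (j : ℕ) = 0 then x else 0) ?_
    · simpa using congrFun this ⟨0, hN⟩
    · funext l
      have h1 := hrow e he l l.2
      rw [hx l l.2, ← Fin.sum_univ_eq_sum_range fun j => ι (a j l) * z (e * N + j)] at h1
      refine h1.symm.trans ?_
      change _ = ∑ j : Fin N, ι (a j l) * if (j : ℕ) = 0 then x else 0
      rw [Finset.sum_eq_single (⟨0, hN⟩ : Fin N)]
      · rw [ha0 l l.2]
        by_cases h0 : (l : ℕ) = 0 <;> simp [h0]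
      · intro j _ hj
        rw [if_neg fun h0 => hj (Fin.ext h0), mul_zero]
      · simp
  constructor
  · have := solve 1 (by omega) y fun l hl => by
      by_cases h0 : l = 0
      · simp [Z, h0]
      · simp only [Z]
        rw [if_neg (by omega), if_neg (by omega), if_neg (by omega), if_neg h0]
    simpa using this
  · exact solve 2 hq y' fun l hl => by
      by_cases h0 : l = 0
      · simp only [Z, h0]
        rw [if_neg (by omega), if_neg (by omega), if_pos (by omega), if_pos trivial]
      · simp only [Z]
        rw [if_neg (by omega), if_neg (by omega), if_neg (by omega), if_neg h0]

end Coding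

/-! ## Digit monomials in separating transcendence bases -/

section Separating

theorem digitMonomial_finFunctionFinEquiv {R : Type u} [CommRing R] {q d : ℕ} (t : ℕ → R)
    (a : Fin d → Fin q) :
    digitMonomial q d t (finFunctionFinEquiv a) = ∏ i : Fin d, t i ^ (a i : ℕ) := by
  rw [digitMonomial, ← Fin.prod_univ_eq_prod_range
    fun i => t i ^ ((finFunctionFinEquiv a : ℕ) / q ^ i % q)]
  refine Finset.prod_congr rfl fun i _ => ?_
  have h : (finFunctionFinEquiv.symm (finFunctionFinEquiv a)) i = a i := by simp
  rw [← h]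
  simp only [Equiv.symm_apply_apply]
  rw [← congrArg Fin.val h]
  rfl

theorem sum_range_finFunctionFinEquiv {M : Type u} [AddCommMonoid M] (q d : ℕ) (f : ℕ → M) :
    ∑ a ∈ Finset.range (q ^ d), f a = ∑ a : Fin d → Fin q, f (finFunctionFinEquiv a) := by
  rw [← Fin.sum_univ_eq_sum_range]
  exact (finFunctionFinEquiv.sum_comp fun a : Fin (q ^ d) => f a).symm

variable {F K : Type u} [Field F] [Field K] [Algebra F K] {p r d : ℕ}

open MvPolynomial in
-- An exponent `a + p ^ r • β` with the entries of `a` below `p ^ r` determines `a` and `β` by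
-- division with remainder, so no terms can cancel.
theorem eq_zero_of_sum_monomial_mul_pow [ExpChar F p]
    (P : (Fin d → Fin (p ^ r)) → MvPolynomial (Fin d) F)
    (h : ∑ a, (∏ i : Fin d, (X i : MvPolynomial (Fin d) F) ^ (a i : ℕ)) * P a ^ p ^ r = 0)
    (a : Fin d → Fin (p ^ r)) : P a = 0 := by
  by_contra hne
  obtain ⟨β, hβ⟩ := support_nonempty.2 hne
  have hexp : ∀ (a : Fin d → Fin (p ^ r)) (Q : MvPolynomial (Fin d) F),
      (∏ i : Fin d, (X i : MvPolynomial (Fin d) F) ^ (a i : ℕ)) * Q ^ p ^ r =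
        ∑ m ∈ Q.support, monomial (Finsupp.equivFunOnFinite.symm (fun i => (a i : ℕ)) + p ^ r • m)
          (coeff m Q ^ p ^ r) := by
    intro a Q
    have h1 : (∏ i : Fin d, (X i : MvPolynomial (Fin d) F) ^ (a i : ℕ)) =
        monomial (Finsupp.equivFunOnFinite.symm fun i => (a i : ℕ)) 1 := by
      rw [monomial_eq, C_1, one_mul, Finsupp.prod_fintype _ _ fun _ => pow_zero _]
      rfl
    conv_lhs => rw [Q.as_sum, sum_pow_char_pow p r, h1, Finset.mul_sum]
    refine Finset.sum_congr rfl fun m _ => ?_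
    rw [monomial_pow, monomial_mul, one_mul]
  simp only [hexp] at h
  have h2 := congrArg (coeff (Finsupp.equivFunOnFinite.symm (fun i => (a i : ℕ)) + p ^ r • β)) h
  simp only [coeff_sum, coeff_monomial, coeff_zero] at h2
  have hinj : ∀ (a' : Fin d → Fin (p ^ r)) (β' : Fin d →₀ ℕ),
      Finsupp.equivFunOnFinite.symm (fun i => (a' i : ℕ)) + p ^ r • β' =
        Finsupp.equivFunOnFinite.symm (fun i => (a i : ℕ)) + p ^ r • β → a' = a ∧ β' = β := by
    intro a' β' h'
    have h3 : ∀ i, (a' i : ℕ) + p ^ r * β' i = a i + p ^ r * β i := fun i => by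
      simpa using DFunLike.congr_fun h' i
    have h4 : ∀ i, (a' i : ℕ) = a i := fun i => by
      have := congrArg (· % p ^ r) (h3 i)
      simpa [Nat.add_mul_mod_self_left, Nat.mod_eq_of_lt (a' i).2, Nat.mod_eq_of_lt (a i).2]
        using this
    refine ⟨funext fun i => Fin.ext (h4 i), Finsupp.ext fun i => ?_⟩
    have := h3 i
    rw [h4 i, Nat.add_left_cancel_iff] at this
    exact Nat.eq_of_mul_eq_mul_left (lt_of_le_of_lt (Nat.zero_le _) (a i).2) this
  rw [Finset.sum_eq_single a, Finset.sum_eq_single β] at h2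
  · rw [if_pos rfl] at h2
    exact (mem_support_iff.1 hβ) (eq_zero_of_pow_eq_zero h2)
  · intro β' _ hne'
    rw [if_neg fun h' => hne' (hinj _ _ h').2]
  · exact fun h' => absurd hβ h'
  · intro a' _ hne'
    exact Finset.sum_eq_zero fun β' _ => if_neg fun h' => hne' (hinj _ _ h').1
  · exact fun h' => absurd (Finset.mem_univ _) h'

/-- The span of the digit monomials over the subfield of `p ^ r`-th powers. -/
def digitSpan (p r d : ℕ) [ExpChar K p] (t : ℕ → K) :
    Submodule (iterateFrobenius K p r).fieldRange K :=
  Submodule.span _ (Set.range fun a : Fin ((p ^ r) ^ d) => digitMonomial (p ^ r) d t a)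

theorem pow_mul_mem [ExpChar K p] {V : Submodule (iterateFrobenius K p r).fieldRange K}
    (y : K) {x : K}
    (hx : x ∈ V) : y ^ p ^ r * x ∈ V :=
  V.smul_mem (⟨y ^ p ^ r, y, rfl⟩ : (iterateFrobenius K p r).fieldRange) hx

/-- Coefficients are `p ^ r`-th powers because `F` is perfect; exponents are split by division with
remainder. -/
theorem aeval_mem_digitSpan [ExpChar F p] [ExpChar K p] [PerfectField F] (hp : 0 < p) (t : ℕ → K)
    (P : MvPolynomial (Fin d) F) :
    MvPolynomial.aeval (fun i : Fin d => t i) P ∈ digitSpan p r d t := by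
  have hq : 0 < p ^ r := by positivity
  induction P using MvPolynomial.induction_on' with
  | monomial m c =>
    obtain ⟨c', rfl⟩ := (iterateFrobeniusEquiv F p r).surjective c
    have : MvPolynomial.aeval (fun i : Fin d => t i) (MvPolynomial.monomial m
        (iterateFrobeniusEquiv F p r c')) =
        (algebraMap F K c' * ∏ i : Fin d, t i ^ (m i / p ^ r)) ^ p ^ r *
          digitMonomial (p ^ r) d t
            (finFunctionFinEquiv fun i => (⟨m i % p ^ r, Nat.mod_lt _ hq⟩ : Fin (p ^ r))) := by
      rw [digitMonomial_finFunctionFinEquiv, MvPolynomial.aeval_monomial,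
        Finsupp.prod_fintype _ _ fun _ => pow_zero _, iterateFrobeniusEquiv_def, map_pow, mul_pow,
        mul_assoc, ← Finset.prod_pow, ← Finset.prod_mul_distrib]
      refine congrArg _ (Finset.prod_congr rfl fun i _ => ?_)
      rw [← pow_mul, ← pow_add, Nat.div_add_mod']
    rw [this]
    exact pow_mul_mem _ (Submodule.subset_span ⟨_, rfl⟩)
  | add P Q hP hQ => rw [map_add]; exact add_mem hP hQ

/-- With `q = p ^ r`, the quotient `x / y` equals `(x * y ^ (q - 1)) * (1 / y) ^ q`. A
`K^q`-subspace that contains a ring therefore contains its fractions. -/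
theorem div_mem_of_mul_pow_mem [ExpChar K p] (hp : 0 < p)
    {V : Submodule (iterateFrobenius K p r).fieldRange K} {x y : K}
    (h : x * y ^ (p ^ r - 1) ∈ V) : x / y ∈ V := by
  by_cases hy : y = 0
  · rw [hy, div_zero]
    exact V.zero_mem
  · convert pow_mul_mem y⁻¹ h using 1
    have : p ^ r = p ^ r - 1 + 1 := (Nat.sub_add_cancel (Nat.one_le_pow _ _ hp)).symm
    conv_rhs => rw [inv_pow, this, Nat.add_sub_cancel, pow_succ]
    field_simp

/-- Separability of `K` over `L = F(t)` means that `K` is spanned over `L` by `p ^ r`-th powers;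
polynomials in `t`, hence their fractions, lie in the digit span. -/
theorem digitSpan_eq_top [ExpChar F p] [ExpChar K p] [PerfectField F] (hp : 0 < p) (t : ℕ → K)
    [Algebra.IsSeparable (IntermediateField.adjoin F (Set.range fun i : Fin d => t i)) K] :
    digitSpan p r d t = ⊤ := by
  let L := IntermediateField.adjoin F (Set.range fun i : Fin d => t i)
  have hL : ∀ x : L, (x : K) ∈ digitSpan p r d t := by
    intro x
    obtain ⟨P, Q, hPQ⟩ := (IntermediateField.mem_adjoin_range_iff F _ (x : K)).1 x.2
    rw [hPQ]
    refine div_mem_of_mul_pow_mem hp ?_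
    rw [← map_pow, ← map_mul]
    exact aeval_mem_digitSpan hp t _
  have hexp : ExpChar L p := expChar_of_injective_algebraMap (algebraMap F L).injective p
  have hspan := Field.span_map_pow_expChar_pow_eq_top_of_isSeparable (F := L) (E := K) p r
    (v := id) (by rw [Set.range_id, Submodule.span_univ])
  rw [eq_top_iff]
  intro x _
  have hx : x ∈ Submodule.span L (Set.range fun y : K => id y ^ p ^ r) := by
    rw [hspan]; trivial
  obtain ⟨c, rfl⟩ := (Finsupp.mem_span_range_iff_exists_finsupp).1 hx
  refine Submodule.sum_mem _ fun y _ => ?_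
  change c y • y ^ p ^ r ∈ _
  rw [Algebra.smul_def, mul_comm]
  exact pow_mul_mem y (hL (c y))

theorem exists_common_denominator {S : Subring K} {T : Type*} (x : T → K)
    (h : ∀ i, ∃ v ∈ S, v ≠ 0 ∧ x i * v ∈ S) (I : Finset T) :
    ∃ v ∈ S, v ≠ 0 ∧ ∀ i ∈ I, x i * v ∈ S := by
  classical
  induction I using Finset.induction_on with
  | empty => exact ⟨1, S.one_mem, one_ne_zero, by simp⟩
  | insert i I _ ih =>
    obtain ⟨v, hv, hv0, hvI⟩ := ih
    obtain ⟨w, hw, hw0, hwi⟩ := h i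
    refine ⟨v * w, S.mul_mem hv hw, mul_ne_zero hv0 hw0, fun j hj => ?_⟩
    obtain rfl | hj := Finset.mem_insert.1 hj
    · rw [mul_comm v, ← mul_assoc]
      exact S.mul_mem hwi hv
    · rw [← mul_assoc]
      exact S.mul_mem (hvI j hj) hw

/-- Multiplication by the `p ^ r`-th power of a common denominator reduces the relation to one
between polynomials. -/
theorem digit_independent_adjoin [ExpChar F p] {t : ℕ → K}
    (ht : AlgebraicIndependent F fun i : Fin d => t i) {l : ℕ → K}
    (hl : ∀ a, l a ∈ IntermediateField.adjoin F (Set.range fun i : Fin d => t i))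
    (h : ∑ a ∈ Finset.range ((p ^ r) ^ d), digitMonomial (p ^ r) d t a * l a ^ p ^ r = 0) :
    ∀ a < (p ^ r) ^ d, l a = 0 := by
  let L := IntermediateField.adjoin F (Set.range fun i : Fin d => t i)
  let f := MvPolynomial.aeval (R := F) fun i : Fin d => t i
  have hden : ∀ a, ∃ v ∈ f.range.toSubring, v ≠ 0 ∧ l a * v ∈ f.range.toSubring := by
    intro a
    obtain ⟨P, Q, hPQ⟩ := (IntermediateField.mem_adjoin_range_iff F _ (l a)).1 (hl a)
    change l a = f P / f Q at hPQ
    by_cases hQ : f Q = 0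
    · refine ⟨1, Subring.one_mem _, one_ne_zero, ?_⟩
      rw [hPQ, hQ, div_zero, zero_mul]
      exact Subring.zero_mem _
    · refine ⟨f Q, ⟨Q, rfl⟩, hQ, ?_⟩
      rw [hPQ, div_mul_cancel₀ _ hQ]
      exact ⟨P, rfl⟩
  obtain ⟨v, -, hv0, hv⟩ := exists_common_denominator l hden (Finset.range ((p ^ r) ^ d))
  have : ∀ a : Fin d → Fin (p ^ r), ∃ P, f P = l (finFunctionFinEquiv a) * v := fun a =>
    hv _ (Finset.mem_range.2 (Fin.is_lt _))
  choose P hP using this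
  rw [sum_range_finFunctionFinEquiv] at h
  have h0 := eq_zero_of_sum_monomial_mul_pow P (ht (by
    rw [map_zero, map_sum, ← zero_mul (v ^ p ^ r), ← h, Finset.sum_mul]
    refine Finset.sum_congr rfl fun a _ => ?_
    rw [digitMonomial_finFunctionFinEquiv, map_mul, map_prod, map_pow]
    change _ * (f (P a)) ^ _ = _
    rw [hP, mul_pow, mul_assoc]
    congr 1
    refine Finset.prod_congr rfl fun i _ => ?_
    rw [map_pow, MvPolynomial.aeval_X]))
  intro a ha
  have h1 := hP (finFunctionFinEquiv.symm ⟨a, ha⟩)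
  rw [h0, map_zero, Equiv.apply_symm_apply] at h1
  exact (mul_eq_zero.1 h1.symm).resolve_right hv0

/-- By separability the `p ^ r`-th powers of an `L`-basis of `K` remain independent over `L`. A
relation with coefficients from `K` thus splits into relations with coefficients from `L`, one per
basis element. -/
theorem digit_independent [ExpChar F p] [ExpChar K p] {t : ℕ → K}
    (ht : AlgebraicIndependent F fun i : Fin d => t i)
    [Algebra.IsSeparable (IntermediateField.adjoin F (Set.range fun i : Fin d => t i)) K]
    (z : ℕ → K)
    (h : ∑ a ∈ Finset.range ((p ^ r) ^ d), digitMonomial (p ^ r) d t a * z a ^ p ^ r = 0) :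
    ∀ a < (p ^ r) ^ d, z a = 0 := by
  classical
  let L := IntermediateField.adjoin F (Set.range fun i : Fin d => t i)
  have hexp : ExpChar L p := expChar_of_injective_algebraMap (algebraMap F L).injective p
  let e := Module.Basis.ofVectorSpace L K
  have hind := LinearIndependent.map_pow_expChar_pow_of_isSeparable p r e.linearIndependent
  let I := (Finset.range ((p ^ r) ^ d)).biUnion fun a => (e.repr (z a)).support
  have hz : ∀ a ∈ Finset.range ((p ^ r) ^ d), z a = ∑ i ∈ I, (e.repr (z a) i : L) • e i := by
    intro a ha
    conv_lhs => rw [← e.linearCombination_repr (z a), Finsupp.linearCombination_apply]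
    refine Finsupp.sum_of_support_subset _ ?_ _ fun i _ => zero_smul _ _
    exact Finset.subset_biUnion_of_mem (fun a => (e.repr (z a)).support) ha
  have hm : ∀ a, digitMonomial (p ^ r) d t a ∈ L := by
    intro a
    rw [digitMonomial]
    refine prod_mem fun i hi => pow_mem ?_ _
    exact IntermediateField.subset_adjoin _ _ ⟨⟨i, Finset.mem_range.1 hi⟩, rfl⟩
  have h1 : ∑ i ∈ I, (∑ a ∈ Finset.range ((p ^ r) ^ d),
      (⟨_, hm a⟩ : L) * (e.repr (z a) i) ^ p ^ r) • (e i ^ p ^ r) = 0 := by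
    rw [← h]
    simp only [Finset.sum_smul]
    rw [Finset.sum_comm]
    refine Finset.sum_congr rfl fun a ha => ?_
    conv_rhs => rw [hz a ha]
    rw [sum_pow_char_pow, Finset.mul_sum]
    refine Finset.sum_congr rfl fun i _ => ?_
    rw [Algebra.smul_def, Algebra.smul_def, map_mul, map_pow, mul_pow, mul_assoc]
    rfl
  have h2 := linearIndependent_iff'.1 hind I _ h1
  intro a ha
  rw [hz a (Finset.mem_range.2 ha)]
  refine Finset.sum_eq_zero fun i hi => ?_
  have h3 := digit_independent_adjoin (F := F) (r := r) ht
    (l := fun a => (e.repr (z a) i : L)) (fun a => Subtype.property _) (by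
      have := congrArg L.val (h2 i hi)
      rw [map_zero, map_sum] at this
      exact this) a ha
  rw [Subtype.ext h3 (a2 := (0 : L)), zero_smul]

theorem exists_separating_transcendenceBasis [PerfectField F] [Algebra.EssFiniteType F K]
    (h : Algebra.trdeg F K = d) : ∃ t : ℕ → K, AlgebraicIndependent F (fun i : Fin d => t i) ∧
      Algebra.IsSeparable (IntermediateField.adjoin F (Set.range fun i : Fin d => t i)) K := by
  obtain ⟨s, hs, hsep⟩ := exists_isTranscendenceBasis_and_isSeparable_of_perfectField F K
  have hcard := hs.cardinalMk_eq_trdeg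
  rw [h, Cardinal.mk_fintype, Nat.cast_inj] at hcard
  let e : Fin d ≃ s := (Fintype.equivFinOfCardEq hcard).symm
  let t : ℕ → K := fun i => if hi : i < d then e ⟨i, hi⟩ else 0
  have ht : (fun i : Fin d => t i) = Subtype.val ∘ e := by
    funext i
    simp [t]
  refine ⟨t, ?_, ?_⟩
  · rw [ht]
    exact hs.1.comp _ e.injective
  · have hr : Set.range (fun i : Fin d => t i) = s := by
      rw [ht, e.surjective.range_comp, Subtype.range_coe]
    rwa [hr]

end Separating

/-! ## Digit bases of function fields -/

section Constants

/-- If `β` is a basis over `p`-th powers, the products `β l * β i ^ p` form one over `p ^ 2`-th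
powers. Dividing by the first element arranges `b 0 = 1`, as decoding requires of its constants. -/
theorem exists_constant_basis {p n : ℕ} [hp : Fact p.Prime] (k : Type u) [Field k] [CharP k p]
    (h : Module.finrank (frobenius k p).fieldRange k = p ^ n) : ∃ b : ℕ → k, b 0 = 1 ∧
      (∀ c : k, ∃ a : ℕ → k, c = ∑ j ∈ Finset.range (p ^ (2 * n)), b j * a j ^ p ^ 2) ∧
      ∀ a : ℕ → k, ∑ j ∈ Finset.range (p ^ (2 * n)), b j * a j ^ p ^ 2 = 0 →
        ∀ j < p ^ (2 * n), a j = 0 := by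
  have hpos : 0 < p ^ n := pow_pos hp.out.pos n
  have hq : p ^ 2 ≠ 0 := (pow_pos hp.out.pos 2).ne'
  rw [← iterateFrobenius_one] at h
  have : Module.Finite (iterateFrobenius k p 1).fieldRange k :=
    Module.finite_of_finrank_pos (h.symm ▸ hpos)
  let β₀ := Module.finBasisOfFinrankEq _ k h
  let β : ℕ → k := fun i => if hi : i < p ^ n then β₀ ⟨i, hi⟩ else 0
  have hβ : (fun i : Fin (p ^ n) => β i) = β₀ := by
    funext i
    simp [β]
  have hind := (linearIndependent_pow_iff p 1 β).1 (hβ ▸ β₀.linearIndependent)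
  have hspan := (span_pow_eq_top_iff p 1 (m := p ^ n) β).1 (hβ ▸ β₀.span_eq.ge)
  simp only [pow_one] at hind hspan
  -- products of the basis elements with the `p`-th powers of the basis elements
  let b' : ℕ → k := fun i => β (i % p ^ n) * β (i / p ^ n) ^ p
  have hsum : ∀ a : ℕ → k, ∑ j ∈ Finset.range (p ^ (2 * n)), b' j * a j ^ p ^ 2 =
      ∑ l ∈ Finset.range (p ^ n),
        β l * (∑ i ∈ Finset.range (p ^ n), β i * a (i * p ^ n + l) ^ p) ^ p := by
    intro a
    have hs : ∀ f : ℕ → k, ∀ Q, ∑ j ∈ Finset.range (Q * p ^ n), f j =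
        ∑ i ∈ Finset.range Q, ∑ l ∈ Finset.range (p ^ n), f (i * p ^ n + l) := by
      intro f Q
      induction Q with
      | zero => simp
      | succ Q ih => rw [Finset.sum_range_succ, ← ih, Nat.succ_mul, Finset.sum_range_add]
    rw [two_mul, pow_add, hs, Finset.sum_comm]
    refine Finset.sum_congr rfl fun l hl => ?_
    have hl := Finset.mem_range.1 hl
    rw [sum_pow_char, Finset.mul_sum]
    refine Finset.sum_congr rfl fun i _ => ?_
    simp only [b']
    rw [Nat.mul_add_mod_of_lt hl, Nat.mul_comm i, Nat.mul_add_div hpos, Nat.div_eq_of_lt hl,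
      Nat.add_zero]
    ring
  have hind' : ∀ a : ℕ → k, ∑ j ∈ Finset.range (p ^ (2 * n)), b' j * a j ^ p ^ 2 = 0 →
      ∀ j < p ^ (2 * n), a j = 0 := by
    intro a ha j hj
    rw [hsum] at ha
    have h1 := hind _ (hind _ ha (j % p ^ n) (Nat.mod_lt _ hpos)) (j / p ^ n)
      (Nat.div_lt_of_lt_mul (by rwa [← pow_add, ← two_mul]))
    rwa [Nat.div_add_mod'] at h1
  have hb0 : b' 0 ≠ 0 := by
    intro h0
    have := hind' (fun j => if j = 0 then 1 else 0) (Finset.sum_eq_zero fun j _ => by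
      by_cases hj : j = 0
      · rw [hj, h0, zero_mul]
      · rw [if_neg hj, zero_pow hq, mul_zero]) 0 (pow_pos hp.out.pos _)
    simp at this
  have hdiv : ∀ a : ℕ → k, ∑ j ∈ Finset.range (p ^ (2 * n)), b' j / b' 0 * a j ^ p ^ 2 =
      (∑ j ∈ Finset.range (p ^ (2 * n)), b' j * a j ^ p ^ 2) / b' 0 := by
    intro a
    rw [Finset.sum_div]
    exact Finset.sum_congr rfl fun j _ => by ring
  refine ⟨fun j => b' j / b' 0, div_self hb0, fun c => ?_, fun a ha => hind' a ?_⟩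
  · obtain ⟨x, hx⟩ := hspan (c * b' 0)
    choose y hy using fun j => hspan (x j)
    refine ⟨fun j => y (j % p ^ n) (j / p ^ n), ?_⟩
    rw [hdiv, eq_div_iff hb0, hx, hsum]
    refine Finset.sum_congr rfl fun l hl => ?_
    have hl := Finset.mem_range.1 hl
    conv_lhs => rw [hy l]
    congr 2
    refine Finset.sum_congr rfl fun i _ => ?_
    rw [Nat.mul_add_mod_of_lt hl, Nat.mul_comm i, Nat.mul_add_div hpos, Nat.div_eq_of_lt hl,
      Nat.add_zero]
  · rw [hdiv, div_eq_zero_iff] at ha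
    exact ha.resolve_right hb0

end Constants

section FunctionField

variable {F K₀ k K : Type u} [Field F] [Field K₀] [Field k] [Field K] [Algebra F K₀] [Algebra F k]
  [Algebra k K] (κ : K₀ →+* K)

/-- The field `K` is the field of fractions of the compositum of linearly disjoint `k` and `K₀`
over `F`. -/
structure IsGenericCompositum (F : Type u) {K₀ k K : Type u} [Field F] [Field K₀] [Field k]
    [Field K] [Algebra F K₀] [Algebra F k] [Algebra k K] (κ : K₀ →+* K) : Prop where
  map_algebraMap (f : F) : κ (algebraMap F K₀ f) = algebraMap k K (algebraMap F k f)
  independent {T : Type u} (e : T → K₀) (he : LinearIndependent F e) (I : Finset T) (a : T → k)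
    (h : ∑ i ∈ I, algebraMap k K (a i) * κ (e i) = 0) : ∀ i ∈ I, a i = 0
  exists_fraction (x : K) : ∃ v ∈ Algebra.adjoin k (Set.range κ), v ≠ 0 ∧
    x * v ∈ Algebra.adjoin k (Set.range κ)

variable {κ}

theorem adjoin_range_eq_span : Subalgebra.toSubmodule (Algebra.adjoin k (Set.range κ)) =
    Submodule.span k (Set.range κ) := by
  rw [Algebra.adjoin_eq_span]
  congr 1
  have : Set.range κ = (MonoidHom.mrange (κ : K₀ →* K) : Set K) := rfl
  rw [this, Submonoid.closure_eq]

theorem IsGenericCompositum.exists_expansion (h : IsGenericCompositum F (k := k) κ)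
    {T : Type u} (e : Module.Basis T F K₀) {x : K}
    (hx : x ∈ Algebra.adjoin k (Set.range κ)) :
    ∃ c : T →₀ k, x = ∑ i ∈ c.support, algebraMap k K (c i) * κ (e i) := by
  have hspan : Submodule.span k (Set.range κ) ≤
      Submodule.span k (Set.range fun i => κ (e i)) := by
    rw [Submodule.span_le]
    rintro _ ⟨y, rfl⟩
    conv in κ y => rw [← e.linearCombination_repr y, Finsupp.linearCombination_apply, Finsupp.sum,
      map_sum]
    refine Submodule.sum_mem _ fun i _ => ?_
    rw [Algebra.smul_def, map_mul, h.map_algebraMap, ← Algebra.smul_def]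
    exact Submodule.smul_mem _ _ (Submodule.subset_span ⟨i, rfl⟩)
  rw [← Subalgebra.mem_toSubmodule, adjoin_range_eq_span] at hx
  obtain ⟨c, hc⟩ := Finsupp.mem_span_range_iff_exists_finsupp.1 (hspan hx)
  refine ⟨c, ?_⟩
  rw [← hc, Finsupp.sum]
  exact Finset.sum_congr rfl fun i _ => Algebra.smul_def _ _

variable {p r N d : ℕ} [ExpChar K₀ p] [ExpChar K p] {t : ℕ → K₀} {b : ℕ → k}

theorem map_digitMonomial {R S : Type*} [CommRing R] [CommRing S] (f : R →+* S) (q d : ℕ)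
    (t : ℕ → R) (a : ℕ) : f (digitMonomial q d t a) = digitMonomial q d (f ∘ t) a := by
  simp [digitMonomial]

/-- Expanding scalars from `k` by `b` and elements of `K₀` by digit monomials shows that the ring
generated by both lies in the span; `div_mem_of_mul_pow_mem` passes to its fractions. -/
theorem IsGenericCompositum.exists_digitExpansion (h : IsGenericCompositum F (k := k) κ)
    (hp : 0 < p) (hN : 0 < N) (ht : digitSpan p r d t = ⊤)
    (hb : ∀ c : k, ∃ a : ℕ → k, c = ∑ j ∈ Finset.range N, b j * a j ^ p ^ r) (x : K) :
    ∃ z : ℕ → K, x = digitExpansion (p ^ r) N d (κ ∘ t) (fun j => algebraMap k K (b j)) z := by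
  simp only [digitExpansion_eq_sum]
  revert x
  rw [← span_pow_eq_top_iff p r fun i =>
    digitMonomial (p ^ r) d (κ ∘ t) (i / N) * algebraMap k K (b (i % N))]
  set V := Submodule.span (iterateFrobenius K p r).fieldRange
    (Set.range fun i : Fin ((p ^ r) ^ d * N) =>
      digitMonomial (p ^ r) d (κ ∘ t) (i / N) * algebraMap k K (b (i % N)))
  have hS : ∀ x ∈ Algebra.adjoin k (Set.range κ), x ∈ V := by
    intro x hx
    rw [← Subalgebra.mem_toSubmodule, adjoin_range_eq_span] at hx
    obtain ⟨c, rfl⟩ := Finsupp.mem_span_range_iff_exists_finsupp.1 hx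
    refine Submodule.sum_mem _ fun y _ => ?_
    change c y • κ y ∈ V
    obtain ⟨a, ha⟩ := hb (c y)
    obtain ⟨z, hz⟩ := (span_pow_eq_top_iff p r _).1 ht.ge y
    rw [Algebra.smul_def, ha]
    conv in κ y => rw [hz]
    simp only [map_sum, map_mul, map_pow, Finset.sum_mul, Finset.mul_sum]
    refine Submodule.sum_mem _ fun i hi => Submodule.sum_mem _ fun j hj => ?_
    have hi := Finset.mem_range.1 hi
    have hj := Finset.mem_range.1 hj
    have : i * N + j < (p ^ r) ^ d * N := by nlinarith
    have hmem : digitMonomial (p ^ r) d (κ ∘ t) ((i * N + j) / N) *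
        algebraMap k K (b ((i * N + j) % N)) ∈ V := Submodule.subset_span ⟨⟨i * N + j, this⟩, rfl⟩
    convert pow_mul_mem (κ (z i) * algebraMap k K (a j)) hmem using 1
    rw [Nat.mul_add_mod_of_lt hj, Nat.mul_comm i, Nat.mul_add_div hN, Nat.div_eq_of_lt hj,
      Nat.add_zero, map_digitMonomial]
    ring
  intro x _
  obtain ⟨v, hv, hv0, hxv⟩ := h.exists_fraction x
  rw [← mul_div_cancel_right₀ x hv0]
  exact div_mem_of_mul_pow_mem hp (hS _ (mul_mem hxv (pow_mem hv _)))

/-- After clearing denominators, each coordinate is a combination over `k` of an `F`-basis `e` of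
`K₀`. The relation becomes one over `k` between the elements `ε = (digit monomial) * e ^ q`, with `q
= p ^ r`. These are independent over `F`, hence over `k` by linear disjointness; the resulting
coefficients `∑ b j * c ^ q` vanish, and independence of `b` finishes. -/
theorem IsGenericCompositum.digitExpansion_independent [ExpChar F p] [PerfectField F]
    (h : IsGenericCompositum F (k := k) κ) (hN : 0 < N)
    (ht : ∀ z : ℕ → K₀,
      ∑ a ∈ Finset.range ((p ^ r) ^ d), digitMonomial (p ^ r) d t a * z a ^ p ^ r = 0 →
        ∀ a < (p ^ r) ^ d, z a = 0)
    (hb : ∀ a : ℕ → k, ∑ j ∈ Finset.range N, b j * a j ^ p ^ r = 0 → ∀ j < N, a j = 0)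
    (z : ℕ → K)
    (hz : digitExpansion (p ^ r) N d (κ ∘ t) (fun j => algebraMap k K (b j)) z = 0) :
    ∀ i < (p ^ r) ^ d * N, z i = 0 := by
  classical
  let e := Module.Basis.ofVectorSpace F K₀
  let T := Module.Basis.ofVectorSpaceIndex F K₀
  obtain ⟨v, -, hv0, hv⟩ := exists_common_denominator
    (S := (Algebra.adjoin k (Set.range κ)).toSubring) z (fun i => h.exists_fraction (z i))
    (Finset.range ((p ^ r) ^ d * N))
  have : ∀ i, ∃ c : T →₀ k, i < (p ^ r) ^ d * N →
      z i * v = ∑ x ∈ c.support, algebraMap k K (c x) * κ (e x) := by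
    intro i
    by_cases hi : i < (p ^ r) ^ d * N
    · obtain ⟨c, hc⟩ := h.exists_expansion e (hv i (Finset.mem_range.2 hi))
      exact ⟨c, fun _ => hc⟩
    · exact ⟨0, fun h => absurd h hi⟩
  choose c hc using this
  let I := (Finset.range ((p ^ r) ^ d * N)).biUnion fun i => (c i).support
  have hc : ∀ i < (p ^ r) ^ d * N, z i * v = ∑ x ∈ I, algebraMap k K (c i x) * κ (e x) := by
    intro i hi
    rw [hc i hi]
    refine Finset.sum_subset (Finset.subset_biUnion_of_mem (fun i => (c i).support)
      (Finset.mem_range.2 hi)) fun x _ hx => ?_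
    rw [Finsupp.notMem_support_iff.1 hx, map_zero, zero_mul]
  let ε : Fin ((p ^ r) ^ d) × T → K₀ := fun ax => digitMonomial (p ^ r) d t ax.1 * e ax.2 ^ p ^ r
  -- Scalars of the perfect field `F` have `q`-th roots, so a relation collects into digit monomials
  -- times `q`-th powers of combinations of `e`.
  have hε : LinearIndependent F ε := by
    rw [linearIndependent_iff']
    intro J g hg
    let g' : ℕ → T → F := fun a x => if ha : a < (p ^ r) ^ d then
      if (⟨a, ha⟩, x) ∈ J then (iterateFrobeniusEquiv F p r).symm (g (⟨a, ha⟩, x)) else 0 else 0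
    have h1 := ht (fun a => ∑ x ∈ J.image Prod.snd, algebraMap F K₀ (g' a x) * e x) (by
      rw [← hg, ← Fin.sum_univ_eq_sum_range fun a => digitMonomial (p ^ r) d t a *
        (∑ x ∈ J.image Prod.snd, algebraMap F K₀ (g' a x) * e x) ^ p ^ r]
      simp only [sum_pow_char_pow, Finset.mul_sum]
      rw [← Finset.sum_product', ← Finset.sum_subset (s₁ := J)]
      · refine Finset.sum_congr rfl fun ax hax => ?_
        obtain ⟨a, x⟩ := ax
        simp only [g', ε]
        rw [dif_pos a.2, if_pos hax, Algebra.smul_def, mul_pow, ← map_pow,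
          ← iterateFrobeniusEquiv_def, RingEquiv.apply_symm_apply]
        ring
      · exact fun ax hax => Finset.mem_product.2
          ⟨Finset.mem_univ _, Finset.mem_image_of_mem _ hax⟩
      · rintro ⟨a, x⟩ _ hax
        simp only [g']
        have : p ^ r ≠ 0 := (pow_pos (expChar_pos F p) r).ne'
        rw [dif_pos a.2, if_neg hax, map_zero, zero_mul, zero_pow this, mul_zero])
    rintro ⟨a, x⟩ hax
    have h2 := h1 a a.2
    simp only [← Algebra.smul_def] at h2
    have h3 := linearIndependent_iff'.1 e.linearIndependent _ _ h2 x
      (Finset.mem_image_of_mem Prod.snd hax)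
    simpa only [g', dif_pos a.2, Fin.eta, if_pos hax, map_eq_zero_iff _ (RingEquiv.injective _)]
      using h3
  have hq : p ^ r ≠ 0 := (pow_pos (expChar_pos F p) r).ne'
  have hk : ExpChar k p := expChar_of_injective_algebraMap (algebraMap F k).injective p
  -- The index type is lifted to the universe in which linear disjointness is stated.
  have h1 := h.independent (fun ax : ULift.{u} (Fin ((p ^ r) ^ d)) × T => ε (ax.1.down, ax.2))
    (hε.comp (fun ax : ULift.{u} (Fin ((p ^ r) ^ d)) × T => (ax.1.down, ax.2)) (by
      rintro ⟨⟨a⟩, x⟩ ⟨⟨a'⟩, x'⟩ h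
      simpa using h)) (Finset.univ ×ˢ I)
    (fun ax => ∑ j ∈ Finset.range N, b j * (c (ax.1.down * N + j) ax.2) ^ p ^ r) (by
      rw [Finset.sum_product]
      rw [← Equiv.ulift.symm.sum_comp]
      rw [← zero_mul (v ^ p ^ r), ← hz, digitExpansion_eq _ _ _ hN, Finset.sum_mul,
        ← Fin.sum_univ_eq_sum_range fun a => digitMonomial (p ^ r) d (κ ∘ t) a *
          (∑ j ∈ Finset.range N, algebraMap k K (b j) * z (a * N + j) ^ p ^ r) * v ^ p ^ r]
      refine Finset.sum_congr rfl fun a _ => ?_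
      have ha := a.2
      rw [mul_assoc, Finset.sum_mul, ← map_digitMonomial]
      simp only [ε, map_sum, Finset.sum_mul, Finset.mul_sum, Equiv.ulift_symm_down]
      rw [Finset.sum_comm]
      refine Finset.sum_congr rfl fun j hj => ?_
      have hj := Finset.mem_range.1 hj
      rw [mul_assoc, ← mul_pow, hc _ (by nlinarith), sum_pow_char_pow, Finset.mul_sum,
        Finset.mul_sum]
      refine Finset.sum_congr rfl fun x _ => ?_
      simp only [map_mul, map_pow]
      ring)
  intro i hi
  refine (mul_eq_zero.1 ((hc i hi).trans (Finset.sum_eq_zero fun x hx => ?_))).resolve_right hv0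
  have h2 := hb _ (h1 (⟨⟨i / N, Nat.div_lt_of_lt_mul (by rwa [Nat.mul_comm])⟩⟩, x)
    (Finset.mem_product.2 ⟨Finset.mem_univ _, hx⟩)) (i % N) (Nat.mod_lt _ hN)
  simp only [Nat.div_add_mod'] at h2
  rw [h2, map_zero, zero_mul]

/-- Supplies the elements independent over `k` that codes carry: powers of a transcendental element
are independent over `F`, hence over `k`. -/
theorem IsGenericCompositum.independent_pow (h : IsGenericCompositum F (k := k) κ)
    {x : K₀} (hx : Transcendental F x) (a : ℕ → k)
    (ha : ∑ j ∈ Finset.range N, algebraMap k K (a j) * κ x ^ j = 0) : ∀ j < N, a j = 0 := by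
  have hli : LinearIndependent F fun j : ℕ => x ^ j := by
    have := (Polynomial.basisMonomials F).linearIndependent.map'
      (Polynomial.aeval x).toLinearMap
      (LinearMap.ker_eq_bot.2 (transcendental_iff_injective.1 hx))
    have hf : (fun j : ℕ => x ^ j) =
        (Polynomial.aeval x).toLinearMap ∘ Polynomial.basisMonomials F := by
      funext j
      simp
    rwa [hf]
  intro j hj
  refine h.independent (fun j : ULift.{u} ℕ => x ^ j.down) (hli.comp _ ULift.down_injective)
    ((Finset.range N).map Equiv.ulift.symm.toEmbedding) (fun j => a j.down) ?_ ⟨j⟩ ?_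
  · rw [← ha]
    simp
  · simpa using hj

theorem IsGenericCompositum.exists_isDigitBasis [PerfectField F] [Algebra.EssFiniteType F K₀]
    {p n : ℕ} [hp : Fact p.Prime] [CharP F p] [CharP k p]
    (h : IsGenericCompositum F (k := k) κ) (hd : 1 ≤ d) (htr : Algebra.trdeg F K₀ = d)
    (hk : Module.finrank (frobenius k p).fieldRange k = p ^ n) :
    ∃ (t : ℕ → K) (b : ℕ → k) (s : ℕ → K),
      IsDigitBasis (algebraMap k K) (p ^ 2) (p ^ (2 * n)) d t b ∧
      ∀ a : ℕ → k, ∑ j ∈ Finset.range (p ^ (2 * n)), algebraMap k K (a j) * s j = 0 →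
        ∀ j < p ^ (2 * n), a j = 0 := by
  have hp0 := hp.out.pos
  have hN : 0 < p ^ (2 * n) := pow_pos hp0 _
  have : CharP K₀ p := charP_of_injective_algebraMap (algebraMap F K₀).injective p
  have : CharP K p := charP_of_injective_algebraMap (algebraMap k K).injective p
  obtain ⟨t, ht, hsep⟩ := exists_separating_transcendenceBasis (F := F) (K := K₀) htr
  obtain ⟨b, hb, hb1, hb2⟩ := exists_constant_basis k hk
  -- The powers of `t 0` are available because `d ≥ 1`.
  refine ⟨κ ∘ t, b, fun j => κ (t 0) ^ j, ⟨hb, hb1, ?_, ?_⟩, ?_⟩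
  · exact h.exists_digitExpansion hp0 hN (digitSpan_eq_top (F := F) hp0 t) hb1
  · exact h.digitExpansion_independent hN (digit_independent (F := F) ht) hb2
  · exact h.independent_pow (ht.transcendental ⟨0, hd⟩)

end FunctionField

/-! ## Dimension and transcendence degree -/

section Dimension

/-- Incomparability keeps chains strict under contraction; lying over and going up lift chains. -/
theorem ringKrullDim_eq_of_isIntegral {R S : Type*} [CommRing R] [CommRing S] [IsDomain R]
    [IsDomain S] [Algebra R S] [Algebra.IsIntegral R S]
    (h : Function.Injective (algebraMap R S)) : ringKrullDim S = ringKrullDim R := by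
  refine le_antisymm ?_ ?_
  · refine Order.krullDim_le_of_strictMono (PrimeSpectrum.comap (algebraMap R S)) fun P Q hPQ => ?_
    exact Ideal.IsIntegral.comap_lt_comap hPQ
  · have hlies : ∀ p : PrimeSpectrum R, ∃ P : Ideal S, P.IsPrime ∧ P.LiesOver p.asIdeal := by
      intro p
      obtain ⟨Q, _, hQ, hQp⟩ := Ideal.exists_ideal_over_prime_of_isIntegral p.asIdeal (⊥ : Ideal S)
        (by rw [Ideal.comap_bot_of_injective _ h]; exact bot_le)
      exact ⟨Q, hQ, ⟨hQp.symm⟩⟩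
    refine iSup_le fun l => ?_
    obtain ⟨P, hP, hPl⟩ := hlies l.head
    obtain ⟨L, hL, -⟩ := Ideal.exists_ltSeries_of_hasGoingUp l P
    rw [← hL]
    exact le_iSup (fun L : LTSeries (PrimeSpectrum S) => (L.length : WithBot ℕ∞)) L

/-- Noether normalization: both invariants equal the number of variables of a polynomial ring over
which `A` is integral. -/
theorem exists_ringKrullDim_eq_trdeg (F A K : Type u) [Field F] [CommRing A] [IsDomain A]
    [Algebra F A] [Algebra.FiniteType F A] [Field K] [Algebra A K] [IsFractionRing A K]
    [Algebra F K] [IsScalarTower F A K] :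
    ∃ s : ℕ, ringKrullDim A = s ∧ Algebra.trdeg F K = s := by
  obtain ⟨s, g, hg, hint⟩ := exists_integral_inj_algHom_of_fg F A
  algebraize [g.toRingHom]
  have : IsScalarTower F (MvPolynomial (Fin s) F) A := .of_algebraMap_eq' g.comp_algebraMap.symm
  have : FaithfulSMul (MvPolynomial (Fin s) F) A := (faithfulSMul_iff_algebraMap_injective _ _).2 hg
  refine ⟨s, ?_, ?_⟩
  · rw [ringKrullDim_eq_of_isIntegral (R := MvPolynomial (Fin s) F) hg,
      MvPolynomial.ringKrullDim_of_isNoetherianRing, ringKrullDim_eq_zero_of_field]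
    simp
  · have h1 := trdeg_add_eq F (MvPolynomial (Fin s) F) (A := A)
    have h2 := trdeg_add_eq F A (A := K)
    have : Algebra.IsAlgebraic A K := IsLocalization.isAlgebraic K (nonZeroDivisors A)
    rw [← h2, ← h1, MvPolynomial.trdeg_of_isDomain, trdeg_eq_zero,
      trdeg_eq_zero]
    simp

end Dimension

/-! ### Base change of a domain and linear disjointness -/

section Compositum

variable {F A k B K₀ K : Type u} [Field F] [CommRing A] [Field k] [CommRing B]
  [Field K₀] [Field K] [Algebra F A] [Algebra F k] [Algebra F B] [Algebra k B] [Algebra A B]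
  [IsScalarTower F A B] [IsScalarTower F k B] [Algebra F K₀] [Algebra A K₀]
  [IsScalarTower F A K₀] [IsFractionRing A K₀]

theorem linearIndependent_algebraMap_of_isPushout [Algebra.IsPushout F k A B] {T : Type*}
    {e : T → A} (he : LinearIndependent F e) :
    LinearIndependent k fun i => algebraMap A B (e i) := by
  have h := (Module.Flat.linearIndependent_one_tmul (S := k) he).map'
    (Algebra.IsPushout.out (R := F) (S := k) (R' := A) (S' := B)).equiv.toLinearMap
    (LinearEquiv.ker _)
  have hf : (fun i => algebraMap A B (e i)) =
      (Algebra.IsPushout.out (R := F) (S := k) (R' := A) (S' := B)).equiv.toLinearMap ∘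
        fun i => 1 ⊗ₜ[F] e i := by
    funext i
    simp [IsBaseChange.equiv_tmul]
  rwa [hf]

/-- A common denominator moves finitely many independent elements of `K₀` into `A`, and tensoring
with `k` preserves their independence. Since `B` is generated by `k` and `A`, the fractions of `B`
are fractions of the compositum. -/
theorem isGenericCompositum_of_isPushout [IsDomain A] [Algebra.IsPushout F k A B] [Algebra k K]
    (φ : B →+* K) (hφ : Function.Injective φ)
    (hk : ∀ c, algebraMap k K c = φ (algebraMap k B c))
    (hfrac : ∀ x : K, ∃ u v : B, φ v ≠ 0 ∧ x * φ v = φ u) :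
    ∃ κ : K₀ →+* K, IsGenericCompositum F (k := k) κ := by
  have hinj : Function.Injective (φ.comp (algebraMap A B)) := by
    refine hφ.comp ((injective_iff_map_eq_zero _).2 fun a ha => ?_)
    by_contra hne
    -- Injectivity of `A → B` is the case of a single independent element.
    have he : LinearIndependent F fun _ : Unit => a := LinearIndependent.of_subsingleton () hne
    exact (linearIndependent_algebraMap_of_isPushout (k := k) (B := B) he).ne_zero () ha
  have hκ : ∀ a : A, IsFractionRing.lift (K := K₀) hinj (algebraMap A K₀ a) =
      φ (algebraMap A B a) := fun a => IsFractionRing.lift_algebraMap hinj a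
  refine ⟨IsFractionRing.lift hinj, ?_, ?_, ?_⟩
  · intro f
    rw [IsScalarTower.algebraMap_apply F A K₀, hκ, ← IsScalarTower.algebraMap_apply, hk,
      ← IsScalarTower.algebraMap_apply]
  · intro T e he I a h
    obtain ⟨s, hs⟩ := IsLocalization.exist_integer_multiples (nonZeroDivisors A) I e
    have hs0 : algebraMap A K₀ s ≠ 0 := by
      simp [nonZeroDivisors.ne_zero s.2]
    choose! m hm using hs
    have hm : ∀ i ∈ I, algebraMap A K₀ (m i) = algebraMap A K₀ s * e i := fun i hi => by
      rw [hm i hi, Algebra.smul_def]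
    have hind : LinearIndependent F fun i : I => m i := by
      refine LinearIndependent.of_comp (IsScalarTower.toAlgHom F A K₀).toLinearMap ?_
      have h1 := (he.comp (Subtype.val : I → T) Subtype.val_injective).map'
        (LinearMap.mulLeft F (algebraMap A K₀ s))
        (LinearMap.ker_eq_bot.2 fun x y hxy => mul_left_cancel₀ hs0 hxy)
      have hf : (IsScalarTower.toAlgHom F A K₀).toLinearMap ∘ (fun i : I => m i) =
          LinearMap.mulLeft F (algebraMap A K₀ s) ∘ e ∘ Subtype.val := funext fun i => hm i i.2
      rwa [hf]
    have h2 := Fintype.linearIndependent_iff.1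
      (linearIndependent_algebraMap_of_isPushout (k := k) (B := B) hind) (fun i => a i) (hφ (by
        rw [map_zero, map_sum, ← mul_zero (IsFractionRing.lift (K := K₀) hinj (algebraMap A K₀ s)),
          ← h, Finset.mul_sum, ← Finset.sum_coe_sort I]
        refine Finset.sum_congr rfl fun i _ => ?_
        rw [Algebra.smul_def, map_mul, ← hk, ← hκ, hm i i.2, map_mul]
        ring))
    exact fun i hi => h2 ⟨i, hi⟩
  · intro x
    obtain ⟨u, v, hv, hx⟩ := hfrac x
    have hmem : ∀ b : B, φ b ∈ Algebra.adjoin k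
        (Set.range (IsFractionRing.lift hinj : K₀ →+* K)) := by
      intro b
      obtain ⟨y, rfl⟩ :=
        (Algebra.IsPushout.out (R := F) (S := k) (R' := A) (S' := B)).equiv.surjective b
      induction y using TensorProduct.induction_on with
      | zero => simp
      | tmul c a =>
        rw [IsBaseChange.equiv_tmul, Algebra.smul_def, map_mul, ← hk]
        refine mul_mem (Subalgebra.algebraMap_mem _ c)
          (Algebra.subset_adjoin ⟨algebraMap A K₀ a, ?_⟩)
        rw [hκ]
        rfl
      | add y z hy hz =>
        rw [map_add, map_add]
        exact add_mem hy hz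
    exact ⟨φ v, hmem v, hv, hx ▸ hmem u⟩

end Compositum

/-! ### Dimension and sections over affine open subschemes -/

section Geometry

open AlgebraicGeometry CategoryTheory Limits TopologicalSpace

/-- Every irreducible closed set containing `Z` meets an open `U` that meets `Z`, so `Z` and its
trace on `U` have the same coheight. -/
theorem topologicalKrullDim_le_of_forall_exists_isOpen {X : Type u} [TopologicalSpace X]
    {D : WithBot ℕ∞} (h : ∀ x : X, ∃ U : Opens X, x ∈ U ∧ topologicalKrullDim U ≤ D) :
    topologicalKrullDim X ≤ D := by
  rw [topologicalKrullDim, Order.krullDim_eq_iSup_coheight]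
  refine iSup_le fun Z => ?_
  obtain ⟨x, hxZ⟩ := Z.isIrreducible.nonempty
  obtain ⟨U, hx, hD⟩ := h x
  have hU := U.isOpen.isOpenEmbedding_subtypeVal
  obtain ⟨Z', hZ'⟩ := (IrreducibleCloseds.orderIsoOfIsOpenEmbedding Subtype.val hU).surjective
    ⟨Z, ⟨x, hx⟩, hxZ⟩
  have hZ : Z = IrreducibleCloseds.map Subtype.val hU.continuous Z' :=
    congrArg Subtype.val hZ'.symm
  rw [hZ, hU.coheight_map]
  exact (Order.coheight_le_krullDim Z').trans hD

theorem AlgebraicGeometry.IsAffineOpen.topologicalKrullDim_eq {X : Scheme.{u}} {U : X.Opens}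
    (hU : IsAffineOpen U) : topologicalKrullDim U = ringKrullDim Γ(X, U) := by
  rw [← PrimeSpectrum.topologicalKrullDim_eq_ringKrullDim]
  exact IsHomeomorph.topologicalKrullDim_eq _ hU.isoSpec.hom.homeomorph.isHomeomorph

namespace PrimeVariety

variable {p : ℕ} {X : Scheme.{u}} (s : X ⟶ Spec (primeField.{u} p))

/-- The structure of an algebra over the prime field on the sections of a scheme over it. -/
@[reducible]
noncomputable def algebraSections (U : X.Opens) : Algebra (ULift.{u} (ZMod p)) Γ(X, U) :=
  ((Scheme.ΓSpecIso (primeField.{u} p)).inv ≫ s.appLE ⊤ U le_top).hom.toAlgebra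

/-- The structure of an algebra over the prime field on the function field of a scheme
over it. -/
@[reducible]
noncomputable def algebraFunctionField [IrreducibleSpace X] :
    Algebra (ULift.{u} (ZMod p)) X.functionField :=
  ((Scheme.ΓSpecIso (primeField.{u} p)).inv ≫ s.appTop ≫
    X.presheaf.germ ⊤ (genericPoint X) trivial).hom.toAlgebra

theorem isScalarTower_functionField [IrreducibleSpace X] (U : X.Opens) [Nonempty U] :
    letI := algebraSections s U
    letI := algebraFunctionField s
    IsScalarTower (ULift.{u} (ZMod p)) Γ(X, U) X.functionField := by
  let := algebraSections s U
  let := algebraFunctionField s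
  refine .of_algebraMap_eq' ?_
  change CommRingCat.Hom.hom _ = (CommRingCat.Hom.hom (X.germToFunctionField U)).comp
    (CommRingCat.Hom.hom _)
  rw [← CommRingCat.hom_comp]
  congr 1
  have h : s.appLE ⊤ U le_top ≫ X.germToFunctionField U =
      s.appTop ≫ X.presheaf.germ ⊤ (genericPoint X) trivial := by
    simp only [Scheme.Hom.appLE, Category.assoc]
    exact congrArg _ (X.presheaf.germ_res (homOfLE le_top) _ _)
  rw [Category.assoc, h]

theorem finiteType_sections [LocallyOfFiniteType s] {U : X.Opens} (hU : IsAffineOpen U) :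
    letI := algebraSections s U
    Algebra.FiniteType (ULift.{u} (ZMod p)) Γ(X, U) := by
  let := algebraSections s U
  rw [← RingHom.finiteType_algebraMap]
  change (CommRingCat.Hom.hom _).FiniteType
  rw [CommRingCat.hom_comp]
  exact (s.finiteType_appLE (isAffineOpen_top _) hU _).comp (.of_surjective _
    (Scheme.ΓSpecIso (primeField.{u} p)).symm.commRingCatIsoToRingEquiv.surjective)

theorem exists_ringKrullDim_sections_eq_trdeg [Fact p.Prime] [IsIntegral X]
    [LocallyOfFiniteType s] {U : X.Opens} [Nonempty U] (hU : IsAffineOpen U) :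
    letI := algebraFunctionField s
    ∃ m : ℕ, ringKrullDim Γ(X, U) = m ∧
      Algebra.trdeg (ULift.{u} (ZMod p)) X.functionField = m := by
  let := algebraSections s U
  let := algebraFunctionField s
  have := isScalarTower_functionField s U
  have := finiteType_sections s hU
  have := functionField_isFractionRing_of_isAffineOpen X U hU
  exact exists_ringKrullDim_eq_trdeg (ULift.{u} (ZMod p)) Γ(X, U) X.functionField

/-- All nonempty affine opens have the transcendence degree as their dimension, since they share the
function field. Covering `X` by them bounds its dimension from above, and any one of them from
below. -/
theorem trdeg_functionField [Fact p.Prime] [IsIntegral X] [LocallyOfFiniteType s] {d : ℕ}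
    (hd : topologicalKrullDim X = d) :
    letI := algebraFunctionField s
    Algebra.trdeg (ULift.{u} (ZMod p)) X.functionField = d := by
  let := algebraFunctionField s
  have haff : ∀ x : X, ∃ U : X.Opens, x ∈ U ∧ IsAffineOpen U := fun x => by
    obtain ⟨U, hU, hx, -⟩ := exists_isAffineOpen_mem_and_subset (x := x) (U := ⊤) trivial
    exact ⟨U, hx, hU⟩
  obtain ⟨U, hx, hU⟩ := haff (genericPoint X)
  have : Nonempty U := ⟨⟨_, hx⟩⟩
  obtain ⟨m, hm, htr⟩ := exists_ringKrullDim_sections_eq_trdeg s hU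
  rw [htr, Nat.cast_inj]
  have h1 : topologicalKrullDim X ≤ m := by
    refine topologicalKrullDim_le_of_forall_exists_isOpen fun x => ?_
    obtain ⟨W, hxW, hW⟩ := haff x
    have : Nonempty W := ⟨⟨_, hxW⟩⟩
    obtain ⟨m', hm', htr'⟩ := exists_ringKrullDim_sections_eq_trdeg s hW
    rw [htr, Nat.cast_inj] at htr'
    exact ⟨W, hxW, (hW.topologicalKrullDim_eq.trans (hm'.trans (by rw [htr']))).le⟩
  have h2 : (m : WithBot ℕ∞) ≤ topologicalKrullDim X := by
    rw [← hm, ← hU.topologicalKrullDim_eq]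
    exact topologicalKrullDim_subspace_le X (U : Set X)
  have := h2.antisymm h1
  rw [hd] at this
  exact_mod_cast this

/-- Identifies the sections over the preimage of an affine open `U` with the tensor product of `k`
and the sections over `U`. -/
theorem isPushout_sections (k : Type u) [Field k] [CharP k p] (U : X.Opens)
    (hU : IsAffineOpen U) :
    IsPushout ((Scheme.ΓSpecIso (primeField.{u} p)).inv ≫ s.appLE ⊤ U le_top) (primeFieldMap p k)
      ((pullback.fst s (Spec.map (primeFieldMap p k))).appLE U
        (pullback.fst s (Spec.map (primeFieldMap p k)) ⁻¹ᵁ U) le_rfl)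
      ((Scheme.ΓSpecIso (CommRingCat.of k)).inv ≫
        (pullback.snd s (Spec.map (primeFieldMap p k))).appLE ⊤
          (pullback.fst s (Spec.map (primeFieldMap p k)) ⁻¹ᵁ U) le_top) := by
  have h := (isIso_pushoutSection_iff (IsPullback.of_hasPullback s (Spec.map (primeFieldMap p k)))
    (US := ⊤) (UT := ⊤) (UX := U) (UY := pullback.fst s (Spec.map (primeFieldMap p k)) ⁻¹ᵁ U)
    le_top le_top (by simp)).1 (isIso_pushoutSection_of_isAffineOpen _ _ _ _ (isAffineOpen_top _)
      (isAffineOpen_top _) hU)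
  refine h.of_iso (Scheme.ΓSpecIso _) (Iso.refl _) (Scheme.ΓSpecIso _) (Iso.refl _) ?_ ?_ ?_ ?_
  · simp
  · have h : (Spec.map (primeFieldMap p k)).appLE ⊤ ⊤ le_top =
        (Spec.map (primeFieldMap p k)).appTop := (Scheme.Hom.app_eq_appLE _).symm
    rw [h]
    exact Scheme.ΓSpecIso_naturality _
  · simp
  · simp

end PrimeVariety

end Geometry

/-! ### Digit bases of function fields of varieties -/

namespace PrimeVariety

open AlgebraicGeometry CategoryTheory Limits TopologicalSpace

/-- The function field of a geometrically integral variety of dimension `d` over the prime field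
has a digit basis that involves `d` separating elements. -/
theorem exists_isDigitBasis {p n d : ℕ} [hp : Fact p.Prime] {X : Scheme.{u}}
    (s : X ⟶ Spec (primeField.{u} p)) [GeometricallyIntegral s] [LocallyOfFiniteType s]
    (hd : 1 ≤ d) (hX : topologicalKrullDim X = d) (k : Type u) [Field k] [CharP k p]
    (hk : Module.finrank (frobenius k p).fieldRange k = p ^ n) :
    ∃ (t : ℕ → functionField s k) (b : ℕ → k) (e : ℕ → functionField s k),
      IsDigitBasis (constantMap s k) (p ^ 2) (p ^ (2 * n)) d t b ∧
      ∀ a : ℕ → k, ∑ j ∈ Finset.range (p ^ (2 * n)), constantMap s k (a j) * e j = 0 →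
        ∀ j < p ^ (2 * n), a j = 0 := by
  have : IsIntegral X := GeometricallyIntegral.isIntegral_of_subsingleton s
  obtain ⟨U, hU, hx, -⟩ := exists_isAffineOpen_mem_and_subset (x := genericPoint X) (U := ⊤) trivial
  have : Nonempty U := ⟨⟨_, hx⟩⟩
  let f := pullback.fst s (Spec.map (primeFieldMap p k))
  let V := f ⁻¹ᵁ U
  -- Surjectivity passes to the projection from `X_k` to `X` and makes the preimage `V` of `U`
  -- nonempty.
  have : Surjective (Spec.map (primeFieldMap p k)) :=
    ⟨fun x => ⟨genericPoint _, Subsingleton.elim _ _⟩⟩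
  have hf : Surjective f :=
    inferInstanceAs (Surjective (pullback.fst s (Spec.map (primeFieldMap p k))))
  have : IsAffineHom f :=
    MorphismProperty.of_isPullback (P := @IsAffineHom)
      (IsPullback.of_hasPullback s (Spec.map (primeFieldMap p k))).flip inferInstance
  have hVne : Nonempty V := by
    obtain ⟨y, hy⟩ := hf.surj (genericPoint X)
    exact ⟨⟨y, show f y ∈ U from hy ▸ hx⟩⟩
  have hV : IsAffineOpen V := hU.preimage f
  let := algebraSections s U
  let := algebraFunctionField s
  have := isScalarTower_functionField s U
  have := finiteType_sections s hU
  have := functionField_isFractionRing_of_isAffineOpen X U hU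
  have := functionField_isFractionRing_of_isAffineOpen (baseChange s k) V hV
  have : Algebra.EssFiniteType Γ(X, U) X.functionField :=
    .of_isLocalization _ (nonZeroDivisors Γ(X, U))
  have := Algebra.EssFiniteType.comp (ULift.{u} (ZMod p)) Γ(X, U) X.functionField
  let : Algebra (ULift.{u} (ZMod p)) k := (primeFieldMap p k).hom.toAlgebra
  let c := (Scheme.ΓSpecIso (CommRingCat.of k)).inv ≫
    (pullback.snd s (Spec.map (primeFieldMap p k))).appLE ⊤ V le_top
  let : Algebra k Γ(baseChange s k, V) := c.hom.toAlgebra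
  let : Algebra Γ(X, U) Γ(baseChange s k, V) := (f.appLE U V le_rfl).hom.toAlgebra
  let : Algebra (ULift.{u} (ZMod p)) Γ(baseChange s k, V) :=
    (c.hom.comp (primeFieldMap p k).hom).toAlgebra
  have hpush := isPushout_sections s k U hU
  have : IsScalarTower (ULift.{u} (ZMod p)) k Γ(baseChange s k, V) := .of_algebraMap_eq' rfl
  have : IsScalarTower (ULift.{u} (ZMod p)) Γ(X, U) Γ(baseChange s k, V) :=
    .of_algebraMap_eq' (congrArg CommRingCat.Hom.hom hpush.w.symm)
  have : Algebra.IsPushout (ULift.{u} (ZMod p)) k Γ(X, U) Γ(baseChange s k, V) :=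
    CommRingCat.isPushout_iff_isPushout.1 hpush.flip
  let : Algebra k (functionField s k) := (constantMap s k).toAlgebra
  let φ := algebraMap Γ(baseChange s k, V) (functionField s k)
  have hφ : Function.Injective φ := IsFractionRing.injective _ _
  have hconst : ∀ a, algebraMap k (functionField s k) a =
      φ (algebraMap k Γ(baseChange s k, V) a) := by
    intro a
    have h : (pullback.snd s (Spec.map (primeFieldMap p k))).appLE ⊤ V le_top ≫
        (baseChange s k).germToFunctionField V =
          (pullback.snd s (Spec.map (primeFieldMap p k))).appTop ≫
            (baseChange s k).presheaf.germ ⊤ (genericPoint (baseChange s k)) trivial := by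
      simp only [Scheme.Hom.appLE, Category.assoc]
      exact congrArg _ ((baseChange s k).presheaf.germ_res (homOfLE le_top) _ _)
    exact congrArg (fun g : CommRingCat.of k ⟶ (baseChange s k).functionField => g.hom a)
      (congrArg ((Scheme.ΓSpecIso (CommRingCat.of k)).inv ≫ ·) h.symm)
  have hfrac : ∀ x : functionField s k, ∃ u v : Γ(baseChange s k, V),
      φ v ≠ 0 ∧ x * φ v = φ u := by
    intro x
    obtain ⟨u, v, hv, rfl⟩ := IsFractionRing.div_surjective (A := Γ(baseChange s k, V)) x
    have hv0 : φ v ≠ 0 := (map_ne_zero_iff _ hφ).2 (nonZeroDivisors.ne_zero hv)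
    exact ⟨u, v, hv0, div_mul_cancel₀ _ hv0⟩
  obtain ⟨κ, hκ⟩ := isGenericCompositum_of_isPushout (F := ULift.{u} (ZMod p)) (A := Γ(X, U))
    (K₀ := X.functionField) φ hφ hconst hfrac
  exact hκ.exists_isDigitBasis hd (trdeg_functionField s hX) hk

end PrimeVariety

/-! ### The reduction over function fields -/

open AlgebraicGeometry CategoryTheory RingFormula PrimeVariety in
/-- Over the function field of a variety the translation of a formula expresses the formula
together with the condition that all its free variables are constants. -/
theorem realize_translate_functionField {γ φ : RingFormula} {w p n d : ℕ} [hp : Fact p.Prime]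
    {X : Scheme.{u}} (s : X ⟶ Spec (primeField.{u} p)) [GeometricallyIntegral s]
    [LocallyOfFiniteType s] (hd : 1 ≤ d) (hX : topologicalKrullDim X = d) (k : Type u) [Field k]
    [CharP k p] (hk : Module.finrank (frobenius k p).fieldRange k = p ^ n)
    (hγk : γ.definedSet (functionField s k) = Set.range (constantMap s k))
    (hq : 2 < (p ^ 2) ^ d) (hγ : γ.code < w) (hφ : φ.code < w) (v : ℕ → functionField s k) :
    (translate γ φ (p ^ 2) (p ^ (2 * n)) d w).Realize v ↔
      φ.Realize v ∧ ∀ i ∈ φ.freeVars, v i ∈ γ.definedSet (functionField s k) := by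
  have hp0 := hp.out.pos
  have hN : 0 < p ^ (2 * n) := pow_pos hp0 _
  have : CharP (functionField s k) p := charP_of_injective_ringHom (constantMap s k).injective p
  obtain ⟨t, b, e, h, he⟩ := exists_isDigitBasis s hd hX k hk
  refine realize_translate hN hq hγ hφ ?_ ?_ ?_ ?_ v
  · rw [hγk]
    exact Set.range_nonempty _
  · rw [hγk]
    exact fun t' ht' => (h.of_not_digitDependent hp0 hN ht').exists_digitDecode
  · rw [hγk]
    exact fun t' ht' y z => (h.of_not_digitDependent hp0 hN ht').exists_code hp0 hN hq he y z
  · rw [hγk]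
    exact ⟨t, h.not_digitDependent hp0 hN⟩

open AlgebraicGeometry CategoryTheory RingFormula PrimeVariety in
/-- Here `F` is the fragment `∃`, `∃∀`, `∃∀∃`, ... with `l + 1` alternating blocks. -/
theorem proposition4p6 (l : ℕ) :
    ∃ (τ : ℕ → ℕ → ℕ → RingFormula → RingFormula → RingFormula)
      (f : ℕ × ℕ × ℕ × ℕ × ℕ → ℕ), Computable f ∧
      ∀ (p : ℕ) [Fact p.Prime] (n d : ℕ), 1 ≤ d →
      ∀ γ ∈ existential, γ.freeVars.card ≤ 1 →
        (∀ φ ∈ unbounded .all (alternating .ex (l + 1)),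
          f (p, n, d, γ.code, φ.code) = (τ p n d γ φ).code ∧
          τ p n d γ φ ∈ bracket .all (d + 1) (alternating .ex (l + 1)) ∧
          (τ p n d γ φ).freeVars = φ.freeVars) ∧
        ∀ (X : Scheme.{u}) (s : X ⟶ Spec (primeField.{u} p)) [GeometricallyIntegral s]
          [LocallyOfFiniteType s] [QuasiCompact s], topologicalKrullDim X = (d : WithBot ℕ∞) →
        ∀ (k : Type u) [Field k] [CharP k p],
          Module.finrank (frobenius k p).fieldRange k = p ^ n →
          γ.definedSet (functionField s k) = Set.range (constantMap s k) →
          (∀ φ ∈ unbounded .all (alternating .ex (l + 1)), ∀ v : ℕ → functionField s k,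
            (φ.Realize v ∧ ∀ i ∈ φ.freeVars, v i ∈ γ.definedSet (functionField s k)) ↔
              (τ p n d γ φ).Realize v) ∧
          theoryIn (unbounded .all (alternating .ex (l + 1))) (functionField s k) =
            {φ | φ ∈ unbounded .all (alternating .ex (l + 1)) ∧
              τ p n d γ φ ∈ theoryIn (bracket .all (d + 1) (alternating .ex (l + 1)))
                (functionField s k)} := by
  -- The base variable `γ.code + φ.code + 1` lies above all variables free in `γ` or `φ`.
  refine ⟨fun p n d γ φ => translate γ φ (p ^ 2) (p ^ (2 * n)) d (γ.code + φ.code + 1),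
    fun a => translateCode a.2.2.2.1 a.2.2.2.2 (a.1 ^ 2) (a.1 ^ (2 * a.2.1)) a.2.2.1
      (a.2.2.2.1 + a.2.2.2.2 + 1), ?_, ?_⟩
  · have hp : Primrec fun a : ℕ × ℕ × ℕ × ℕ × ℕ => a.1 := Primrec.fst
    have h1 : Primrec fun a : ℕ × ℕ × ℕ × ℕ × ℕ => a.2 := Primrec.snd
    have hn := Primrec.fst.comp h1
    have h2 := Primrec.snd.comp h1
    have hd := Primrec.fst.comp h2
    have h3 := Primrec.snd.comp h2
    have hg := Primrec.fst.comp h3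
    have hc := Primrec.snd.comp h3
    exact (primrec_translateCode hg hc (hp.pow (Primrec.const 2))
      (hp.pow ((Primrec.const 2).mul hn)) hd ((hg.add hc).add (Primrec.const 1))).to_comp
  · intro p hp n d hd γ hγ _
    have hN : 0 < p ^ (2 * n) := pow_pos hp.out.pos _
    -- Room for the three blocks of a code.
    have hq : 2 < (p ^ 2) ^ d := calc
      2 < 2 ^ 2 := by norm_num
      _ ≤ p ^ 2 := Nat.pow_le_pow_left hp.out.two_le 2
      _ ≤ (p ^ 2) ^ d := Nat.le_self_pow (by omega) _
    have hγw : ∀ φ : RingFormula, γ.code < γ.code + φ.code + 1 := fun _ => by omega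
    have hφw : ∀ φ : RingFormula, φ.code < γ.code + φ.code + 1 := fun _ => by omega
    have hmem : ∀ φ ∈ unbounded .all (alternating .ex (l + 1)),
        translate γ φ (p ^ 2) (p ^ (2 * n)) d (γ.code + φ.code + 1) ∈
          bracket .all (d + 1) (alternating .ex (l + 1)) := fun φ hφ =>
      translate_mem_bracket (isExistentialFragment_alternating l)
        (subformulaClosed_alternating _ _) (existential_subset_alternating l hγ) hφ _ _ _ _
    refine ⟨fun φ hφ => ⟨(code_translate _ _ _ _ _ _).symm, hmem φ hφ,
      freeVars_translate hN hq (hγw φ) (hφw φ)⟩, fun X s _ _ _ hX k _ _ hk hγk => ?_⟩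
    have hreal : ∀ (φ : RingFormula) (v : ℕ → functionField s k),
        (translate γ φ (p ^ 2) (p ^ (2 * n)) d (γ.code + φ.code + 1)).Realize v ↔
          φ.Realize v ∧ ∀ i ∈ φ.freeVars, v i ∈ γ.definedSet (functionField s k) := fun φ v =>
      realize_translate_functionField s hd hX k hk hγk hq (hγw φ) (hφw φ) v
    refine ⟨fun φ _ v => (hreal φ v).symm, Set.ext fun φ => ?_⟩
    constructor
    · rintro ⟨hφ, hfree, hall⟩
      refine ⟨hφ, hmem φ hφ, (freeVars_translate hN hq (hγw φ) (hφw φ)).trans hfree, fun v => ?_⟩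
      -- A sentence has no free variables, so the condition that they be constants is empty.
      refine (hreal φ v).2 ⟨hall v, fun i hi => ?_⟩
      simp [hfree] at hi
    · rintro ⟨hφ, _, hfree, hall⟩
      exact ⟨hφ, (freeVars_translate hN hq (hγw φ) (hφw φ)).symm.trans hfree,
        fun v => ((hreal φ v).1 (hall v)).1⟩
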